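/- Let $H_{\mathbf R}$ be a separable real Hilbert space and let $(U_t)_{t\in\mathbf R}$ be a strongly continuous orthogonal representation of $\mathbf R$ on $H_{\mathbf R}$ that is mixing: $\langle U_t\xi,\eta\rangle\to 0$ as $|t|\to\infty$, for all $\xi,\eta\in H_{\mathbf R}$. Extend $U_t$ to the complexification $H_{\mathbf C}$, write $U_t=A^{it}$ with $A$ positive self-adjoint, and let $H$ be the completion of $H_{\mathbf C}$ for the inner product $\langle\xi,\eta\rangle_U=\langle \frac{2}{1+A^{-1}}\xi,\eta\rangle$ (inner products are linear in the first variable). On the full Fock space $\mathcal F(H)=\mathbf C\Omega\oplus\bigoplus_{n\ge1}H^{\bar\otimes n}$, with left creation operators $\ell(\xi)$, put $s(\xi)=\frac12(\ell(\xi)+\ell(\xi)^*)$. Let $\mathcal M=\Gamma(H_{\mathbf R},U_t)''=\{s(\xi):\xi\in H_{\mathbf R}\}''$ be the free Araki–Woods von Neumann algebra, $\varphi=\langle\,\cdot\,\Omega,\Omega\rangle$ its free quasi-free state, and $\sigma_t=\operatorname{Ad}\mathcal F(U_{-t})$ its modular group, where $\mathcal F(U_t)=\bigoplus_n U_t^{\otimes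 n}$. Let $M=\mathcal M\rtimes_\sigma\mathbf R$ be the continuous core, i.e. the von Neumann algebra on $L^2(\mathbf R,\mathcal F(H))$ generated by the operators $(\pi_\sigma(x)\xi)(t)=\sigma_{-t}(x)\xi(t)$, $x\in\mathcal M$, and $(\lambda_s\xi)(t)=\xi(t-s)$, $s\in\mathbf R$, and let $L(\mathbf R)=\{\lambda_s:s\in\mathbf R\}''\subset M$. Let $E:M\to L(\mathbf R)$ be the conditional expectation with $E(\pi_\sigma(x)\lambda_s)=\varphi(x)\lambda_s$, and let $\operatorname{Tr}$ be the canonical faithful normal semifinite trace of $M$ associated with $\varphi$: $\operatorname{Tr}(x)=\int_{\mathbf R}E(x)(p)\,e^{2\pi p}\,dp$ for $x\in M_+$, where $L(\mathbf R)$ is identified with $L^\infty(\mathbf R)$ by the Fourier transform, so that $\lambda_s$ is the function $e^{-2\pi i s p}$. Let $k\ge1$, let $\operatorname{Tr}_k$ be the non-normalized trace on $\mathbf M_k(\mathbf C)$, and let $q\in\mathbf M_k(\mathbf C)\otimes L(\mathbf R)$ be a non-zero projection such that $T:=(\operatorname{Tr}_k\otimes\operatorname{Tr})(q)<\infty$.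 Write $L(\mathbf R)^T:=q(\mathbf M_k(\mathbf C)\otimes L(\mathbf R))q$ and $M^T:=q(\mathbf M_k(\mathbf C)\otimes M)q$, with the trace $\operatorname{Tr}_k\otimes\operatorname{Tr}$. Let $A\subset L(\mathbf R)^T$ be a diffuse von Neumann subalgebra with unit $q$. Then every (closed) $A$–$L(\mathbf R)^T$ sub-bimodule $K$ of $L^2(M^T)$ such that $\dim(K_{L(\mathbf R)^T})<\infty$ is contained in $L^2(L(\mathbf R)^T)$. In particular $A'\cap M^T\subset L(\mathbf R)^T$. Here, for $B=L(\mathbf R)^T$, $\dim(K_B)=\operatorname{Tr}(vv^*)$ for any right $B$-linear isometry $v:K\to\ell^2\bar\otimes L^2(B)$, where $\operatorname{Tr}([y_{ij}])=\sum_i\tau(y_{ii})$ on $\mathbf B(\ell^2)\bar\otimes B$ and $\tau$ is the trace on $B$. -/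

import Mathlib

open MeasureTheory Filter Topology
open scoped ENNReal InnerProductSpace ComplexOrder

noncomputable section

/-! ### Extending operators to completions -/

/-- The bounded operator on the Hausdorff completion of `E` that extends a linear map `T` on `E`
with `‖T x‖ ≤ C ‖x‖`. -/
def complMap {E : Type*} [SeminormedAddCommGroup E] [InnerProductSpace ℂ E] (T : E →ₗ[ℂ] E)
    (C : ℝ) (hT : ∀ x, ‖T x‖ ≤ C * ‖x‖) :
    UniformSpace.Completion E →L[ℂ] UniformSpace.Completion E :=
  ((UniformSpace.Completion.toComplL (𝕜 := ℂ) (E := E)).comp (T.mkContinuous C hT)).extend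
    (UniformSpace.Completion.toComplL (𝕜 := ℂ) (E := E))

theorem complMap_coe {E : Type*} [SeminormedAddCommGroup E] [InnerProductSpace ℂ E]
    (T : E →ₗ[ℂ] E) (C : ℝ) (hT : ∀ x, ‖T x‖ ≤ C * ‖x‖) (x : E) :
    complMap T C hT (x : UniformSpace.Completion E) = (T x : UniformSpace.Completion E) :=
  ContinuousLinearMap.extend_eq
    ((UniformSpace.Completion.toComplL (𝕜 := ℂ) (E := E)).comp (T.mkContinuous C hT))
    (UniformSpace.Completion.denseRange_coe)
    (UniformSpace.Completion.isUniformInducing_coe E) x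

/-! ### The Hilbert space of a positive semidefinite kernel -/

/-- A positive semidefinite kernel on a set `X`. -/
structure PosKernel (X : Type*) where
  /-- the kernel -/
  ker : Matrix X X ℂ
  posSemidef : ker.PosSemidef

namespace PosKernel

variable {X : Type*}

/-- The free complex vector space on `X`; its basis vectors are the point masses. -/
def Pre (_κ : PosKernel X) : Type _ := X →₀ ℂ

instance (κ : PosKernel X) : AddCommGroup κ.Pre := inferInstanceAs (AddCommGroup (X →₀ ℂ))

instance (κ : PosKernel X) : Module ℂ κ.Pre := inferInstanceAs (Module ℂ (X →₀ ℂ))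

/-- The point mass at `x`. -/
def preDelta (κ : PosKernel X) (x : X) : κ.Pre := (Finsupp.single x 1 : X →₀ ℂ)

/-- The sesquilinear form on the free vector space with `⟨δ x, δ y⟩ = K x y`. -/
def form (K : Matrix X X ℂ) (f g : X →₀ ℂ) : ℂ :=
  f.sum fun x z => g.sum fun y w => star z * K x y * w

theorem form_mapDomain (K : Matrix X X ℂ) (g : X → X) (c : ℂ)
    (h : ∀ x y, K (g x) (g y) = c * K x y) (f f' : X →₀ ℂ) :
    form K (f.mapDomain g) (f'.mapDomain g) = c * form K f f' := by
  rw [form, form, Finsupp.sum_mapDomain_index (by simp)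
    (by intros; simp [← Finsupp.sum_add, add_mul]), Finsupp.mul_sum]
  refine Finsupp.sum_congr fun x _ => ?_
  rw [Finsupp.sum_mapDomain_index (by simp) (by intros; simp [mul_add]), Finsupp.mul_sum]
  refine Finsupp.sum_congr fun y _ => ?_
  rw [h]; ring

theorem form_conj {K : Matrix X X ℂ} (hK : K.PosSemidef) (f g : X →₀ ℂ) :
    (starRingEnd ℂ) (form K g f) = form K f g := by
  rw [form, form, Finsupp.sum_comm]
  simp only [map_finsuppSum]
  refine Finsupp.sum_congr fun x _ => Finsupp.sum_congr fun y _ => ?_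
  have h := hK.isHermitian.apply x y
  rw [← h]
  simp only [starRingEnd_apply, star_mul, star_star]
  ring

theorem form_add_left (K : Matrix X X ℂ) (f g h : X →₀ ℂ) :
    form K (f + g) h = form K f h + form K g h := by
  rw [form, Finsupp.sum_add_index' (by simp)
    (by intros; simp [← Finsupp.sum_add, add_mul])]
  rfl

theorem form_smul_left (K : Matrix X X ℂ) (f g : X →₀ ℂ) (r : ℂ) :
    form K (r • f) g = (starRingEnd ℂ) r * form K f g := by
  rw [form, Finsupp.sum_smul_index (by simp), form]
  simp [Finsupp.mul_sum, mul_assoc]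

/-- The semi-inner product with `⟪δ x, δ y⟫ = κ x y` on the free vector space. -/
abbrev core (κ : PosKernel X) : PreInnerProductSpace.Core ℂ κ.Pre where
  inner f g := form κ.ker f g
  conj_inner_symm f g := form_conj κ.posSemidef f g
  re_inner_nonneg f := (Complex.nonneg_iff.1 (κ.posSemidef.2 f)).1
  add_left f g h := form_add_left κ.ker f g h
  smul_left f g r := form_smul_left κ.ker f g r

instance (κ : PosKernel X) : SeminormedAddCommGroup κ.Pre :=
  @InnerProductSpace.Core.toSeminormedAddCommGroup ℂ κ.Pre _ _ _ κ.core

instance (κ : PosKernel X) : InnerProductSpace ℂ κ.Pre := InnerProductSpace.ofCore κ.core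

theorem inner_pre (κ : PosKernel X) (f g : κ.Pre) : ⟪f, g⟫_ℂ = form κ.ker f g := rfl

/-- The Hilbert space generated by vectors `δ x`, `x ∈ X`, with `⟪δ x, δ y⟫ = κ x y`: the
completion (after division by null vectors) of the free vector space on `X`. -/
abbrev Space (κ : PosKernel X) : Type _ := UniformSpace.Completion κ.Pre

/-- The generating vectors. -/
def delta (κ : PosKernel X) (x : X) : κ.Space := (κ.preDelta x : UniformSpace.Completion κ.Pre)

theorem inner_delta (κ : PosKernel X) (x y : X) : ⟪κ.delta x, κ.delta y⟫_ℂ = κ.ker x y := by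
  rw [delta, delta, UniformSpace.Completion.inner_coe, inner_pre, preDelta, preDelta, form]
  simp

/-- The linear map on the free vector space with `δ x ↦ δ (g x)`. -/
def preMap (κ : PosKernel X) (g : X → X) : κ.Pre →ₗ[ℂ] κ.Pre :=
  (Finsupp.lmapDomain ℂ ℂ g : (X →₀ ℂ) →ₗ[ℂ] (X →₀ ℂ))

theorem norm_preMap_le (κ : PosKernel X) (g : X → X) (c : ℝ) (hc : 0 ≤ c)
    (h : ∀ x y, κ.ker (g x) (g y) = (c : ℂ) ^ 2 * κ.ker x y) (f : κ.Pre) :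
    ‖κ.preMap g f‖ ≤ c * ‖f‖ := by
  have key : ⟪κ.preMap g f, κ.preMap g f⟫_ℂ = (c : ℂ) ^ 2 * ⟪f, f⟫_ℂ :=
    form_mapDomain κ.ker g _ h f f
  rw [inner_self_eq_norm_sq_to_K, inner_self_eq_norm_sq_to_K] at key
  have key' : ‖κ.preMap g f‖ ^ 2 = (c * ‖f‖) ^ 2 := by
    rw [mul_pow]
    apply Complex.ofReal_injective
    simpa using key
  exact (abs_le_of_sq_le_sq' key'.le (by positivity)).2

/-- The bounded operator with `δ x ↦ δ (g x)`, where `κ (g x) (g y) = c² κ x y`. -/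
def map (κ : PosKernel X) (g : X → X) (c : ℝ) (hc : 0 ≤ c)
    (h : ∀ x y, κ.ker (g x) (g y) = (c : ℂ) ^ 2 * κ.ker x y) : κ.Space →L[ℂ] κ.Space :=
  complMap (κ.preMap g) c (κ.norm_preMap_le g c hc h)

theorem map_delta (κ : PosKernel X) (g : X → X) (c : ℝ) (hc : 0 ≤ c)
    (h : ∀ x y, κ.ker (g x) (g y) = (c : ℂ) ^ 2 * κ.ker x y) (x : X) :
    κ.map g c hc h (κ.delta x) = κ.delta (g x) := by
  rw [map, delta, complMap_coe, delta]
  congr 1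
  exact Finsupp.mapDomain_single

end PosKernel

/-! ### The full Fock space -/

section Fock

variable {H : Type*} [NormedAddCommGroup H] [InnerProductSpace ℂ H]

/-- `⟨ξ₁ ⊗ ⋯ ⊗ ξₙ, η₁ ⊗ ⋯ ⊗ ηₘ⟩`, which is `∏ ⟨ξᵢ, ηᵢ⟩` if `n = m` and `0` otherwise. -/
def wordInner : List H → List H → ℂ
  | [], [] => 1
  | ξ :: v, η :: w => ⟪ξ, η⟫_ℂ * wordInner v w
  | [], _ :: _ => 0
  | _ :: _, [] => 0

theorem gram_posSemidef {ι E : Type*} [NormedAddCommGroup E] [InnerProductSpace ℂ E] (v : ι → E) :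
    (Matrix.of fun i j => ⟪v i, v j⟫_ℂ).PosSemidef := by
  refine ⟨?_, fun f => ?_⟩
  · ext i j
    exact inner_conj_symm (v i) (v j)
  · have h : (f.sum fun i a => f.sum fun j b => star a * ⟪v i, v j⟫_ℂ * b)
        = ⟪f.sum fun i a => a • v i, f.sum fun j b => b • v j⟫_ℂ := by
      simp only [Finsupp.sum]
      rw [sum_inner]
      refine Finset.sum_congr rfl fun i _ => ?_
      rw [inner_sum]
      refine Finset.sum_congr rfl fun j _ => ?_
      rw [inner_smul_left, inner_smul_right, RCLike.star_def]
      ring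
    change 0 ≤ f.sum fun i a => f.sum fun j b => star a * ⟪v i, v j⟫_ℂ * b
    rw [h, inner_self_eq_norm_sq_to_K]
    exact Complex.nonneg_iff.2 ⟨by simp [← Complex.ofReal_pow], by simp [← Complex.ofReal_pow]⟩

theorem wordInner_posSemidef_aux (n : ℕ) :
    (Matrix.of fun v w : {v : List H // v.length ≤ n} => wordInner v.1 w.1).PosSemidef := by
  classical
  induction n with
  | zero =>
    have h := gram_posSemidef (fun _ : {v : List H // v.length ≤ 0} => (1 : ℂ))
    refine (congrArg Matrix.PosSemidef (?_ : _ = _)).mpr h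
    ext ⟨v, hv⟩ ⟨w, hw⟩
    obtain rfl : v = [] := by simpa using hv
    obtain rfl : w = [] := by simpa using hw
    simp [wordInner]
  | succ n ih =>
    let tl : {v : List H // v.length ≤ n + 1} → {v : List H // v.length ≤ n} :=
      fun v => ⟨v.1.tail, by have := v.2; rw [List.length_tail]; omega⟩
    have h1 := gram_posSemidef
      (fun v : {v : List H // v.length ≤ n + 1} => if v.1 = [] then (1 : ℂ) else 0)
    have h2 := gram_posSemidef
      (fun v : {v : List H // v.length ≤ n + 1} => v.1.headD 0)
    have h3 := gram_posSemidef
      (fun v : {v : List H // v.length ≤ n + 1} => if v.1 = [] then (0 : ℂ) else 1)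
    have h4 := h1.add (h3.hadamard (h2.hadamard (ih.submatrix tl)))
    refine (congrArg Matrix.PosSemidef (?_ : _ = _)).mpr h4
    ext ⟨v, hv⟩ ⟨w, hw⟩
    cases v <;> cases w <;> simp [wordInner, tl]

variable (H) in
theorem wordInner_posSemidef : (Matrix.of fun v w : List H => wordInner v w).PosSemidef := by
  classical
  refine ⟨?_, fun f => ?_⟩
  · ext v w
    have h := (wordInner_posSemidef_aux (H := H) (max v.length w.length)).isHermitian.apply
      ⟨v, le_max_left _ _⟩ ⟨w, le_max_right _ _⟩
    exact h
  · obtain ⟨n, hn⟩ : ∃ n, ∀ v ∈ f.support, v.length ≤ n :=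
      ⟨f.support.sup List.length, fun v hv => Finset.le_sup (f := List.length) hv⟩
    have h := (wordInner_posSemidef_aux (H := H) n).2
      (f.comapDomain (Subtype.val) Subtype.val_injective.injOn)
    have hc : f = (f.comapDomain (Subtype.val : {v : List H // v.length ≤ n} → List H)
        Subtype.val_injective.injOn).mapDomain Subtype.val := by
      refine (Finsupp.mapDomain_comapDomain _ Subtype.val_injective _ ?_).symm
      intro v hv
      exact ⟨⟨v, hn v hv⟩, rfl⟩
    rw [hc, Finsupp.sum_mapDomain_index (by simp) (by intros; simp [← Finsupp.sum_add, add_mul])]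
    convert h using 1
    refine Finsupp.sum_congr fun v _ => ?_
    rw [Finsupp.sum_mapDomain_index (by simp) (by intros; simp [mul_add])]
    rfl

variable (H) in
/-- The kernel of the full Fock space over `H`, on the set of words `(ξ₁, …, ξₙ)` in `H`. -/
def fockKernel : PosKernel (List H) where
  ker := Matrix.of fun v w => wordInner v w
  posSemidef := wordInner_posSemidef H

variable (H) in
/-- The full Fock space `ℂ Ω ⊕ ⨁_{n ≥ 1} H^{⊗ n}` (Hilbert space direct sum and tensor powers):
the Hilbert space generated by the elementary tensors `ξ₁ ⊗ ⋯ ⊗ ξₙ`, with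
`⟨ξ₁ ⊗ ⋯ ⊗ ξₙ, η₁ ⊗ ⋯ ⊗ ηₘ⟩ = ∏ ⟨ξᵢ, ηᵢ⟩` if `n = m`, and `0` if `n ≠ m`. -/
abbrev Fock : Type _ := (fockKernel H).Space

/-- The elementary tensor `ξ₁ ⊗ ⋯ ⊗ ξₙ`; the empty one is the vacuum. -/
def tensorWord (w : List H) : Fock H := (fockKernel H).delta w

variable (H) in
/-- The vacuum vector `Ω`. -/
def vacuum : Fock H := tensorWord []

theorem inner_tensorWord (v w : List H) :
    ⟪tensorWord v, tensorWord w⟫_ℂ = wordInner v w :=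
  (fockKernel H).inner_delta v w

/-- The left creation operator: `ℓ(ξ) Ω = ξ`, `ℓ(ξ) (ξ₁ ⊗ ⋯ ⊗ ξₙ) = ξ ⊗ ξ₁ ⊗ ⋯ ⊗ ξₙ`. -/
def creation (ξ : H) : Fock H →L[ℂ] Fock H :=
  (fockKernel H).map (fun w => ξ :: w) ‖ξ‖ (norm_nonneg ξ) (fun v w => by
    change ⟪ξ, ξ⟫_ℂ * wordInner v w = (‖ξ‖ : ℂ) ^ 2 * wordInner v w
    rw [inner_self_eq_norm_sq_to_K]; rfl)

theorem creation_tensorWord (ξ : H) (w : List H) :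
    creation ξ (tensorWord w) = tensorWord (ξ :: w) :=
  (fockKernel H).map_delta _ _ _ _ w

/-- `s(ξ) = (ℓ(ξ) + ℓ(ξ)^*) / 2`. -/
def semicircular (ξ : H) : Fock H →L[ℂ] Fock H :=
  (1 / 2 : ℂ) • (creation ξ + ContinuousLinearMap.adjoint (creation ξ))

/-- The second quantization `𝓕(V) = ⨁ V^{⊗ n}` of an isometry `V`:
`𝓕(V) (ξ₁ ⊗ ⋯ ⊗ ξₙ) = V ξ₁ ⊗ ⋯ ⊗ V ξₙ`. -/
def secondQuant (V : H →L[ℂ] H) (hV : ∀ ξ η, ⟪V ξ, V η⟫_ℂ = ⟪ξ, η⟫_ℂ) : Fock H →L[ℂ] Fock H :=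
  (fockKernel H).map (fun w => w.map V) 1 zero_le_one (fun v w => by
    change wordInner (v.map V) (w.map V) = ((1 : ℝ) : ℂ) ^ 2 * wordInner v w
    induction v generalizing w with
    | nil => cases w <;> simp [wordInner]
    | cons a v ih =>
      cases w with
      | nil => simp [wordInner]
      | cons b w =>
        have := ih w
        simp only [Complex.ofReal_one, one_pow, one_mul] at this ⊢
        simp [wordInner, this, hV])

theorem secondQuant_tensorWord (V : H →L[ℂ] H) (hV : ∀ ξ η, ⟪V ξ, V η⟫_ℂ = ⟪ξ, η⟫_ℂ)
    (w : List H) : secondQuant V hV (tensorWord w) = tensorWord (w.map V) :=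
  (fockKernel H).map_delta _ _ _ _ w

end Fock

/-! ### Complexification of a real Hilbert space -/

/-- The complexification `H ⊗_ℝ ℂ` of a real Hilbert space; `(a, b)` stands for `a + i b`. -/
def Cplx (H : Type*) : Type _ := WithLp 2 (H × H)

namespace Cplx

variable {H : Type*}

/-- The vector `a + i b`. -/
def mk (a b : H) : Cplx H := WithLp.toLp 2 (a, b)

/-- The real part. -/
def re (x : Cplx H) : H := WithLp.fst (p := 2) x

/-- The imaginary part. -/
def im (x : Cplx H) : H := WithLp.snd (p := 2) x

@[simp] theorem re_mk (a b : H) : (mk a b).re = a := rfl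

@[simp] theorem im_mk (a b : H) : (mk a b).im = b := rfl

theorem ext {x y : Cplx H} (h1 : x.re = y.re) (h2 : x.im = y.im) : x = y :=
  WithLp.ofLp_injective 2 (Prod.ext h1 h2)

variable [NormedAddCommGroup H]

instance : NormedAddCommGroup (Cplx H) := inferInstanceAs (NormedAddCommGroup (WithLp 2 (H × H)))

instance [CompleteSpace H] : CompleteSpace (Cplx H) :=
  inferInstanceAs (CompleteSpace (WithLp 2 (H × H)))

@[simp] theorem re_add (x y : Cplx H) : (x + y).re = x.re + y.re := rfl

@[simp] theorem im_add (x y : Cplx H) : (x + y).im = x.im + y.im := rfl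

@[simp] theorem re_zero : (0 : Cplx H).re = 0 := rfl

@[simp] theorem im_zero : (0 : Cplx H).im = 0 := rfl

theorem norm_sq (x : Cplx H) : ‖x‖ ^ 2 = ‖x.re‖ ^ 2 + ‖x.im‖ ^ 2 :=
  WithLp.prod_norm_sq_eq_of_L2 (α := H) (β := H) x

variable [InnerProductSpace ℝ H]

instance : SMul ℂ (Cplx H) :=
  ⟨fun z x => mk (z.re • x.re - z.im • x.im) (z.re • x.im + z.im • x.re)⟩

@[simp] theorem re_smul (z : ℂ) (x : Cplx H) : (z • x).re = z.re • x.re - z.im • x.im := rfl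

@[simp] theorem im_smul (z : ℂ) (x : Cplx H) : (z • x).im = z.re • x.im + z.im • x.re := rfl

instance : Module ℂ (Cplx H) where
  one_smul x := by apply ext <;> simp
  mul_smul z w x := by
    apply ext <;> simp only [re_smul, im_smul, Complex.mul_re, Complex.mul_im] <;> module
  smul_zero z := by apply ext <;> simp
  smul_add z x y := by
    apply ext <;> simp only [re_smul, im_smul, re_add, im_add] <;> module
  add_smul z w x := by
    apply ext <;> simp only [re_smul, im_smul, re_add, im_add, Complex.add_re, Complex.add_im] <;>
      module
  zero_smul x := by apply ext <;> simp

/-- `⟨a + i b, c + i d⟩ = ⟨a, c⟩ + ⟨b, d⟩ + i (⟨a, d⟩ - ⟨b, c⟩)`, antilinear in the first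
variable. -/
instance : Inner ℂ (Cplx H) :=
  ⟨fun x y => ⟨⟪x.re, y.re⟫_ℝ + ⟪x.im, y.im⟫_ℝ, ⟪x.re, y.im⟫_ℝ - ⟪x.im, y.re⟫_ℝ⟩⟩

theorem inner_def (x y : Cplx H) : ⟪x, y⟫_ℂ =
    ⟨⟪x.re, y.re⟫_ℝ + ⟪x.im, y.im⟫_ℝ, ⟪x.re, y.im⟫_ℝ - ⟪x.im, y.re⟫_ℝ⟩ := rfl

instance : InnerProductSpace ℂ (Cplx H) where
  norm_smul_le z x := by
    have h : ‖z • x‖ ^ 2 = (‖z‖ * ‖x‖) ^ 2 := by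
      rw [mul_pow, norm_sq, norm_sq, Complex.sq_norm, Complex.normSq_apply, re_smul, im_smul,
        norm_sub_sq_real, norm_add_sq_real]
      simp only [norm_smul, inner_smul_left, inner_smul_right, mul_pow, Real.norm_eq_abs, sq_abs,
        real_inner_comm x.re x.im]
      simp
      ring
    exact (abs_le_of_sq_le_sq' h.le (by positivity)).2
  norm_sq_eq_re_inner x := by
    rw [norm_sq, inner_def]
    simp
  conj_inner_symm x y := by
    rw [inner_def, inner_def]
    apply Complex.ext <;> simp [real_inner_comm]
  add_left x y z := by
    simp only [inner_def]
    apply Complex.ext <;> simp [inner_add_left] <;> ring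
  smul_left x y r := by
    simp only [inner_def]
    apply Complex.ext <;> simp [inner_sub_left, inner_add_left, inner_smul_left] <;> ring

end Cplx

/-! ### Orthogonal representations of `ℝ` and the deformed inner product -/

/-- A strongly continuous orthogonal representation `(U_t)` of `ℝ` on a real Hilbert space. -/
structure OrthRep (H : Type*) [NormedAddCommGroup H] [InnerProductSpace ℝ H] where
  /-- the orthogonal operators `U_t` -/
  op : ℝ → (H ≃ₗᵢ[ℝ] H)
  op_add : ∀ s t ξ, op (s + t) ξ = op s (op t ξ)
  continuous_op : ∀ ξ, Continuous fun t => op t ξ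

namespace OrthRep

variable {H : Type*} [NormedAddCommGroup H] [InnerProductSpace ℝ H]

/-- `(U_t)` is mixing: `⟨U_t ξ, η⟩ → 0` as `|t| → ∞`. -/
def IsMixing (U : OrthRep H) : Prop :=
  ∀ ξ η : H, Tendsto (fun t => ⟪U.op t ξ, η⟫_ℝ) (cocompact ℝ) (𝓝 0)

/-- The complexified operators `U_t` on `H_ℂ`. -/
def cop (U : OrthRep H) (t : ℝ) : Cplx H →ₗᵢ[ℂ] Cplx H where
  toFun x := Cplx.mk (U.op t x.re) (U.op t x.im)
  map_add' x y := by apply Cplx.ext <;> simp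
  map_smul' z x := by apply Cplx.ext <;> simp
  norm_map' x := by
    have h : ‖Cplx.mk (U.op t x.re) (U.op t x.im)‖ ^ 2 = ‖x‖ ^ 2 := by
      rw [Cplx.norm_sq, Cplx.norm_sq]; simp
    exact (sq_eq_sq₀ (norm_nonneg _) (norm_nonneg _)).1 h

theorem cop_add (U : OrthRep H) (s t : ℝ) (x : Cplx H) :
    U.cop (s + t) x = U.cop s (U.cop t x) := by
  apply Cplx.ext <;> simp [cop, U.op_add]

theorem cop_comm (U : OrthRep H) (s t : ℝ) (x : Cplx H) :
    U.cop s (U.cop t x) = U.cop t (U.cop s x) := by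
  rw [← cop_add, ← cop_add, add_comm]

/-- `μ` is the spectral measure at `ξ` of `log A`, where `A` is the positive self-adjoint operator
on `H_ℂ` with `U_t = A^{it}` (Stone's theorem): it is the finite measure on `ℝ` with
`⟨U_t ξ, ξ⟩ = ∫ e^{itx} dμ(x)` for all `t`. -/
def IsSpectralMeasure (U : OrthRep H) (ξ : Cplx H) (μ : Measure ℝ) : Prop :=
  IsFiniteMeasure μ ∧ ∀ t : ℝ, ⟪ξ, U.cop t ξ⟫_ℂ = ∫ x : ℝ, Complex.exp (t * x * Complex.I) ∂μ

/-- `B` is the bounded operator `2 / (1 + A⁻¹)`, by functional calculus of `A`: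
`⟨B ξ, ξ⟩ = ∫ 2 / (1 + e^{-x}) dμ_ξ(x)`, where `μ_ξ` is the spectral measure of `log A` at `ξ`. -/
def IsDeformation (U : OrthRep H) (B : Cplx H →L[ℂ] Cplx H) : Prop :=
  ∀ ξ, ∃ μ : Measure ℝ, U.IsSpectralMeasure ξ μ ∧
    ⟪ξ, B ξ⟫_ℂ = ((∫ x : ℝ, 2 / (1 + Real.exp (-x)) ∂μ : ℝ) : ℂ)

open scoped Classical in
/-- The operator `2 / (1 + A⁻¹)` on `H_ℂ`, where `U_t = A^{it}`. It exists by Stone's theorem and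
the spectral theorem, and it is unique because a measure is determined by its Fourier transform and
an operator by its quadratic form. -/
def deformation (U : OrthRep H) : Cplx H →L[ℂ] Cplx H :=
  if h : ∃ B, U.IsDeformation B then h.choose else 0

theorem IsSpectralMeasure.eq {U : OrthRep H} {ξ η : Cplx H} {μ ν : Measure ℝ}
    (hμ : U.IsSpectralMeasure ξ μ) (hν : U.IsSpectralMeasure η ν)
    (h : ∀ t, ⟪ξ, U.cop t ξ⟫_ℂ = ⟪η, U.cop t η⟫_ℂ) : μ = ν := by
  have := hμ.1
  have := hν.1
  refine Measure.ext_of_charFun (funext fun t => ?_)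
  rw [charFun_apply_real, charFun_apply_real, ← hμ.2, ← hν.2, h]

theorem deformation_real (U : OrthRep H) (ξ : Cplx H) :
    ∃ r : ℝ, 0 ≤ r ∧ ⟪ξ, U.deformation ξ⟫_ℂ = r := by
  unfold deformation
  split_ifs with h
  · obtain ⟨μ, -, hμ⟩ := h.choose_spec ξ
    exact ⟨_, integral_nonneg fun x => by positivity, hμ⟩
  · exact ⟨0, le_rfl, by simp⟩

theorem deformation_invariant (U : OrthRep H) (s : ℝ) (ξ : Cplx H) :
    ⟪U.cop s ξ, U.deformation (U.cop s ξ)⟫_ℂ = ⟪ξ, U.deformation ξ⟫_ℂ := by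
  unfold deformation
  split_ifs with h
  · obtain ⟨μ, hμ, hμ'⟩ := h.choose_spec ξ
    obtain ⟨ν, hν, hν'⟩ := h.choose_spec (U.cop s ξ)
    rw [hμ', hν', hν.eq hμ fun t => ?_]
    rw [U.cop_comm t s, LinearIsometry.inner_map_map]
  · simp

/-- `H_ℂ` as a space with the deformed inner product. -/
def Pre (_U : OrthRep H) : Type _ := Cplx H

instance (U : OrthRep H) : AddCommGroup U.Pre := inferInstanceAs (AddCommGroup (Cplx H))

instance (U : OrthRep H) : Module ℂ U.Pre := inferInstanceAs (Module ℂ (Cplx H))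

theorem deformation_symm (U : OrthRep H) (ξ η : Cplx H) :
    ⟪U.deformation ξ, η⟫_ℂ = ⟪ξ, U.deformation η⟫_ℂ := by
  have h : (U.deformation : Cplx H →ₗ[ℂ] Cplx H).IsSymmetric := by
    rw [LinearMap.isSymmetric_iff_inner_map_self_real]
    intro v
    obtain ⟨r, -, hr⟩ := U.deformation_real v
    have h2 : ⟪U.deformation v, v⟫_ℂ = r := by
      rw [← inner_conj_symm, hr, Complex.conj_ofReal]
    change (starRingEnd ℂ) ⟪U.deformation v, v⟫_ℂ = ⟪U.deformation v, v⟫_ℂ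
    rw [h2, Complex.conj_ofReal]
  exact h ξ η

/-- The deformed inner product `⟨ξ, η⟩_U = ⟨2 / (1 + A⁻¹) ξ, η⟩` on `H_ℂ`. -/
abbrev core (U : OrthRep H) : PreInnerProductSpace.Core ℂ U.Pre where
  inner ξ η := inner ℂ (E := Cplx H) ξ (U.deformation η)
  conj_inner_symm ξ η := by
    exact (inner_conj_symm (E := Cplx H) (U.deformation ξ) η).trans (U.deformation_symm ξ η)
  re_inner_nonneg ξ := by
    obtain ⟨r, h0, hr⟩ := U.deformation_real ξ
    rw [hr]
    simpa using h0
  add_left ξ η ζ := inner_add_left (E := Cplx H) ξ η _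
  smul_left ξ η r := inner_smul_left (E := Cplx H) ξ _ r

instance (U : OrthRep H) : SeminormedAddCommGroup U.Pre :=
  @InnerProductSpace.Core.toSeminormedAddCommGroup ℂ U.Pre _ _ _ U.core

instance (U : OrthRep H) : InnerProductSpace ℂ U.Pre := InnerProductSpace.ofCore U.core

theorem inner_pre (U : OrthRep H) (ξ η : U.Pre) :
    ⟪ξ, η⟫_ℂ = inner ℂ (E := Cplx H) ξ (U.deformation η) := rfl

/-- The complex Hilbert space `H`: the completion of `H_ℂ` for `⟨·, ·⟩_U`. -/
abbrev Space (U : OrthRep H) : Type _ := UniformSpace.Completion U.Pre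

/-- The inclusion `H_ℝ ⊂ H`. -/
def incl (U : OrthRep H) (ξ : H) : U.Space :=
  let x : U.Pre := Cplx.mk ξ 0
  (x : UniformSpace.Completion U.Pre)

/-- `U_t` on `H_ℂ`, with the deformed inner product. -/
def preOp (U : OrthRep H) (t : ℝ) : U.Pre →ₗ[ℂ] U.Pre := (U.cop t).toLinearMap

variable [CompleteSpace H]

theorem inner_preOp (U : OrthRep H) (t : ℝ) (ξ η : U.Pre) :
    ⟪U.preOp t ξ, U.preOp t η⟫_ℂ = ⟪ξ, η⟫_ℂ := by
  let V : Cplx H →L[ℂ] Cplx H := (U.cop t).toContinuousLinearMap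
  have h : ContinuousLinearMap.adjoint V ∘L U.deformation ∘L V = U.deformation := by
    rw [← ContinuousLinearMap.coe_inj, ← ext_inner_map]
    intro x
    have h1 := U.deformation_invariant t x
    have h2 : ⟪x, (ContinuousLinearMap.adjoint V ∘L U.deformation ∘L V) x⟫_ℂ
        = ⟪x, U.deformation x⟫_ℂ := by
      rw [ContinuousLinearMap.comp_apply, ContinuousLinearMap.adjoint_inner_right]
      exact h1
    have h3 := congrArg (starRingEnd ℂ) h2
    rwa [inner_conj_symm, inner_conj_symm] at h3
  have h4 : ∀ x y : Cplx H, ⟪V x, U.deformation (V y)⟫_ℂ = ⟪x, U.deformation y⟫_ℂ := by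
    intro x y
    conv_rhs => rw [← h]
    rw [ContinuousLinearMap.comp_apply, ContinuousLinearMap.adjoint_inner_right]
    rfl
  exact h4 ξ η

theorem norm_preOp (U : OrthRep H) (t : ℝ) (ξ : U.Pre) : ‖U.preOp t ξ‖ ≤ 1 * ‖ξ‖ := by
  rw [one_mul, @norm_eq_sqrt_re_inner ℂ, @norm_eq_sqrt_re_inner ℂ, inner_preOp]

/-- The unitary operators `U_t` on `H`. -/
def uop (U : OrthRep H) (t : ℝ) : U.Space →L[ℂ] U.Space :=
  complMap (U.preOp t) 1 (U.norm_preOp t)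

theorem inner_uop (U : OrthRep H) (t : ℝ) (ξ η : U.Space) :
    ⟪U.uop t ξ, U.uop t η⟫_ℂ = ⟪ξ, η⟫_ℂ := by
  induction ξ, η using UniformSpace.Completion.induction_on₂ with
  | hp => exact isClosed_eq (by fun_prop) (by fun_prop)
  | ih a b =>
    rw [uop, complMap_coe, complMap_coe, UniformSpace.Completion.inner_coe,
      UniformSpace.Completion.inner_coe, inner_preOp]

end OrthRep

/-! ### Von Neumann algebras generated by sets of operators -/

/-- The von Neumann algebra `(S ∪ S^*)''` generated by a set `S` of bounded operators. -/
def vnGenerated {K : Type*} [NormedAddCommGroup K] [InnerProductSpace ℂ K] [CompleteSpace K]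
    (S : Set (K →L[ℂ] K)) : VonNeumannAlgebra K where
  toStarSubalgebra := StarSubalgebra.centralizer ℂ
    (StarSubalgebra.centralizer ℂ S : Set (K →L[ℂ] K))
  centralizer_centralizer' := by
    simp

namespace OrthRep

variable {H : Type*} [NormedAddCommGroup H] [InnerProductSpace ℝ H] [CompleteSpace H]

/-! ### The free Araki-Woods algebra and its continuous core -/

/-- The free Araki-Woods von Neumann algebra `Γ(H_ℝ, U_t)'' = {s(ξ) : ξ ∈ H_ℝ}''`. -/
def arakiWoods (U : OrthRep H) : VonNeumannAlgebra (Fock U.Space) :=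
  vnGenerated {T | ∃ ξ : H, T = semicircular (U.incl ξ)}

/-- The unitary operators `𝓕(U_t)` on the Fock space. -/
def fockOp (U : OrthRep H) (t : ℝ) : Fock U.Space →L[ℂ] Fock U.Space :=
  secondQuant (U.uop t) (U.inner_uop t)

/-- The modular group `σ_t = Ad 𝓕(U_{-t})` of the free quasi-free state `⟨· Ω, Ω⟩`. -/
def modular (U : OrthRep H) (t : ℝ) (x : Fock U.Space →L[ℂ] Fock U.Space) :
    Fock U.Space →L[ℂ] Fock U.Space :=
  U.fockOp (-t) ∘L x ∘L U.fockOp t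

/-- The Hilbert space `L²(ℝ, 𝓕(H))` of the crossed product. -/
abbrev CoreSpace (U : OrthRep H) : Type _ := Lp (Fock U.Space) 2 (volume : Measure ℝ)

/-- `T = π_σ(x)`, that is, `(T ξ)(t) = σ_{-t}(x) ξ(t)` for almost every `t`. -/
def IsPi (U : OrthRep H) (x : Fock U.Space →L[ℂ] Fock U.Space)
    (T : U.CoreSpace →L[ℂ] U.CoreSpace) : Prop :=
  ∀ ξ : U.CoreSpace, ∀ᵐ t : ℝ, T ξ t = U.modular (-t) x (ξ t)

/-- `(λ_s ξ)(t) = ξ(t - s)`. -/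
def lam (U : OrthRep H) (s : ℝ) : U.CoreSpace →L[ℂ] U.CoreSpace :=
  (Lp.compMeasurePreservingₗᵢ ℂ (fun t : ℝ => t - s)
    (measurePreserving_sub_right volume s)).toContinuousLinearMap

/-- `L(ℝ) = {λ_s : s ∈ ℝ}''`. -/
def groupAlgebra (U : OrthRep H) : VonNeumannAlgebra U.CoreSpace :=
  vnGenerated {T | ∃ s : ℝ, T = U.lam s}

/-- The continuous core: the crossed product of the free Araki-Woods algebra by its modular group,
generated by the operators `π_σ(x)` and `λ_s`. -/
def continuousCore (U : OrthRep H) : VonNeumannAlgebra U.CoreSpace :=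
  vnGenerated ({T | ∃ x ∈ U.arakiWoods, U.IsPi x T} ∪ {T | ∃ s : ℝ, T = U.lam s})

/-! ### The trace of the core -/

/-- The function `e^{π p}` on `[n, n + 1)`, and `0` elsewhere, as an element of `L²(ℝ)`. -/
def expPiece (n : ℤ) : Lp ℂ 2 (volume : Measure ℝ) :=
  MemLp.toLp (Set.indicator (Set.Ico (n : ℝ) (n + 1)) fun p : ℝ => (Real.exp (Real.pi * p) : ℂ)) <| by
    rw [memLp_indicator_iff_restrict measurableSet_Ico]
    have h : Continuous fun p : ℝ => (Real.exp (Real.pi * p) : ℂ) := by fun_prop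
    refine MemLp.of_bound h.aestronglyMeasurable (Real.exp (Real.pi * (n + 1))) ?_
    refine (ae_restrict_iff' measurableSet_Ico).2 (Eventually.of_forall fun p hp => ?_)
    rw [Complex.norm_real, Real.norm_of_nonneg (Real.exp_pos _).le]
    exact Real.exp_le_exp.2 (mul_le_mul_of_nonneg_left hp.2.le Real.pi_pos.le)

/-- The vectors `v_n = f_n ⊗ Ω` of `L²(ℝ, 𝓕(H)) = L²(ℝ) ⊗ 𝓕(H)`, where `f_n` has Fourier transform
`e^{π p} 1_{[n, n+1)}(p)`. -/
def traceVec (U : OrthRep H) (n : ℤ) : U.CoreSpace :=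
  (ContinuousLinearMap.toSpanSingleton ℂ (vacuum U.Space)).compLp
    ((Lp.fourierTransformₗᵢ ℝ ℂ).symm (expPiece n))

/-- The canonical semifinite trace `Tr` on the positive part of the core:
`Tr(x) = ∑_{n ∈ ℤ} ⟨x v_n, v_n⟩`.

The map `E(x) = (id ⊗ ⟨· Ω, Ω⟩)(x)` is the conditional expectation `E(π_σ(x) λ_s) = ⟨x Ω, Ω⟩ λ_s`
of the core onto `L(ℝ)`. The Fourier transform identifies `L(ℝ)` with `L^∞(ℝ)`, where `λ_s` becomes
the function `e^{-2πisp}`, and `Tr(x) = ∫ E(x)(p) e^{2πp} dp`. Hence `Tr` is the dual weight of the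
free quasi-free state (the Plancherel weight `∫ E(x)(p) dp`) multiplied by the density `h⁻¹`, where
`h = e^{-2πp}` is the positive operator affiliated with `L(ℝ)` with `h^{is} = λ_s`. -/
def trace (U : OrthRep H) (x : U.CoreSpace →L[ℂ] U.CoreSpace) : ℝ≥0∞ :=
  ∑' n : ℤ, ENNReal.ofReal (RCLike.re ⟪U.traceVec n, x (U.traceVec n)⟫_ℂ)

/-! ### Amplifications and corners -/

/-- Elements of `M_k(ℂ) ⊗ B(L²(ℝ, 𝓕(H)))`, as matrices of operators. -/
abbrev Amp (U : OrthRep H) (k : ℕ) : Type _ :=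
  Matrix (Fin k) (Fin k) (U.CoreSpace →L[ℂ] U.CoreSpace)

variable {k : ℕ}

/-- `(Tr_k ⊗ Tr)(x) = ∑_j Tr(x_{jj})`, with the non-normalized trace `Tr_k`, for positive `x`. -/
def ampTrace (U : OrthRep H) (x : U.Amp k) : ℝ≥0∞ := ∑ j, U.trace (x j j)

/-- The corner `q (M_k(ℂ) ⊗ N) q`. -/
def corner (U : OrthRep H) (N : VonNeumannAlgebra U.CoreSpace) (q : U.Amp k) : Set (U.Amp k) :=
  {x | ∃ y : U.Amp k, (∀ i j, y i j ∈ N) ∧ x = q * y * q}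

/-- `A` is a von Neumann algebra of operators on the range of the projection `q`, with unit `q`:
a `*`-closed set of operators with `q x q = x` that contains `q` and equals its bicommutant
(cut down by `q`). -/
structure IsVNAlgebraWithUnit (U : OrthRep H) (q : U.Amp k) (A : Set (U.Amp k)) : Prop where
  unit_mem : q ∈ A
  star_mem : ∀ x ∈ A, star x ∈ A
  mem_iff : ∀ x, x ∈ A ↔ q * x * q = x ∧ x ∈ Set.centralizer (Set.centralizer A)

/-- `A` is diffuse: it has no minimal projection, that is, every nonzero projection `p ∈ A`
dominates a projection `r ∈ A` with `r ≠ 0` and `r ≠ p`. -/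
def IsDiffuse (U : OrthRep H) (A : Set (U.Amp k)) : Prop :=
  ∀ p ∈ A, IsStarProjection p → p ≠ 0 →
    ∃ r ∈ A, IsStarProjection r ∧ p * r = r ∧ r ≠ 0 ∧ r ≠ p

/-! ### The space `L²(N)` of a corner and its bimodule structure -/

/-- The Hilbert space `⨁_{i, j ≤ k, n ∈ ℤ} L²(ℝ, 𝓕(H))`, in which the spaces `L²(N)` live. -/
abbrev L2Ambient (U : OrthRep H) (k : ℕ) : Type _ :=
  lp (fun _ : Fin k × Fin k × ℤ => U.CoreSpace) 2

open scoped Classical in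
/-- The vector `x̂ = (x_{ij} v_n)_{i, j, n}` of `x`, for which
`⟨x̂, ŷ⟩ = ∑ ⟨x_{ij} v_n, y_{ij} v_n⟩ = (Tr_k ⊗ Tr)(y^* x)` and
`‖x̂‖² = (Tr_k ⊗ Tr)(x^* x)`; it is used only for `x` with `(Tr_k ⊗ Tr)(x^* x) < ∞`. -/
def hat (U : OrthRep H) (x : U.Amp k) : U.L2Ambient k :=
  if h : Memℓp (fun p : Fin k × Fin k × ℤ => x p.1 p.2.1 (U.traceVec p.2.2)) 2
  then ⟨_, h⟩ else 0

/-- `L²(N)`, for the trace `Tr_k ⊗ Tr`: the closed linear span of the vectors `x̂`, `x ∈ N`. -/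
def L2 (U : OrthRep H) (N : Set (U.Amp k)) : Submodule ℂ (U.L2Ambient k) :=
  (Submodule.span ℂ (U.hat '' N)).topologicalClosure

/-- `η = a ξ` in `L²(N)`: `(ξ, η)` lies in the graph of the continuous extension of
`x̂ ↦ (a x)^`, `x ∈ N`, which is the closure of the graph of this map. -/
def IsLeftMul (U : OrthRep H) (N : Set (U.Amp k)) (a : U.Amp k) (ξ η : U.L2Ambient k) : Prop :=
  (ξ, η) ∈ closure ((fun x => (U.hat x, U.hat (a * x))) '' N)

/-- `η = ξ b` in `L²(N)`: `(ξ, η)` lies in the graph of the continuous extension of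
`x̂ ↦ (x b)^`, `x ∈ N`, which is the closure of the graph of this map. -/
def IsRightMul (U : OrthRep H) (N : Set (U.Amp k)) (b : U.Amp k) (ξ η : U.L2Ambient k) : Prop :=
  (ξ, η) ∈ closure ((fun x => (U.hat x, U.hat (x * b))) '' N)

/-- `K` is an `A`-`B` sub-bimodule of `L²(N)`. -/
structure IsSubBimodule (U : OrthRep H) (N A B : Set (U.Amp k))
    (K : Submodule ℂ (U.L2Ambient k)) : Prop where
  le : K ≤ U.L2 N
  left : ∀ a ∈ A, ∀ ξ ∈ K, ∀ η, U.IsLeftMul N a ξ η → η ∈ K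
  right : ∀ b ∈ B, ∀ ξ ∈ K, ∀ η, U.IsRightMul N b ξ η → η ∈ K

/-- The vector `e_i ⊗ ζ` of `ℓ² ⊗ L²(N)`. -/
def unitTensor (U : OrthRep H) (i : ℕ) (ζ : U.L2Ambient k) :
    lp (fun _ : ℕ => U.L2Ambient k) 2 :=
  lp.single (E := fun _ : ℕ => U.L2Ambient k) 2 i ζ

/-- `dim(K_B) < ∞` for a right `B`-submodule `K` of `L²(N)`, where `q` is the unit of `B ⊂ N`:
there is a right `B`-linear isometry `v : K → ℓ² ⊗ L²(B)` with `Tr(v v^*) < ∞`, where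
`Tr([y_{ij}]) = ∑_i τ(y_{ii})` on `B(ℓ²) ⊗ B` and `τ(y_{ii}) = ⟨y (e_i ⊗ q̂), e_i ⊗ q̂⟩`. -/
def HasFiniteRightDim (U : OrthRep H) (N B : Set (U.Amp k)) (q : U.Amp k)
    (K : Submodule ℂ (U.L2Ambient k)) [CompleteSpace K] : Prop :=
  ∃ v : K →ₗᵢ[ℂ] lp (fun _ : ℕ => U.L2Ambient k) 2,
    (∀ ξ i, v ξ i ∈ U.L2 B) ∧
    (∀ b ∈ B, ∀ ξ η : K, U.IsRightMul N b ξ η → ∀ i, U.IsRightMul N b (v ξ i) (v η i)) ∧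
    ∑' i : ℕ, ENNReal.ofReal (RCLike.re
      ⟪U.unitTensor i (U.hat q), v.toContinuousLinearMap
        (ContinuousLinearMap.adjoint v.toContinuousLinearMap (U.unitTensor i (U.hat q)))⟫_ℂ) < ⊤

end OrthRep

end

/-!
The core `M` acts on `L²(ℝ) ⊗ 𝓕`, where `𝓕` is the Fock space, and `L(ℝ)` acts on the first tensor
factor alone, so that `L²(L(ℝ)^T)` consists of the matrices in `L²(M^T)` with entries in `L²(ℝ) ⊗ Ω`
(`OrthRep.IsFiniteProjection.mem_L2_of_vacProj`). The right action of `L(ℝ)` is the conjugate of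
the left one by the unitary `(W ξ)(t) = 𝓕(U_t) ξ(t)`; it commutes with the core
(`OrthRep.core_commute_rho`). Since both actions are explicit, no modular theory is needed.

*Asymptotic orthogonality.* Let `u_n` be operators in the unit ball of `L(ℝ)` that converge weakly
to `0`. For vectors `w`, `w'` orthogonal to `Ω`, pairing `W⁻¹ u_n (g ⊗ w')` with `w` in the second
tensor factor gives the function `c · (u_n g)`, where `c(t) = ⟨w, 𝓕(U_{-t}) w'⟩` tends to `0` at
infinity because the representation is mixing (`OrthRep.flow_mixing`). On functions with Fourier
transform in a bounded window, weak convergence to `0` implies locally uniform convergence, so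
multiplication by `c` makes the convergence strong (`tendsto_bddMul_of_weak`,
`UnitaryFlow.tendsto_slice_bwd`). Consequently, for right bounded `ζ'` and arbitrary `ζ` orthogonal
to `L²(ℝ) ⊗ Ω`, the functional `b ↦ ⟨ζ b, u_n ζ'⟩` on `L²(L(ℝ)^T)` tends to `0` in norm
(`OrthRep.IsFiniteProjection.eventually_inner_le`).

*Symmetries.* A diffuse von Neumann algebra contains self-adjoint unitaries `u_n` with `u_n → 0`
weakly (`exists_small_symmetry`, `OrthRep.exists_weakly_null_symmetries`): by Zorn's lemma the unit
splits into finitely many projections that are small on given vectors, and the parallelogram law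
gives a choice of signs for which the signed sum is small.

*Bimodules.* Let `v : K → ℓ² ⊗ L²(L(ℝ)^T)` be a right linear isometry with `Tr(v v^*) < ∞`, let
`T_i` be the right linear operator `L²(L(ℝ)^T) → K` given by the `i`-th coordinate of `v^*`, followed
by the projection onto the complement of `L²(ℝ) ⊗ Ω`, and let `ζ_i = T_i q̂`. The entries
`T_i^* u_n T_j` tend to `0` by asymptotic orthogonality, and by the trace property they are dominated
by `‖ζ_i‖`, which is square summable in `i`. By dominated convergence the projections of `u_n ζ_j`
to `K` tend to `0`, while their pairings with `u_n v^*(e_j ⊗ q̂) ∈ K` are equal to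
`‖u_n ζ_j‖² = ‖ζ_j‖²`. Therefore `ζ_j = 0` for all `j`, which means `K ⊆ L²(ℝ) ⊗ Ω`
(`OrthRep.IsFiniteProjection.le_L2`).

*Relative commutants.* If `x` commutes with `A`, the component `ζ` of `x̂` orthogonal to `L²(ℝ) ⊗ Ω`
satisfies `u_n ζ = ζ u_n`, and asymptotic orthogonality gives `‖ζ‖² = ⟨ζ u_n, u_n ζ⟩ → 0`. As the
vacuum is cyclic for the commutant of the free Araki-Woods algebra
(`OrthRep.closure_fieldCommutant_vacuum`), operators in the core are determined by their values on
`L²(ℝ) ⊗ Ω` (`OrthRep.core_eq_zero`), and so `x` is equal to its conditional expectation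
(`OrthRep.IsFiniteProjection.mem_corner_of_commute`).
-/


noncomputable section

/-! ### Fields of isometries acting pointwise on vector-valued `L²` functions -/

section Twist

variable {E : Type*} [NormedAddCommGroup E] [NormedSpace ℂ E]

theorem continuous_isometry_field {V : ℝ → E →L[ℂ] E} (hV : ∀ t x, ‖V t x‖ = ‖x‖)
    (hc : ∀ x, Continuous fun t => V t x) : Continuous fun p : ℝ × E => V p.1 p.2 := by
  rw [continuous_iff_continuousAt]
  rintro ⟨t, x⟩
  rw [ContinuousAt, tendsto_iff_norm_sub_tendsto_zero]
  have h1 : Tendsto (fun p : ℝ × E => ‖p.2 - x‖ + ‖V p.1 x - V t x‖) (𝓝 (t, x)) (𝓝 0) := by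
    have hcont : Continuous fun p : ℝ × E => ‖p.2 - x‖ + ‖V p.1 x - V t x‖ := by
      have := hc x
      fun_prop
    simpa using hcont.tendsto (t, x)
  refine squeeze_zero (fun _ => norm_nonneg _) (fun p => ?_) h1
  calc ‖V p.1 p.2 - V t x‖ = ‖V p.1 (p.2 - x) + (V p.1 x - V t x)‖ := by
        rw [map_sub]; congr 1; abel
    _ ≤ _ := (norm_add_le _ _).trans (by rw [hV])

theorem memLp_isometry_field {V : ℝ → E →L[ℂ] E} (hV : ∀ t x, ‖V t x‖ = ‖x‖)
    (hc : ∀ x, Continuous fun t => V t x) (ξ : Lp E 2 (volume : Measure ℝ)) :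
    MemLp (fun t => V t (ξ t)) 2 (volume : Measure ℝ) := by
  refine (Lp.memLp ξ).congr_norm ?_ (Eventually.of_forall fun t => (hV t _).symm)
  exact (continuous_isometry_field hV hc).comp_aestronglyMeasurable
    (aestronglyMeasurable_id.prodMk (Lp.aestronglyMeasurable ξ))

/-- The isometry `(V ξ)(t) = V_t ξ(t)` of `L²(ℝ, E)` given by a strongly continuous field of
isometries `V_t` of `E`. -/
def twist (V : ℝ → E →L[ℂ] E) (hV : ∀ t x, ‖V t x‖ = ‖x‖)
    (hc : ∀ x, Continuous fun t => V t x) :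
    Lp E 2 (volume : Measure ℝ) →ₗᵢ[ℂ] Lp E 2 (volume : Measure ℝ) :=
  have hm := memLp_isometry_field hV hc
  { toFun ξ := (hm ξ).toLp _
    map_add' ξ η := by
      apply Lp.ext
      filter_upwards [(hm (ξ + η)).coeFn_toLp, (hm ξ).coeFn_toLp, (hm η).coeFn_toLp,
        Lp.coeFn_add ξ η, Lp.coeFn_add ((hm ξ).toLp _) ((hm η).toLp _)] with t h1 h2 h3 h4 h5
      rw [h1, h5, h4, Pi.add_apply, Pi.add_apply, h2, h3, map_add]
    map_smul' c ξ := by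
      apply Lp.ext
      filter_upwards [(hm (c • ξ)).coeFn_toLp, (hm ξ).coeFn_toLp,
        Lp.coeFn_smul c ξ, Lp.coeFn_smul c ((hm ξ).toLp _)] with t h1 h2 h4 h5
      rw [h1, RingHom.id_apply, h5, h4, Pi.smul_apply, Pi.smul_apply, h2, map_smul]
    norm_map' ξ := by
      change ‖(hm ξ).toLp _‖ = _
      rw [Lp.norm_toLp, Lp.norm_def]
      congr 1
      exact eLpNorm_congr_norm_ae (Eventually.of_forall fun t => hV t _) }

theorem twist_ae {V : ℝ → E →L[ℂ] E} (hV : ∀ t x, ‖V t x‖ = ‖x‖)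
    (hc : ∀ x, Continuous fun t => V t x) (ξ : Lp E 2 (volume : Measure ℝ)) :
    twist V hV hc ξ =ᵐ[volume] fun t => V t (ξ t) :=
  (memLp_isometry_field hV hc ξ).coeFn_toLp

variable (E) in
/-- Translation by `s` on `L²(ℝ, E)`. -/
def shift (s : ℝ) : Lp E 2 (volume : Measure ℝ) →L[ℂ] Lp E 2 (volume : Measure ℝ) :=
  (Lp.compMeasurePreservingₗᵢ ℂ (fun t : ℝ => t - s)
    (measurePreserving_sub_right volume s)).toContinuousLinearMap

theorem shift_ae (s : ℝ) (ξ : Lp E 2 (volume : Measure ℝ)) :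
    shift E s ξ =ᵐ[volume] fun t => ξ (t - s) :=
  Lp.coeFn_compMeasurePreserving ξ (measurePreserving_sub_right volume s)

theorem norm_shift (s : ℝ) (ξ : Lp E 2 (volume : Measure ℝ)) : ‖shift E s ξ‖ = ‖ξ‖ :=
  Lp.norm_compMeasurePreserving ξ (measurePreserving_sub_right volume s)

theorem ae_shift {p : ℝ → Prop} (h : ∀ᵐ t, p t) (s : ℝ) : ∀ᵐ t : ℝ, p (t - s) :=
  (measurePreserving_sub_right volume s).quasiMeasurePreserving.ae h

theorem shift_add (s t : ℝ) (ξ : Lp E 2 (volume : Measure ℝ)) :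
    shift E (s + t) ξ = shift E s (shift E t ξ) := by
  apply Lp.ext
  filter_upwards [shift_ae (s + t) ξ, shift_ae s (shift E t ξ), ae_shift (shift_ae t ξ) s]
    with x h1 h2 h3
  rw [h1, h2, h3]
  congr 1; ring

theorem shift_zero (ξ : Lp E 2 (volume : Measure ℝ)) : shift E 0 ξ = ξ := by
  apply Lp.ext
  filter_upwards [shift_ae 0 ξ] with x h1
  rw [h1, sub_zero]

end Twist

theorem inner_shift {E : Type*} [NormedAddCommGroup E] [InnerProductSpace ℂ E] (s : ℝ)
    (ξ η : Lp E 2 (volume : Measure ℝ)) : ⟪shift E s ξ, shift E s η⟫_ℂ = ⟪ξ, η⟫_ℂ :=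
  (Lp.compMeasurePreservingₗᵢ ℂ (fun t : ℝ => t - s)
    (measurePreserving_sub_right volume s)).inner_map_map ξ η

theorem adjoint_shift {E : Type*} [NormedAddCommGroup E] [InnerProductSpace ℂ E]
    [CompleteSpace E] (s : ℝ) :
    ContinuousLinearMap.adjoint (shift E s) = shift E (-s) := by
  symm
  rw [ContinuousLinearMap.eq_adjoint_iff]
  intro ξ η
  rw [← inner_shift s, ← shift_add, add_neg_cancel, shift_zero]

/-! ### Fourier analysis on `L²(ℝ)` -/

/-- The Hilbert space `L²(ℝ)`. -/
abbrev L2R : Type := Lp ℂ 2 (volume : Measure ℝ)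

/-- The Fourier transform on `L²(ℝ)`. -/
abbrev fourierL2 : L2R ≃ₗᵢ[ℂ] L2R := Lp.fourierTransformₗᵢ ℝ ℂ

open FourierTransform SchwartzMap in
theorem integral_fourierInv_mul (k : ℝ → ℂ) (hk : Integrable k) (φ : 𝓢(ℝ, ℂ)) :
    ∫ x, 𝓕⁻ k x * φ x = ∫ x, k x * 𝓕⁻ φ x := by
  have h := VectorFourier.integral_fourierIntegral_smul_eq_flip (L := -innerₗ ℝ)
    (μ := (volume : Measure ℝ)) (ν := (volume : Measure ℝ)) (f := k) (g := φ)
    Real.continuous_fourierChar (by simp; fun_prop) hk φ.integrable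
  have hflip : (-innerₗ ℝ).flip = -innerₗ ℝ := by ext; simp
  rw [hflip] at h
  rw [SchwartzMap.fourierInv_coe]
  exact h

open FourierTransform SchwartzMap in
theorem ae_eq_of_integral_schwartz {f g : ℝ → ℂ} (hf : LocallyIntegrable f)
    (hg : LocallyIntegrable g) (h : ∀ φ : 𝓢(ℝ, ℂ), ∫ x, f x * φ x = ∫ x, g x * φ x) :
    f =ᵐ[volume] g := by
  refine ae_eq_of_integral_contDiff_smul_eq hf hg fun φ hφ hφc => ?_
  have h1 := h (HasCompactSupport.toSchwartzMap (f := fun x => (φ x : ℂ))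
    (hφc.comp_left (g := ((↑) : ℝ → ℂ)) (by simp)) (Complex.ofRealCLM.contDiff.comp hφ))
  simp only [Complex.real_smul, mul_comm ((φ _ : ℝ) : ℂ)]
  exact h1

open FourierTransform SchwartzMap in
/-- The `L²` Fourier transform of an integrable function is given by the Fourier integral. -/
theorem fourierL2_symm_ae (u : L2R) (hu : Integrable u) :
    fourierL2.symm u =ᵐ[volume] 𝓕⁻ (u : ℝ → ℂ) := by
  refine ae_eq_of_integral_schwartz
    ((Lp.memLp (fourierL2.symm u)).locallyIntegrable (by norm_num)) ?_ fun φ => ?_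
  · refine Continuous.locallyIntegrable ?_
    exact VectorFourier.fourierIntegral_continuous (L := -innerₗ ℝ) Real.continuous_fourierChar
      (by simp; fun_prop) hu
  · rw [integral_fourierInv_mul _ hu]
    have h := Lp.fourierInv_toTemperedDistribution_eq (E := ℝ) (F := ℂ) u
    have h2 := congrArg (fun d => d φ) h
    simp only [TemperedDistribution.fourierInv_apply, Lp.toTemperedDistribution_apply,
      smul_eq_mul] at h2
    simp only [mul_comm (u _), mul_comm _ (φ _)]
    exact h2.symm

theorem fourierInv_apply_real (u : ℝ → ℂ) (t : ℝ) :
    FourierTransformInv.fourierInv u t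
      = ∫ p : ℝ, Complex.exp (2 * Real.pi * t * p * Complex.I) * u p := by
  rw [Real.fourierInv_eq]
  refine integral_congr_ae (Eventually.of_forall fun p => ?_)
  simp only [Circle.smul_def, Real.fourierChar_apply, smul_eq_mul]
  congr 2
  simp
  ring

open FourierTransform SchwartzMap in
/-- An integrable function is determined by its Fourier integral. -/
theorem ae_eq_zero_of_fourierInv {k : ℝ → ℂ} (hk : Integrable k)
    (h : ∀ t : ℝ, ∫ p : ℝ, Complex.exp (2 * Real.pi * t * p * Complex.I) * k p = 0) :
    k =ᵐ[volume] 0 := by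
  refine ae_eq_of_integral_schwartz hk.locallyIntegrable
    (by exact (integrable_zero _ _ _).locallyIntegrable) fun φ => ?_
  have h1 := integral_fourierInv_mul k hk (𝓕 φ)
  have h2 : (𝓕⁻ k : ℝ → ℂ) = 0 := funext fun t => by rw [fourierInv_apply_real, h]; rfl
  rw [h2, fourierInv_fourier_eq] at h1
  simpa using h1.symm

/-- Multiplication by the character `e^{-2πisp}` on `L²(ℝ)`. -/
def charMul (s : ℝ) : L2R →ₗᵢ[ℂ] L2R :=
  twist (fun p => Complex.exp (-2 * Real.pi * s * p * Complex.I) • ContinuousLinearMap.id ℂ ℂ)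
    (fun p x => by
      rw [smul_apply, norm_smul, Complex.norm_exp]
      simp)
    (fun x => by
      simp only [smul_apply]
      fun_prop)

theorem charMul_ae (s : ℝ) (g : L2R) :
    charMul s g =ᵐ[volume] fun p => Complex.exp (-2 * Real.pi * s * p * Complex.I) * g p :=
  twist_ae _ _ g

theorem dense_integrable_L2R : Dense {u : L2R | Integrable u} := by
  have h := SchwartzMap.denseRange_toLpCLM (F := ℂ) (E := ℝ) (μ := volume) (p := 2)
    ENNReal.ofNat_ne_top
  refine h.mono ?_
  rintro _ ⟨φ, rfl⟩
  refine φ.integrable.congr ?_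
  exact (SchwartzMap.coeFn_toLp φ 2 volume).symm

theorem fourierL2_symm_charMul (s : ℝ) (g : L2R) :
    fourierL2.symm (charMul s g) = shift ℂ s (fourierL2.symm g) := by
  have hd := dense_integrable_L2R
  refine congrFun (Continuous.ext_on hd
    (f := fun g => fourierL2.symm (charMul s g)) (g := fun g => shift ℂ s (fourierL2.symm g))
    (by fun_prop) (by fun_prop) fun u hu => ?_) g
  have hu' : Integrable (charMul s u) := by
    refine Integrable.congr (f := fun p : ℝ => Complex.exp (-2 * Real.pi * s * p * Complex.I) * u p)
      ?_ (charMul_ae s u).symm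
    have hu2 : Integrable (u : ℝ → ℂ) := hu
    refine hu2.bdd_mul (c := 1) (by fun_prop) (Eventually.of_forall fun p => ?_)
    rw [Complex.norm_exp]; simp
  apply Lp.ext
  filter_upwards [fourierL2_symm_ae _ hu', shift_ae s (fourierL2.symm u),
    ae_shift (fourierL2_symm_ae u hu) s] with t h1 h2 h3
  rw [h1, h2, h3, fourierInv_apply_real, fourierInv_apply_real]
  refine integral_congr_ae ?_
  filter_upwards [charMul_ae s u] with p hp
  rw [hp, ← mul_assoc, ← Complex.exp_add]
  congr 2
  push_cast
  ring

theorem fourierL2_shift (s : ℝ) (g : L2R) :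
    fourierL2 (shift ℂ s g) = charMul s (fourierL2 g) := by
  apply fourierL2.symm.injective
  rw [fourierL2_symm_charMul, LinearIsometryEquiv.symm_apply_apply,
    LinearIsometryEquiv.symm_apply_apply]

/-! ### Operators on `L²(ℝ)` commuting with translations -/

theorem integrable_inner_L2R (f g : L2R) :
    Integrable fun p => (starRingEnd ℂ) (f p) * g p := by
  have h := L2.integrable_inner (𝕜 := ℂ) f g
  refine h.congr (Eventually.of_forall fun p => ?_)
  simp [mul_comm]

theorem inner_L2R (f g : L2R) : ⟪f, g⟫_ℂ = ∫ p, (starRingEnd ℂ) (f p) * g p := by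
  rw [L2.inner_def]
  refine integral_congr_ae (Eventually.of_forall fun p => ?_)
  simp [mul_comm]

theorem integral_char_mul_inner (t : ℝ) (f g : L2R) :
    ∫ p : ℝ, Complex.exp (2 * Real.pi * t * p * Complex.I) * ((starRingEnd ℂ) (f p) * g p)
      = ⟪f, charMul (-t) g⟫_ℂ := by
  rw [inner_L2R]
  refine integral_congr_ae ?_
  filter_upwards [charMul_ae (-t) g] with p hp
  rw [hp]
  push_cast
  ring_nf

/-- An operator commuting with the multiplications by characters is local. -/
theorem conj_adjoint_mul_eq {S : L2R →L[ℂ] L2R} (hS : ∀ s g, S (charMul s g) = charMul s (S g))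
    (f g : L2R) : (fun p => (starRingEnd ℂ) (ContinuousLinearMap.adjoint S g p) * f p)
      =ᵐ[volume] fun p => (starRingEnd ℂ) (g p) * S f p := by
  have h1 := integrable_inner_L2R (ContinuousLinearMap.adjoint S g) f
  have h2 := integrable_inner_L2R g (S f)
  have h := ae_eq_zero_of_fourierInv (h1.sub h2) fun t => ?_
  · filter_upwards [h] with p hp
    exact sub_eq_zero.1 hp
  · have hb (k : ℝ → ℂ) (hk : Integrable k) :
        Integrable fun p : ℝ => Complex.exp (2 * Real.pi * t * p * Complex.I) * k p := by
      refine hk.bdd_mul (c := 1) (by fun_prop) (Eventually.of_forall fun p => ?_)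
      rw [Complex.norm_exp]; simp
    simp only [Pi.sub_apply, mul_sub]
    rw [integral_sub (hb _ h1) (hb _ h2), integral_char_mul_inner, integral_char_mul_inner,
      ContinuousLinearMap.adjoint_inner_left, hS, sub_self]

/-- The Gaussian `e^{-p²}`, as a nowhere vanishing element of `L²(ℝ)`. -/
def gaussL2 : L2R :=
  MemLp.toLp (fun p : ℝ => (Real.exp (-1 * p ^ 2) : ℂ)) <| by
    rw [memLp_two_iff_integrable_sq_norm (by fun_prop)]
    refine (integrable_exp_neg_mul_sq (b := 2) (by norm_num)).congr (Eventually.of_forall fun p => ?_)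
    simp only
    rw [Complex.norm_real, Real.norm_of_nonneg (Real.exp_pos _).le, ← Real.exp_nat_mul]
    congr 1; push_cast; ring

theorem gaussL2_ne_zero : ∀ᵐ p, (gaussL2 : ℝ → ℂ) p ≠ 0 := by
  have h : (gaussL2 : ℝ → ℂ) =ᵐ[volume] fun p : ℝ => (Real.exp (-1 * p ^ 2) : ℂ) :=
    MemLp.coeFn_toLp _
  filter_upwards [h] with p hp
  rw [hp]
  exact_mod_cast (Real.exp_pos _).ne'

/-- An operator on `L²(ℝ)` that commutes with translations is a Fourier multiplier. -/
theorem exists_multiplier {T : L2R →L[ℂ] L2R} (hT : ∀ s g, T (shift ℂ s g) = shift ℂ s (T g)) :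
    ∃ m : ℝ → ℂ, ∀ g, fourierL2 (T g) =ᵐ[volume] fun p => m p * fourierL2 g p := by
  let S : L2R →L[ℂ] L2R := (fourierL2 : L2R →L[ℂ] L2R) ∘L T ∘L (fourierL2.symm : L2R →L[ℂ] L2R)
  have hS : ∀ s g, S (charMul s g) = charMul s (S g) := fun s g => by
    change fourierL2 (T (fourierL2.symm (charMul s g))) = charMul s (fourierL2 (T (fourierL2.symm g)))
    rw [fourierL2_symm_charMul, hT, fourierL2_shift]
  refine ⟨fun p => (starRingEnd ℂ) (ContinuousLinearMap.adjoint S gaussL2 p)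
    / (starRingEnd ℂ) (gaussL2 p), fun g => ?_⟩
  filter_upwards [conj_adjoint_mul_eq hS (fourierL2 g) gaussL2, gaussL2_ne_zero] with p h1 h2
  have h3 : S (fourierL2 g) = fourierL2 (T g) := by
    change fourierL2 (T (fourierL2.symm (fourierL2 g))) = _
    rw [LinearIsometryEquiv.symm_apply_apply]
  rw [h3] at h1
  have h4 : (starRingEnd ℂ) (gaussL2 p) ≠ 0 := by simpa using h2
  rw [div_mul_eq_mul_div, h1, mul_div_cancel_left₀ _ h4]

/-- The operators on `L²(ℝ)` that commute with translations commute with each other. -/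
theorem commute_of_shift {T S : L2R →L[ℂ] L2R} (hT : ∀ s g, T (shift ℂ s g) = shift ℂ s (T g))
    (hS : ∀ s g, S (shift ℂ s g) = shift ℂ s (S g)) (g : L2R) : T (S g) = S (T g) := by
  obtain ⟨m, hm⟩ := exists_multiplier hT
  obtain ⟨m', hm'⟩ := exists_multiplier hS
  apply fourierL2.injective
  apply Lp.ext
  filter_upwards [hm (S g), hm' g, hm' (T g), hm g] with p h1 h2 h3 h4
  rw [h1, h2, h3, h4]; ring

/-- The function on `ℝ` with Fourier transform `e^{πp} 1_{[n, n+1)}(p)`. -/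
def windowVec (n : ℤ) : L2R := fourierL2.symm (OrthRep.expPiece n)

theorem expPiece_ae (n : ℤ) : OrthRep.expPiece n =ᵐ[volume]
    Set.indicator (Set.Ico (n : ℝ) (n + 1)) fun p : ℝ => (Real.exp (Real.pi * p) : ℂ) :=
  MemLp.coeFn_toLp _

theorem eq_zero_of_inner_windowVec {η : L2R}
    (h : ∀ (s : ℝ) (n : ℤ), ⟪shift ℂ s (windowVec n), η⟫_ℂ = 0) : η = 0 := by
  have key (n : ℤ) : (fun p => (starRingEnd ℂ) (fourierL2 η p) * OrthRep.expPiece n p)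
      =ᵐ[volume] 0 := by
    refine ae_eq_zero_of_fourierInv (integrable_inner_L2R _ _) fun t => ?_
    rw [integral_char_mul_inner, ← LinearIsometryEquiv.inner_map_map fourierL2.symm,
      fourierL2_symm_charMul, LinearIsometryEquiv.symm_apply_apply, ← inner_conj_symm]
    have := h (-t) n
    rw [windowVec] at this
    rw [this, map_zero]
  have h0 : fourierL2 η = 0 := by
    apply Lp.ext
    have hk := ae_all_iff.2 key
    have hk' := ae_all_iff.2 expPiece_ae
    filter_upwards [hk, hk', Lp.coeFn_zero ℂ 2 (volume : Measure ℝ)] with p h1 h2 h3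
    rw [h3]
    have h4 := h1 ⌊p⌋
    rw [h2 ⌊p⌋, Set.indicator_of_mem (Set.mem_Ico.2 ⟨Int.floor_le p, Int.lt_floor_add_one p⟩)] at h4
    have h5 : ((Real.exp (Real.pi * p) : ℝ) : ℂ) ≠ 0 := by exact_mod_cast (Real.exp_pos _).ne'
    simpa [h5] using h4
  exact fourierL2.map_eq_zero_iff.1 h0

/-- The vectors that define the trace of the core are cyclic for the translations. -/
theorem dense_span_windowVec : Dense (Submodule.span ℂ
    (Set.range fun x : ℝ × ℤ => shift ℂ x.1 (windowVec x.2)) : Set L2R) := by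
  rw [Submodule.dense_iff_topologicalClosure_eq_top, Submodule.topologicalClosure_eq_top_iff,
    Submodule.eq_bot_iff]
  intro η hη
  rw [Submodule.mem_orthogonal] at hη
  exact eq_zero_of_inner_windowVec fun s n => hη _ (Submodule.subset_span ⟨(s, n), rfl⟩)

open scoped BoundedContinuousFunction in
theorem memLp_bdd_mul (c : ℝ →ᵇ ℂ) (g : L2R) : MemLp (fun t => c t * g t) 2 (volume : Measure ℝ) :=
  (Lp.memLp g).of_le_mul (c := ‖c‖)
    (c.continuous.aestronglyMeasurable.mul (Lp.aestronglyMeasurable g))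
    (Eventually.of_forall fun t => by
      rw [norm_mul]; exact mul_le_mul_of_nonneg_right (c.norm_coe_le_norm t) (norm_nonneg _))

open scoped BoundedContinuousFunction in
/-- Multiplication by a bounded continuous function on `L²(ℝ)`. -/
def bddMul (c : ℝ →ᵇ ℂ) : L2R →L[ℂ] L2R :=
  LinearMap.mkContinuous
    { toFun g := (memLp_bdd_mul c g).toLp _
      map_add' f g := by
        apply Lp.ext
        filter_upwards [(memLp_bdd_mul c (f + g)).coeFn_toLp, (memLp_bdd_mul c f).coeFn_toLp,
          (memLp_bdd_mul c g).coeFn_toLp, Lp.coeFn_add f g,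
          Lp.coeFn_add ((memLp_bdd_mul c f).toLp _) ((memLp_bdd_mul c g).toLp _)] with t h1 h2 h3 h4 h5
        rw [h1, h5, h4, Pi.add_apply, Pi.add_apply, h2, h3, mul_add]
      map_smul' z f := by
        apply Lp.ext
        filter_upwards [(memLp_bdd_mul c (z • f)).coeFn_toLp, (memLp_bdd_mul c f).coeFn_toLp,
          Lp.coeFn_smul z f, Lp.coeFn_smul z ((memLp_bdd_mul c f).toLp _)] with t h1 h2 h4 h5
        rw [h1, RingHom.id_apply, h5, h4, Pi.smul_apply, Pi.smul_apply, h2, smul_eq_mul,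
          smul_eq_mul]
        ring } ‖c‖ fun g => by
    refine Lp.norm_le_mul_norm_of_ae_le_mul ?_
    filter_upwards [(memLp_bdd_mul c g).coeFn_toLp] with t ht
    refine (congrArg norm ht).trans_le ?_
    rw [norm_mul]
    exact mul_le_mul_of_nonneg_right (c.norm_coe_le_norm t) (norm_nonneg _)

open scoped BoundedContinuousFunction in
theorem bddMul_ae (c : ℝ →ᵇ ℂ) (g : L2R) : bddMul c g =ᵐ[volume] fun t => c t * g t :=
  (memLp_bdd_mul c g).coeFn_toLp

theorem norm_sq_L2R (g : L2R) : ‖g‖ ^ 2 = ∫ t, ‖g t‖ ^ 2 := by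
  have h := inner_self_eq_norm_sq_to_K (𝕜 := ℂ) g
  rw [inner_L2R] at h
  have h2 : ∫ p, (starRingEnd ℂ) (g p) * g p = ((∫ t, ‖g t‖ ^ 2 : ℝ) : ℂ) := by
    rw [← integral_complex_ofReal]
    refine integral_congr_ae (Eventually.of_forall fun p => ?_)
    simp [Complex.conj_mul']
  rw [h2] at h
  apply Complex.ofReal_injective
  rw [h]
  simp

theorem integrable_sq_L2R (g : L2R) : Integrable fun t => ‖g t‖ ^ 2 :=
  (memLp_two_iff_integrable_sq_norm (Lp.aestronglyMeasurable g)).1 (Lp.memLp g)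

/-- A function whose Fourier transform is supported in the window `[m, m + 1)`. -/
def InWindow (m : ℤ) (y : L2R) : Prop :=
  ∀ᵐ p : ℝ, p ∉ Set.Ico (m : ℝ) (m + 1) → fourierL2 y p = 0

theorem InWindow.map {m : ℤ} {y : L2R} (hy : InWindow m y) {T : L2R →L[ℂ] L2R}
    (hT : ∀ s g, T (shift ℂ s g) = shift ℂ s (T g)) : InWindow m (T y) := by
  obtain ⟨φ, hφ⟩ := exists_multiplier hT
  filter_upwards [hφ y, hy] with p h1 h2 h3
  rw [h1, h2 h3, mul_zero]

theorem inWindow_shift_windowVec (s : ℝ) (m : ℤ) : InWindow m (shift ℂ s (windowVec m)) := by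
  have h : fourierL2 (shift ℂ s (windowVec m)) = charMul s (OrthRep.expPiece m) := by
    rw [fourierL2_shift, windowVec, LinearIsometryEquiv.apply_symm_apply]
  unfold InWindow
  rw [h]
  filter_upwards [charMul_ae s (OrthRep.expPiece m), expPiece_ae m] with p h1 h2 h3
  rw [h1, h2, Set.indicator_of_notMem h3, mul_zero]

/-- The function `1_{[m, m + 1)}` in `L²(ℝ)`. -/
def windowInd (m : ℤ) : L2R :=
  indicatorConstLp 2 (μ := volume) (s := Set.Ico (m : ℝ) (m + 1)) measurableSet_Ico (by simp) (1 : ℂ)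

theorem norm_windowInd (m : ℤ) : ‖windowInd m‖ = 1 := by
  rw [windowInd, norm_indicatorConstLp (by norm_num) (by norm_num)]
  simp

/-- A function with Fourier transform supported in a window is continuous: it is given by the
pairings with the modulated indicator functions of the window. -/
theorem InWindow.ae_eq {m : ℤ} {y : L2R} (hy : InWindow m y) :
    y =ᵐ[volume] fun t => ⟪fourierL2.symm (charMul t (windowInd m)), y⟫_ℂ := by
  have h0 : ∀ᵐ p, fourierL2 y p = (starRingEnd ℂ) (windowInd m p) * fourierL2 y p := by
    have h := indicatorConstLp_coeFn (p := 2) (μ := volume) (s := Set.Ico (m : ℝ) (m + 1))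
      (hs := measurableSet_Ico) (hμs := by simp) (c := (1 : ℂ))
    filter_upwards [hy, h] with p h1 h2
    have h2' : windowInd m p = _ := h2
    by_cases hp : p ∈ Set.Ico (m : ℝ) (m + 1)
    · rw [h2', Set.indicator_of_mem hp]; simp
    · rw [h1 hp, mul_zero]
  have hint : Integrable (fourierL2 y) :=
    (integrable_inner_L2R (windowInd m) (fourierL2 y)).congr (h0.mono fun p hp => hp.symm)
  have h1 := fourierL2_symm_ae _ hint
  rw [LinearIsometryEquiv.symm_apply_apply] at h1
  filter_upwards [h1] with t ht
  rw [ht, fourierInv_apply_real, ← LinearIsometryEquiv.inner_map_map fourierL2,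
    LinearIsometryEquiv.apply_symm_apply, inner_L2R]
  refine integral_congr_ae ?_
  filter_upwards [h0, charMul_ae t (windowInd m)] with p h2 h3
  rw [h3, map_mul, ← Complex.exp_conj]
  conv_lhs => rw [h2]
  rw [← mul_assoc]
  congr 3
  simp only [map_mul, map_neg, map_ofNat, Complex.conj_ofReal, Complex.conj_I]
  ring

open scoped BoundedContinuousFunction in
/-- Weak convergence to `0` of functions with Fourier transforms in a fixed window implies local
norm convergence, and so norm convergence after multiplication by a function vanishing at
infinity. -/
theorem tendsto_bddMul_of_inWindow (c : ℝ →ᵇ ℂ) (hc : Tendsto c (cocompact ℝ) (𝓝 0)) {m : ℤ}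
    {y : ℕ → L2R} (hy : ∀ n, InWindow m (y n)) {C : ℝ} (hC : ∀ n, ‖y n‖ ≤ C)
    (hw : ∀ h, Tendsto (fun n => ⟪h, y n⟫_ℂ) atTop (𝓝 0)) :
    Tendsto (fun n => bddMul c (y n)) atTop (𝓝 0) := by
  have hC0 : 0 ≤ C := (norm_nonneg _).trans (hC 0)
  rw [tendsto_zero_iff_norm_tendsto_zero]
  suffices h : Tendsto (fun n => ‖bddMul c (y n)‖ ^ 2) atTop (𝓝 0) by
    have := h.sqrt
    simpa using this
  let K : ℕ → ℝ → ℂ := fun n t => ⟪fourierL2.symm (charMul t (windowInd m)), y n⟫_ℂ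
  have hK : ∀ n, y n =ᵐ[volume] K n := fun n => (hy n).ae_eq
  have hKb : ∀ n t, ‖K n t‖ ≤ C := fun n t => by
    refine (norm_inner_le_norm _ _).trans ?_
    rw [LinearIsometryEquiv.norm_map, LinearIsometry.norm_map, norm_windowInd, one_mul]
    exact hC n
  rw [Metric.tendsto_atTop]
  intro ε hε
  obtain ⟨δ, hδ0, hδ⟩ : ∃ δ : ℝ, 0 < δ ∧ δ ^ 2 * C ^ 2 < ε / 2 := by
    have : Tendsto (fun δ : ℝ => δ ^ 2 * C ^ 2) (𝓝[>] 0) (𝓝 0) := by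
      have h : Continuous fun δ : ℝ => δ ^ 2 * C ^ 2 := by fun_prop
      simpa using (h.tendsto 0).mono_left nhdsWithin_le_nhds
    obtain ⟨δ, h1, h2⟩ := ((this.eventually (gt_mem_nhds (half_pos hε))).and
      self_mem_nhdsWithin).exists
    exact ⟨δ, h2, h1⟩
  obtain ⟨B, hB, hBc⟩ := mem_cocompact.1 (hc (Metric.ball_mem_nhds 0 hδ0))
  have hloc : Tendsto (fun n => ∫ t in B, ‖c‖ ^ 2 * ‖K n t‖ ^ 2) atTop (𝓝 0) := by
    have : IsFiniteMeasure (volume.restrict B) := ⟨by simpa using hB.measure_lt_top⟩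
    have h := tendsto_integral_of_dominated_convergence (μ := volume.restrict B)
      (F := fun n t => ‖c‖ ^ 2 * ‖K n t‖ ^ 2) (f := fun _ => 0) (fun _ => ‖c‖ ^ 2 * C ^ 2)
      (fun n => ?_) (integrable_const _) (fun n => Eventually.of_forall fun t => ?_)
      (Eventually.of_forall fun t => ?_)
    · simpa using h
    · exact ((((Lp.aestronglyMeasurable (y n)).congr (hK n)).norm.pow 2).const_mul _).restrict
    · rw [Real.norm_of_nonneg (by positivity)]
      have := hKb n t
      gcongr
    · have := ((hw (fourierL2.symm (charMul t (windowInd m)))).norm.pow 2).const_mul (‖c‖ ^ 2)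
      simpa using this
  obtain ⟨N, hN⟩ := (Metric.tendsto_atTop.1 hloc) (ε / 2) (half_pos hε)
  refine ⟨N, fun n hn => ?_⟩
  have h1 := hN n hn
  rw [Real.dist_eq, sub_zero] at h1
  rw [Real.dist_eq, sub_zero, abs_of_nonneg (by positivity), norm_sq_L2R,
    ← integral_add_compl hB.measurableSet (integrable_sq_L2R _)]
  have hi := integrable_sq_L2R (y n)
  have e1 : ∫ t in B, ‖bddMul c (y n) t‖ ^ 2 ≤ ∫ t in B, ‖c‖ ^ 2 * ‖K n t‖ ^ 2 := by
    refine integral_mono_ae (integrable_sq_L2R _).restrict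
      (((hi.congr ((hK n).mono fun t ht => by simp only [ht])).const_mul _).restrict) ?_
    refine ae_restrict_of_ae ?_
    filter_upwards [bddMul_ae c (y n), hK n] with t h2 h3
    rw [h2, h3, norm_mul, mul_pow]
    have := c.norm_coe_le_norm t
    gcongr
  have e2 : ∫ t in Bᶜ, ‖bddMul c (y n) t‖ ^ 2 ≤ δ ^ 2 * C ^ 2 := by
    calc ∫ t in Bᶜ, ‖bddMul c (y n) t‖ ^ 2 ≤ ∫ t in Bᶜ, δ ^ 2 * ‖y n t‖ ^ 2 := by
          refine integral_mono_ae (integrable_sq_L2R _).restrict (hi.const_mul _).restrict ?_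
          refine (ae_restrict_iff' hB.measurableSet.compl).2 ?_
          filter_upwards [bddMul_ae c (y n)] with t h2 h3
          rw [h2, norm_mul, mul_pow]
          have : ‖c t‖ ≤ δ := by
            have := hBc h3
            simp only [Set.mem_preimage, Metric.mem_ball, dist_zero_right] at this
            exact this.le
          gcongr
      _ ≤ ∫ t, δ ^ 2 * ‖y n t‖ ^ 2 :=
          setIntegral_le_integral (hi.const_mul _) (Eventually.of_forall fun t => by positivity)
      _ = δ ^ 2 * ‖y n‖ ^ 2 := by rw [integral_const_mul, norm_sq_L2R]
      _ ≤ _ := by have := hC n; gcongr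
  have := le_abs_self (∫ t in B, ‖c‖ ^ 2 * ‖K n t‖ ^ 2)
  linarith

/-- Strong convergence to `0` of a bounded family of operators may be checked on a set with
dense span. -/
theorem tendsto_zero_of_dense_span {E F : Type*} [NormedAddCommGroup E] [NormedSpace ℂ E]
    [NormedAddCommGroup F] [NormedSpace ℂ F] {ι : Type*} {l : Filter ι} {T : ι → E →L[ℂ] F} {C : ℝ}
    (hC : ∀ n x, ‖T n x‖ ≤ C * ‖x‖) {S : Set E} {x : E}
    (hx : x ∈ (Submodule.span ℂ S).topologicalClosure)
    (h : ∀ g ∈ S, Tendsto (fun n => T n g) l (𝓝 0)) :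
    Tendsto (fun n => T n x) l (𝓝 0) := by
  have hspan : ∀ g ∈ Submodule.span ℂ S, Tendsto (fun n => T n g) l (𝓝 0) := by
    intro g hg
    induction hg using Submodule.span_induction with
    | mem g hg => exact h g hg
    | zero => simp only [map_zero]; exact tendsto_const_nhds
    | add a b _ _ ha hb => simpa using ha.add hb
    | smul z a _ ha => simpa using ha.const_smul z
  rw [Metric.tendsto_nhds]
  intro ε hε
  have hC' : 0 < |C| + 1 := by positivity
  obtain ⟨g, hg, hgx⟩ := Metric.mem_closure_iff.1 hx (ε / 2 / (|C| + 1)) (by positivity)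
  filter_upwards [Metric.tendsto_nhds.1 (hspan g hg) (ε / 2) (half_pos hε)] with n h1
  rw [dist_zero_right] at h1 ⊢
  rw [dist_eq_norm, lt_div_iff₀ hC'] at hgx
  have h2 : ‖T n (x - g)‖ ≤ ‖x - g‖ * (|C| + 1) := by
    refine (hC n _).trans ?_
    rw [mul_comm]
    have := le_abs_self C
    exact mul_le_mul_of_nonneg_left (by linarith) (norm_nonneg _)
  calc ‖T n x‖ = ‖T n (x - g) + T n g‖ := by rw [map_sub, sub_add_cancel]
    _ ≤ _ := norm_add_le _ _
    _ < ε := by linarith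

open scoped BoundedContinuousFunction in
/-- If a bounded sequence of Fourier multipliers converges weakly to `0`, then it converges
strongly to `0` after multiplication by a continuous function vanishing at infinity. -/
theorem tendsto_bddMul_of_weak (c : ℝ →ᵇ ℂ) (hc : Tendsto c (cocompact ℝ) (𝓝 0))
    {T : ℕ → L2R →L[ℂ] L2R} (hT : ∀ n s g, T n (shift ℂ s g) = shift ℂ s (T n g)) {C : ℝ}
    (hC : ∀ n g, ‖T n g‖ ≤ C * ‖g‖) (hw : ∀ h g, Tendsto (fun n => ⟪h, T n g⟫_ℂ) atTop (𝓝 0))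
    (g : L2R) : Tendsto (fun n => bddMul c (T n g)) atTop (𝓝 0) := by
  refine tendsto_zero_of_dense_span (T := fun n => bddMul c ∘L T n) (C := ‖bddMul c‖ * C)
    (fun n x => ?_) (dense_span_windowVec g) ?_
  · rw [mul_assoc]
    exact ((bddMul c).le_opNorm _).trans (mul_le_mul_of_nonneg_left (hC n x) (norm_nonneg _))
  · rintro _ ⟨⟨s, m⟩, rfl⟩
    exact tendsto_bddMul_of_inWindow c hc
      (fun n => (inWindow_shift_windowVec s m).map (hT n)) (fun n => hC n _) (fun h => hw h _)

/-! ### Bounded operators on Hilbert sums -/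

theorem memlp_two_iff {ι : Type*} {G : ι → Type*} [∀ i, NormedAddCommGroup (G i)]
    {f : ∀ i, G i} : Memℓp f 2 ↔ Summable fun i => ‖f i‖ ^ 2 := by
  rw [memℓp_gen_iff (by norm_num)]
  norm_num

theorem lp_norm_sq {ι : Type*} {G : ι → Type*} [∀ i, NormedAddCommGroup (G i)]
    (f : lp G 2) : ‖f‖ ^ 2 = ∑' i, ‖f i‖ ^ 2 := by
  have h := lp.norm_rpow_eq_tsum (by norm_num) f
  norm_num at h
  exact h

theorem lp_summable_sq {ι : Type*} {G : ι → Type*} [∀ i, NormedAddCommGroup (G i)]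
    (f : lp G 2) : Summable fun i => ‖f i‖ ^ 2 :=
  memlp_two_iff.1 (lp.memℓp f)

section LpOp

variable {ι κ : Type*} {G : ι → Type*} [∀ i, NormedAddCommGroup (G i)]
  [∀ i, InnerProductSpace ℂ (G i)] [∀ i, CompleteSpace (G i)]
  {G' : κ → Type*} [∀ i, NormedAddCommGroup (G' i)]
  [∀ i, InnerProductSpace ℂ (G' i)] [∀ i, CompleteSpace (G' i)]

/-- The operator between Hilbert sums with bounded components `φ p`. It is bounded by the closed
graph theorem, as soon as its values are square summable. -/
def lpOp (φ : ∀ p, lp G 2 →L[ℂ] G' p) (hφ : ∀ f, Memℓp (fun p => φ p f) 2) :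
    lp G 2 →L[ℂ] lp G' 2 :=
  ContinuousLinearMap.ofSeqClosedGraph (g :=
    { toFun f := (⟨fun p => φ p f, hφ f⟩ : lp G' 2)
      map_add' f g := by ext p; exact map_add (φ p) f g
      map_smul' c f := by ext p; exact map_smul (φ p) c f }) <| by
    intro u x y hu hv
    ext p
    have h1 : Tendsto (fun n => φ p (u n)) atTop (𝓝 (y p)) :=
      ((lp.evalCLM ℂ G' 2 p).continuous.tendsto y).comp hv
    exact tendsto_nhds_unique h1 (((φ p).continuous.tendsto x).comp hu)

theorem lpOp_apply (φ : ∀ p, lp G 2 →L[ℂ] G' p) (hφ : ∀ f, Memℓp (fun p => φ p f) 2) (f : lp G 2)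
    (p : κ) : lpOp φ hφ f p = φ p f := rfl

end LpOp

/-! ### The Hilbert space `L²(ℝ, E) = L²(ℝ) ⊗ E` -/

section VectorValued

variable {E : Type*} [NormedAddCommGroup E] [InnerProductSpace ℂ E]

variable (E) in
/-- The Hilbert space `L²(ℝ, E)`. -/
abbrev L2E : Type _ := Lp E 2 (volume : Measure ℝ)

/-- The operator `g ↦ g ⊗ w` from `L²(ℝ)` to `L²(ℝ, E)`. -/
def tens (w : E) : L2R →L[ℂ] L2E E := (ContinuousLinearMap.toSpanSingleton ℂ w).compLpL 2 volume

/-- The slice operator `ξ ↦ ⟨w, ξ(·)⟩` from `L²(ℝ, E)` to `L²(ℝ)`. -/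
def slice (w : E) : L2E E →L[ℂ] L2R := (innerSL ℂ w).compLpL 2 volume

/-- The operator `1 ⊗ y` on `L²(ℝ, E) = L²(ℝ) ⊗ E`. -/
def amplify (y : E →L[ℂ] E) : L2E E →L[ℂ] L2E E := y.compLpL 2 volume

theorem tens_ae (w : E) (g : L2R) : tens w g =ᵐ[volume] fun t => g t • w :=
  (ContinuousLinearMap.toSpanSingleton ℂ w).coeFn_compLpL g

theorem slice_ae (w : E) (ξ : L2E E) : slice w ξ =ᵐ[volume] fun t => ⟪w, ξ t⟫_ℂ :=
  (innerSL ℂ w).coeFn_compLpL ξ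

theorem amplify_ae (y : E →L[ℂ] E) (ξ : L2E E) : amplify y ξ =ᵐ[volume] fun t => y (ξ t) :=
  y.coeFn_compLpL ξ

theorem inner_tens_left (w : E) (g : L2R) (ξ : L2E E) : ⟪tens w g, ξ⟫_ℂ = ⟪g, slice w ξ⟫_ℂ := by
  rw [L2.inner_def, L2.inner_def]
  refine integral_congr_ae ?_
  filter_upwards [tens_ae w g, slice_ae w ξ] with t h1 h2
  rw [h1, h2, inner_smul_left]
  simp [mul_comm]

theorem inner_tens_right (w : E) (g : L2R) (ξ : L2E E) : ⟪ξ, tens w g⟫_ℂ = ⟪slice w ξ, g⟫_ℂ := by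
  rw [← inner_conj_symm, inner_tens_left, inner_conj_symm]

theorem slice_tens (w w' : E) (g : L2R) : slice w (tens w' g) = ⟪w, w'⟫_ℂ • g := by
  apply Lp.ext
  filter_upwards [slice_ae w (tens w' g), tens_ae w' g, Lp.coeFn_smul ⟪w, w'⟫_ℂ g] with t h1 h2 h3
  rw [h1, h2, h3, Pi.smul_apply, inner_smul_right, smul_eq_mul, mul_comm]

theorem inner_tens_tens (w w' : E) (g g' : L2R) :
    ⟪tens w g, tens w' g'⟫_ℂ = ⟪w, w'⟫_ℂ * ⟪g, g'⟫_ℂ := by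
  rw [inner_tens_left, slice_tens, inner_smul_right]

theorem norm_tens (w : E) (g : L2R) : ‖tens w g‖ = ‖w‖ * ‖g‖ := by
  have h : ‖tens w g‖ ^ 2 = (‖w‖ * ‖g‖) ^ 2 := by
    have h1 := inner_tens_tens w w g g
    rw [inner_self_eq_norm_sq_to_K, inner_self_eq_norm_sq_to_K, inner_self_eq_norm_sq_to_K] at h1
    rw [mul_pow]
    apply Complex.ofReal_injective
    simpa using h1
  exact (sq_eq_sq₀ (norm_nonneg _) (by positivity)).1 h

theorem tens_add (w w' : E) (g : L2R) : tens (w + w') g = tens w g + tens w' g := by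
  rw [tens, ContinuousLinearMap.toSpanSingleton_add, ContinuousLinearMap.add_compLpL]; rfl

theorem tens_smul (c : ℂ) (w : E) (g : L2R) : tens (c • w) g = c • tens w g := by
  rw [tens, ContinuousLinearMap.toSpanSingleton_smul, ContinuousLinearMap.smul_compLpL]; rfl

/-- The operator `w ↦ g ⊗ w`. -/
def tensRight (g : L2R) : E →L[ℂ] L2E E :=
  LinearMap.mkContinuous
    { toFun w := tens w g
      map_add' w w' := tens_add w w' g
      map_smul' c w := tens_smul c w g } ‖g‖ fun w => by
    rw [mul_comm]; exact (norm_tens w g).le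

theorem amplify_tens (y : E →L[ℂ] E) (w : E) (g : L2R) : amplify y (tens w g) = tens (y w) g := by
  apply Lp.ext
  filter_upwards [amplify_ae y (tens w g), tens_ae w g, tens_ae (y w) g] with t h1 h2 h3
  rw [h1, h2, h3, map_smul]

theorem compLpL_shift {F : Type*} [NormedAddCommGroup F] [NormedSpace ℂ F] (y : E →L[ℂ] F) (s : ℝ)
    (ξ : L2E E) : y.compLpL 2 volume (shift E s ξ) = shift F s (y.compLpL 2 volume ξ) := by
  apply Lp.ext
  filter_upwards [y.coeFn_compLpL (shift E s ξ), shift_ae s ξ, shift_ae s (y.compLpL 2 volume ξ),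
    ae_shift (y.coeFn_compLpL (p := 2) ξ) s] with t h1 h2 h3 h4
  rw [h1, h2, h3, h4]

theorem tens_shift (w : E) (s : ℝ) (g : L2R) : tens w (shift ℂ s g) = shift E s (tens w g) := by
  apply Lp.ext
  filter_upwards [tens_ae w (shift ℂ s g), shift_ae s g, shift_ae s (tens w g),
    ae_shift (tens_ae w g) s] with t h1 h2 h3 h4
  rw [h1, h2, h3, h4]

theorem slice_shift (w : E) (s : ℝ) (ξ : L2E E) : slice w (shift E s ξ) = shift ℂ s (slice w ξ) :=
  compLpL_shift _ s ξ

theorem amplify_shift (y : E →L[ℂ] E) (s : ℝ) (ξ : L2E E) :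
    amplify y (shift E s ξ) = shift E s (amplify y ξ) :=
  compLpL_shift _ s ξ

theorem inner_amplify [CompleteSpace E] (y : E →L[ℂ] E) (ξ η : L2E E) :
    ⟪amplify (ContinuousLinearMap.adjoint y) ξ, η⟫_ℂ = ⟪ξ, amplify y η⟫_ℂ := by
  rw [L2.inner_def, L2.inner_def]
  refine integral_congr_ae ?_
  filter_upwards [amplify_ae (ContinuousLinearMap.adjoint y) ξ, amplify_ae y η] with t h1 h2
  rw [h1, h2, ContinuousLinearMap.adjoint_inner_left]

theorem adjoint_amplify [CompleteSpace E] (y : E →L[ℂ] E) :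
    ContinuousLinearMap.adjoint (amplify y) = amplify (ContinuousLinearMap.adjoint y) := by
  symm
  rw [ContinuousLinearMap.eq_adjoint_iff]
  exact inner_amplify y

theorem eq_zero_of_slice {ξ : L2E E} (h : ∀ w, slice w ξ = 0) : ξ = 0 := by
  have hd : ∀ η : L2E E, ⟪η, ξ⟫_ℂ = 0 := by
    intro η
    refine Lp.induction (p := 2) ENNReal.ofNat_ne_top (fun η => ⟪(η : L2E E), ξ⟫_ℂ = 0)
      ?_ ?_ ?_ η
    · intro c s hs hμ
      have : (Lp.simpleFunc.indicatorConst 2 hs hμ.ne c : L2E E)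
          = tens c (indicatorConstLp 2 hs hμ.ne (1 : ℂ)) := by
        rw [Lp.simpleFunc.coe_indicatorConst]
        apply Lp.ext
        filter_upwards [indicatorConstLp_coeFn (p := 2) (hs := hs) (hμs := hμ.ne) (c := c),
          tens_ae c (indicatorConstLp 2 hs hμ.ne (1 : ℂ)),
          indicatorConstLp_coeFn (p := 2) (hs := hs) (hμs := hμ.ne) (c := (1 : ℂ))]
          with t h1 h2 h3
        rw [h1, h2, h3]
        by_cases ht : t ∈ s <;> simp [ht]
      rw [this, inner_tens_left, h, inner_zero_right]
    · intro f g hf hg _ h1 h2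
      rw [inner_add_left, h1, h2, add_zero]
    · exact isClosed_eq (by fun_prop) continuous_const
  exact inner_self_eq_zero.1 (hd ξ)

/-- Elementary tensors `g ⊗ w`, with `g` in a total subset of `L²(ℝ)`, span a dense subspace. -/
theorem dense_span_tens {S : Set L2R} (hS : Dense (Submodule.span ℂ S : Set L2R)) [CompleteSpace E] :
    Dense (Submodule.span ℂ {x : L2E E | ∃ g ∈ S, ∃ w, x = tens w g} : Set (L2E E)) := by
  rw [Submodule.dense_iff_topologicalClosure_eq_top, Submodule.topologicalClosure_eq_top_iff,
    Submodule.eq_bot_iff]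
  intro η hη
  rw [Submodule.mem_orthogonal] at hη
  refine eq_zero_of_slice fun w => ?_
  rw [Submodule.dense_iff_topologicalClosure_eq_top, Submodule.topologicalClosure_eq_top_iff,
    Submodule.eq_bot_iff] at hS
  refine hS _ ?_
  rw [Submodule.mem_orthogonal]
  intro u hu
  induction hu using Submodule.span_induction with
  | mem g hg => rw [← inner_tens_left]; exact hη _ (Submodule.subset_span ⟨g, hg, w, rfl⟩)
  | zero => simp
  | add a b _ _ ha hb => rw [inner_add_left, ha, hb, add_zero]
  | smul z a _ ha => rw [inner_smul_left, ha, mul_zero]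

/-- Two operators on `L²(ℝ, E)` agree if they agree on elementary tensors. -/
theorem clm_ext_tens [CompleteSpace E] {F : Type*} [NormedAddCommGroup F] [NormedSpace ℂ F]
    {S T : L2E E →L[ℂ] F} (h : ∀ g w, S (tens w g) = T (tens w g)) : S = T := by
  have hd := dense_span_tens (E := E) (S := Set.univ) (by simp)
  refine ContinuousLinearMap.ext_on hd ?_
  rintro _ ⟨g, -, w, rfl⟩
  exact h g w

/-- The ampliation `T ⊗ 1` of an operator `T` on `L²(ℝ)` exists. -/
theorem exists_ampliation [CompleteSpace E] (T : L2R →L[ℂ] L2R) :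
    ∃ S : L2E E →L[ℂ] L2E E, ∀ w g, S (tens w g) = tens w (T g) := by
  obtain ⟨I, b, -⟩ := exists_hilbertBasis ℂ E
  let V : I → L2R →ₗᵢ[ℂ] L2E E := fun i =>
    ⟨(tens (b i)).toLinearMap, fun g => by
      have := norm_tens (b i) g
      rw [b.orthonormal.1 i, one_mul] at this
      exact this⟩
  have hV : OrthogonalFamily ℂ (fun _ : I => L2R) V := by
    intro i j hij g h
    change ⟪tens (b i) g, tens (b j) h⟫_ℂ = 0
    rw [inner_tens_tens, b.orthonormal.2 hij, zero_mul]
  have hsum : IsHilbertSum ℂ (fun _ : I => L2R) V := by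
    refine IsHilbertSum.mk hV ?_
    rw [top_le_iff, Submodule.topologicalClosure_eq_top_iff, Submodule.eq_bot_iff]
    intro η hη
    rw [Submodule.mem_orthogonal] at hη
    refine eq_zero_of_slice fun w => ?_
    have hb : ∀ i, slice (b i) η = 0 := fun i => by
      rw [← inner_self_eq_zero (𝕜 := ℂ), ← inner_tens_left]
      exact hη _ (Submodule.mem_iSup_of_mem i ⟨_, rfl⟩)
    have hw : ∀ h : L2R, ⟪tensRight h w, η⟫_ℂ = 0 := by
      intro h
      have hz : innerSL ℂ η ∘L tensRight h = 0 := by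
        refine ContinuousLinearMap.ext_on (s := Set.range b) ?_ ?_
        · rw [Submodule.dense_iff_topologicalClosure_eq_top]; exact b.dense_span
        · rintro _ ⟨i, rfl⟩
          change ⟪η, tens (b i) h⟫_ℂ = 0
          rw [inner_tens_right, hb, inner_zero_left]
      rw [← inner_conj_symm]
      change (starRingEnd ℂ) ((innerSL ℂ η ∘L tensRight h) w) = 0
      rw [hz]; simp
    rw [← inner_self_eq_zero (𝕜 := ℂ), ← inner_tens_left]
    exact hw _
  let J := hsum.linearIsometryEquiv
  let D : lp (fun _ : I => L2R) 2 →L[ℂ] lp (fun _ : I => L2R) 2 :=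
    lpOp (fun i => T ∘L lp.evalCLM ℂ (fun _ : I => L2R) 2 i) fun f => by
      rw [memlp_two_iff]
      refine Summable.of_nonneg_of_le (fun i => by positivity) (fun i => ?_)
        ((lp_summable_sq f).mul_left (‖T‖ ^ 2))
      rw [← mul_pow]
      exact pow_le_pow_left₀ (norm_nonneg _) (T.le_opNorm _) 2
  refine ⟨(J.symm : lp (fun _ : I => L2R) 2 →L[ℂ] L2E E) ∘L D ∘L (J : L2E E →L[ℂ] _), ?_⟩
  classical
  have hi : ∀ i g, J (tens (b i) g) = lp.single (E := fun _ : I => L2R) 2 i g := by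
    intro i g
    rw [← J.eq_symm_apply]
    exact (hsum.linearIsometryEquiv_symm_apply_single g).symm
  have key : ∀ i g, J.symm (D (J (tens (b i) g))) = tens (b i) (T g) := by
    intro i g
    rw [LinearIsometryEquiv.symm_apply_eq, hi, hi]
    ext j : 2
    change T (lp.single (E := fun _ : I => L2R) 2 i g j) = _
    by_cases hj : j = i
    · subst hj; simp
    · simp [hj]
  intro w g
  have : ((J.symm : lp (fun _ : I => L2R) 2 →L[ℂ] L2E E) ∘L D ∘L (J : L2E E →L[ℂ] _)) ∘L tensRight g
      = tensRight (T g) := by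
    refine ContinuousLinearMap.ext_on (s := Set.range b) ?_ ?_
    · rw [Submodule.dense_iff_topologicalClosure_eq_top]; exact b.dense_span
    · rintro _ ⟨i, rfl⟩
      exact key i g
  exact congrArg (fun f => f w) this

end VectorValued

/-! ### The von Neumann algebra of translations -/

theorem mem_vnGenerated_iff {K : Type*} [NormedAddCommGroup K] [InnerProductSpace ℂ K]
    [CompleteSpace K] {S : Set (K →L[ℂ] K)} {x : K →L[ℂ] K} :
    x ∈ vnGenerated S ↔ ∀ z : K →L[ℂ] K,
      (∀ g ∈ S, g * z = z * g ∧ star g * z = z * star g) → z * x = x * z := by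
  change x ∈ StarSubalgebra.centralizer ℂ (StarSubalgebra.centralizer ℂ S : Set (K →L[ℂ] K)) ↔ _
  rw [StarSubalgebra.mem_centralizer_iff]
  constructor
  · intro h z hz
    exact (h z (StarSubalgebra.mem_centralizer_iff ℂ |>.2 hz)).1
  · intro h z hz
    refine ⟨h z (StarSubalgebra.mem_centralizer_iff ℂ |>.1 hz), h (star z) ?_⟩
    exact StarSubalgebra.mem_centralizer_iff ℂ |>.1 (star_mem hz)

theorem subset_vnGenerated {K : Type*} [NormedAddCommGroup K] [InnerProductSpace ℂ K]
    [CompleteSpace K] {S : Set (K →L[ℂ] K)} {x : K →L[ℂ] K} (hx : x ∈ S) : x ∈ vnGenerated S :=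
  mem_vnGenerated_iff.2 fun _ hz => (hz x hx).1.symm

theorem vnGenerated_mono {K : Type*} [NormedAddCommGroup K] [InnerProductSpace ℂ K]
    [CompleteSpace K] {S T : Set (K →L[ℂ] K)} (h : S ⊆ T) {x : K →L[ℂ] K}
    (hx : x ∈ vnGenerated S) : x ∈ vnGenerated T :=
  mem_vnGenerated_iff.2 fun z hz => mem_vnGenerated_iff.1 hx z fun g hg => hz g (h hg)

section Compress

variable {E : Type*} [NormedAddCommGroup E] [InnerProductSpace ℂ E]

/-- The compression `(1 ⊗ Ω)^* a (1 ⊗ Ω)` of an operator to `L²(ℝ) = L²(ℝ) ⊗ Ω`. -/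
def compress (Ω : E) (a : L2E E →L[ℂ] L2E E) : L2R →L[ℂ] L2R := slice Ω ∘L a ∘L tens Ω

theorem compress_apply (Ω : E) (a : L2E E →L[ℂ] L2E E) (g : L2R) :
    compress Ω a g = slice Ω (a (tens Ω g)) := rfl

/-- The operator `|w⟩⟨Ω|`. -/
def rankOne (w Ω : E) : E →L[ℂ] E := (innerSL ℂ Ω).smulRight w

theorem rankOne_apply (w Ω x : E) : rankOne w Ω x = ⟪Ω, x⟫_ℂ • w := rfl

theorem amplify_rankOne (w Ω : E) (ξ : L2E E) : amplify (rankOne w Ω) ξ = tens w (slice Ω ξ) := by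
  apply Lp.ext
  filter_upwards [amplify_ae (rankOne w Ω) ξ, tens_ae w (slice Ω ξ), slice_ae Ω ξ] with t h1 h2 h3
  rw [h1, h2, h3, rankOne_apply]

theorem norm_slice_le {Ω : E} (hΩ : ‖Ω‖ = 1) (ξ : L2E E) : ‖slice Ω ξ‖ ≤ ‖ξ‖ := by
  have h := (innerSL ℂ Ω).norm_compLp_le ξ
  rw [innerSL_apply_norm, hΩ, one_mul] at h
  exact h

theorem norm_compress_le {Ω : E} (hΩ : ‖Ω‖ = 1) {a : L2E E →L[ℂ] L2E E} {C : ℝ}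
    (ha : ∀ ξ, ‖a ξ‖ ≤ C * ‖ξ‖) (g : L2R) : ‖compress Ω a g‖ ≤ C * ‖g‖ := by
  have h := ha (tens Ω g)
  rw [norm_tens, hΩ, one_mul] at h
  exact (norm_slice_le hΩ _).trans h

theorem inner_self_one {Ω : E} (hΩ : ‖Ω‖ = 1) : ⟪Ω, Ω⟫_ℂ = 1 := by
  rw [inner_self_eq_norm_sq_to_K, hΩ]; simp

theorem slice_tens_self {Ω : E} (hΩ : ‖Ω‖ = 1) (g : L2R) : slice Ω (tens Ω g) = g := by
  rw [slice_tens, inner_self_one hΩ, one_smul]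

theorem compress_shift {Ω : E} {x : L2E E →L[ℂ] L2E E}
    (hx : ∀ s g, x (tens Ω (shift ℂ s g)) = shift E s (x (tens Ω g))) (s : ℝ) (g : L2R) :
    compress Ω x (shift ℂ s g) = shift ℂ s (compress Ω x g) := by
  rw [compress_apply, hx, slice_shift, compress_apply]

end Compress

section TransAlg

variable {E : Type*} [NormedAddCommGroup E] [InnerProductSpace ℂ E] [CompleteSpace E]

variable (E) in
/-- The von Neumann algebra on `L²(ℝ, E)` generated by the translations. -/
def transAlg : VonNeumannAlgebra (L2E E) := vnGenerated {T | ∃ s : ℝ, T = shift E s}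

theorem star_shift (s : ℝ) : star (shift E s) = shift E (-s) := adjoint_shift s

theorem mem_transAlg_iff {a : L2E E →L[ℂ] L2E E} : a ∈ transAlg E ↔
    ∀ z : L2E E →L[ℂ] L2E E, (∀ s ξ, z (shift E s ξ) = shift E s (z ξ)) →
      ∀ ξ, z (a ξ) = a (z ξ) := by
  rw [transAlg, mem_vnGenerated_iff]
  constructor
  · intro h z hz ξ
    refine congrArg (fun f => f ξ) (h z ?_)
    rintro _ ⟨s, rfl⟩
    rw [star_shift]
    exact ⟨ContinuousLinearMap.ext fun ξ => (hz s ξ).symm,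
      ContinuousLinearMap.ext fun ξ => (hz (-s) ξ).symm⟩
  · intro h z hz
    refine ContinuousLinearMap.ext fun ξ => h z (fun s ξ => ?_) ξ
    exact (congrArg (fun f => f ξ) (hz _ ⟨s, rfl⟩).1).symm

theorem shift_mem_transAlg (s : ℝ) : shift E s ∈ transAlg E := subset_vnGenerated ⟨s, rfl⟩

theorem transAlg_shift {a : L2E E →L[ℂ] L2E E} (ha : a ∈ transAlg E) (s : ℝ) (ξ : L2E E) :
    a (shift E s ξ) = shift E s (a ξ) :=
  (mem_transAlg_iff.1 ha (shift E s) (fun t ξ => by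
    rw [← shift_add, ← shift_add, add_comm]) ξ).symm

theorem transAlg_comm {a b : L2E E →L[ℂ] L2E E} (ha : a ∈ transAlg E) (hb : b ∈ transAlg E)
    (ξ : L2E E) : a (b ξ) = b (a ξ) :=
  mem_transAlg_iff.1 hb a (transAlg_shift ha) ξ

theorem transAlg_amplify {a : L2E E →L[ℂ] L2E E} (ha : a ∈ transAlg E) (y : E →L[ℂ] E)
    (ξ : L2E E) : amplify y (a ξ) = a (amplify y ξ) :=
  mem_transAlg_iff.1 ha (amplify y) (amplify_shift y) ξ

theorem transAlg_norm_star {a : L2E E →L[ℂ] L2E E} (ha : a ∈ transAlg E) (ξ : L2E E) :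
    ‖star a ξ‖ = ‖a ξ‖ := by
  have h : ⟪star a ξ, star a ξ⟫_ℂ = ⟪a ξ, a ξ⟫_ℂ := by
    rw [ContinuousLinearMap.star_eq_adjoint, ContinuousLinearMap.adjoint_inner_left,
      ← ContinuousLinearMap.star_eq_adjoint, transAlg_comm ha (star_mem ha),
      ContinuousLinearMap.star_eq_adjoint, ContinuousLinearMap.adjoint_inner_right]
  rw [@norm_eq_sqrt_re_inner ℂ, @norm_eq_sqrt_re_inner ℂ, h]

/-- The elements of the translation algebra act on the first tensor factor. -/
theorem transAlg_tens {Ω : E} (hΩ : ‖Ω‖ = 1) {a : L2E E →L[ℂ] L2E E} (ha : a ∈ transAlg E) (w : E)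
    (g : L2R) : a (tens w g) = tens w (compress Ω a g) := by
  rw [compress_apply, ← amplify_rankOne, transAlg_amplify ha, amplify_rankOne, slice_tens_self hΩ]

theorem slice_transAlg {Ω : E} (hΩ : ‖Ω‖ = 1) {a : L2E E →L[ℂ] L2E E} (ha : a ∈ transAlg E) (w : E)
    (ξ : L2E E) : slice w (a ξ) = compress Ω a (slice w ξ) := by
  have : slice w ∘L a = compress Ω a ∘L slice w := clm_ext_tens fun g w' => by
    change slice w (a (tens w' g)) = compress Ω a (slice w (tens w' g))
    rw [transAlg_tens hΩ ha, slice_tens, slice_tens, map_smul]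
  exact congrArg (fun f => f ξ) this

theorem compress_shift_of_mem {Ω : E} {a : L2E E →L[ℂ] L2E E} (ha : a ∈ transAlg E) (s : ℝ)
    (g : L2R) : compress Ω a (shift ℂ s g) = shift ℂ s (compress Ω a g) :=
  compress_shift (fun s g => by rw [tens_shift, transAlg_shift ha]) s g

/-- Every operator on `L²(ℝ)` that commutes with translations comes from the translation algebra:
the translations generate a maximal abelian algebra on `L²(ℝ)`. -/
theorem exists_transAlg_of_shift {T : L2R →L[ℂ] L2R}
    (hT : ∀ s g, T (shift ℂ s g) = shift ℂ s (T g)) :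
    ∃ a ∈ transAlg E, ∀ w g, a (tens w g) = tens w (T g) := by
  obtain ⟨a, ha⟩ := exists_ampliation (E := E) T
  refine ⟨a, mem_transAlg_iff.2 fun z hz => ?_, ha⟩
  have hs : ∀ w ξ, slice w (a ξ) = T (slice w ξ) := by
    intro w ξ
    have : slice w ∘L a = T ∘L slice w := clm_ext_tens fun g w' => by
      change slice w (a (tens w' g)) = T (slice w (tens w' g))
      rw [ha, slice_tens, slice_tens, map_smul]
    exact congrArg (fun f => f ξ) this
  have : z ∘L a = a ∘L z := clm_ext_tens fun g w => by
    change z (a (tens w g)) = a (z (tens w g))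
    rw [← sub_eq_zero]
    refine eq_zero_of_slice fun w' => ?_
    rw [map_sub, hs, ha, sub_eq_zero]
    have hc := commute_of_shift (T := T) (S := slice w' ∘L z ∘L tens w) hT (fun s g => by
      change slice w' (z (tens w (shift ℂ s g))) = shift ℂ s (slice w' (z (tens w g)))
      rw [tens_shift, hz, slice_shift]) g
    exact hc.symm
  exact fun ξ => congrArg (fun f => f ξ) this

end TransAlg

/-! ### Unitary flows and twisted translations -/

/-- A strongly continuous one-parameter group of unitary operators on `E`. -/
structure UnitaryFlow (E : Type*) [NormedAddCommGroup E] [InnerProductSpace ℂ E] where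
  /-- the unitary operators -/
  op : ℝ → E →L[ℂ] E
  inner_op : ∀ t x y, ⟪op t x, op t y⟫_ℂ = ⟪x, y⟫_ℂ
  op_add : ∀ s t x, op (s + t) x = op s (op t x)
  continuous_op : ∀ x, Continuous fun t => op t x

namespace UnitaryFlow

variable {E : Type*} [NormedAddCommGroup E] [InnerProductSpace ℂ E]

theorem norm_op (V : UnitaryFlow E) (t : ℝ) (x : E) : ‖V.op t x‖ = ‖x‖ := by
  rw [@norm_eq_sqrt_re_inner ℂ, @norm_eq_sqrt_re_inner ℂ, V.inner_op]

theorem op_zero (V : UnitaryFlow E) (x : E) : V.op 0 x = x := by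
  have h := V.op_add 0 0 x
  rw [add_zero] at h
  have h2 : ‖V.op 0 (V.op 0 x - x)‖ = 0 := by rw [map_sub, ← h, sub_self, norm_zero]
  rw [V.norm_op, norm_eq_zero, sub_eq_zero] at h2
  exact h2

theorem op_neg_op (V : UnitaryFlow E) (t : ℝ) (x : E) : V.op (-t) (V.op t x) = x := by
  rw [← V.op_add, neg_add_cancel, V.op_zero]

theorem op_op_neg (V : UnitaryFlow E) (t : ℝ) (x : E) : V.op t (V.op (-t) x) = x := by
  rw [← V.op_add, add_neg_cancel, V.op_zero]

/-- The operator `(W ξ)(t) = V_t ξ(t)` on `L²(ℝ, E)`. -/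
def fwd (V : UnitaryFlow E) : L2E E →L[ℂ] L2E E :=
  (twist V.op V.norm_op V.continuous_op).toContinuousLinearMap

/-- The operator `(W⁻¹ ξ)(t) = V_{-t} ξ(t)` on `L²(ℝ, E)`. -/
def bwd (V : UnitaryFlow E) : L2E E →L[ℂ] L2E E :=
  (twist (fun t => V.op (-t)) (fun t => V.norm_op (-t))
    (fun x => (V.continuous_op x).comp continuous_neg)).toContinuousLinearMap

theorem fwd_ae (V : UnitaryFlow E) (ξ : L2E E) : V.fwd ξ =ᵐ[volume] fun t => V.op t (ξ t) :=
  twist_ae V.norm_op V.continuous_op ξ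

theorem bwd_ae (V : UnitaryFlow E) (ξ : L2E E) : V.bwd ξ =ᵐ[volume] fun t => V.op (-t) (ξ t) :=
  twist_ae (V := fun t => V.op (-t)) (fun t => V.norm_op (-t))
    (fun x => (V.continuous_op x).comp continuous_neg) ξ

theorem norm_bwd (V : UnitaryFlow E) (ξ : L2E E) : ‖V.bwd ξ‖ = ‖ξ‖ :=
  LinearIsometry.norm_map _ ξ

theorem inner_fwd (V : UnitaryFlow E) (ξ η : L2E E) : ⟪V.fwd ξ, V.fwd η⟫_ℂ = ⟪ξ, η⟫_ℂ :=
  (twist V.op V.norm_op V.continuous_op).inner_map_map ξ η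

theorem fwd_bwd (V : UnitaryFlow E) (ξ : L2E E) : V.fwd (V.bwd ξ) = ξ := by
  apply Lp.ext
  filter_upwards [V.fwd_ae (V.bwd ξ), V.bwd_ae ξ] with t h1 h2
  rw [h1, h2, V.op_op_neg]

theorem bwd_fwd (V : UnitaryFlow E) (ξ : L2E E) : V.bwd (V.fwd ξ) = ξ := by
  apply Lp.ext
  filter_upwards [V.bwd_ae (V.fwd ξ), V.fwd_ae ξ] with t h1 h2
  rw [h1, h2, V.op_neg_op]

theorem inner_fwd_left (V : UnitaryFlow E) (ξ η : L2E E) : ⟪V.fwd ξ, η⟫_ℂ = ⟪ξ, V.bwd η⟫_ℂ := by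
  rw [← V.inner_fwd ξ, V.fwd_bwd]

theorem inner_bwd_left (V : UnitaryFlow E) (ξ η : L2E E) : ⟪V.bwd ξ, η⟫_ℂ = ⟪ξ, V.fwd η⟫_ℂ := by
  rw [← V.inner_fwd, V.fwd_bwd]

/-- Conjugation by `W`. It takes the left translation algebra to the algebra of the right
multiplications. -/
def rho (V : UnitaryFlow E) (b : L2E E →L[ℂ] L2E E) : L2E E →L[ℂ] L2E E := V.fwd ∘L b ∘L V.bwd

theorem rho_apply (V : UnitaryFlow E) (b : L2E E →L[ℂ] L2E E) (ξ : L2E E) :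
    V.rho b ξ = V.fwd (b (V.bwd ξ)) := rfl

theorem rho_shift (V : UnitaryFlow E) (s : ℝ) (ξ : L2E E) :
    V.rho (shift E s) ξ = amplify (V.op s) (shift E s ξ) := by
  apply Lp.ext
  filter_upwards [V.fwd_ae (shift E s (V.bwd ξ)), shift_ae s (V.bwd ξ), ae_shift (V.bwd_ae ξ) s,
    amplify_ae (V.op s) (shift E s ξ), shift_ae s ξ] with t h1 h2 h3 h4 h5
  rw [rho_apply, h1, h2, h3, h4, h5, ← V.op_add]
  congr 2; ring

theorem fwd_tens (V : UnitaryFlow E) {Ω : E} (hV : ∀ t, V.op t Ω = Ω) (g : L2R) :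
    V.fwd (tens Ω g) = tens Ω g := by
  apply Lp.ext
  filter_upwards [V.fwd_ae (tens Ω g), tens_ae Ω g] with t h1 h2
  rw [h1, h2, map_smul, hV]

theorem bwd_tens (V : UnitaryFlow E) {Ω : E} (hV : ∀ t, V.op t Ω = Ω) (g : L2R) :
    V.bwd (tens Ω g) = tens Ω g := by
  rw [← V.fwd_tens hV g, V.bwd_fwd, V.fwd_tens hV]

theorem slice_fwd (V : UnitaryFlow E) {Ω : E} (hV : ∀ t, V.op t Ω = Ω) (ξ : L2E E) :
    slice Ω (V.fwd ξ) = slice Ω ξ := by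
  apply ext_inner_left ℂ
  intro g
  rw [← inner_tens_left, ← inner_tens_left, ← V.inner_bwd_left, V.bwd_tens hV]

theorem slice_bwd (V : UnitaryFlow E) {Ω : E} (hV : ∀ t, V.op t Ω = Ω) (ξ : L2E E) :
    slice Ω (V.bwd ξ) = slice Ω ξ := by
  rw [← V.slice_fwd hV, V.fwd_bwd]

open scoped BoundedContinuousFunction in
/-- The matrix coefficient `t ↦ ⟨w, V_{-t} w'⟩`. -/
def coeff (V : UnitaryFlow E) (w w' : E) : ℝ →ᵇ ℂ :=
  BoundedContinuousFunction.ofNormedAddCommGroup (fun t => ⟪w, V.op (-t) w'⟫_ℂ)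
    (by
      have := (V.continuous_op w').comp continuous_neg
      exact continuous_const.inner this) (‖w‖ * ‖w'‖) fun t => by
    have := norm_inner_le_norm (𝕜 := ℂ) w (V.op (-t) w')
    rwa [V.norm_op] at this

theorem slice_bwd_tens (V : UnitaryFlow E) (w w' : E) (g : L2R) :
    slice w (V.bwd (tens w' g)) = bddMul (V.coeff w w') g := by
  apply Lp.ext
  filter_upwards [slice_ae w (V.bwd (tens w' g)), V.bwd_ae (tens w' g), tens_ae w' g,
    bddMul_ae (V.coeff w w') g] with t h1 h2 h3 h4
  rw [h1, h2, h3, h4, map_smul, inner_smul_right, mul_comm]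
  rfl

variable [CompleteSpace E]

theorem inner_rho_left (V : UnitaryFlow E) (b : L2E E →L[ℂ] L2E E) (ξ η : L2E E) :
    ⟪V.rho b ξ, η⟫_ℂ = ⟪ξ, V.rho (star b) η⟫_ℂ := by
  rw [rho_apply, rho_apply, inner_fwd_left, ← ContinuousLinearMap.adjoint_inner_right,
    inner_bwd_left]
  rfl

/-- Left and right multiplication by an element of the translation algebra agree on the vectors
`g ⊗ Ω`. -/
theorem rho_tens (V : UnitaryFlow E) {Ω : E} (hΩ : ‖Ω‖ = 1) (hV : ∀ t, V.op t Ω = Ω)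
    {b : L2E E →L[ℂ] L2E E} (hb : b ∈ transAlg E) (g : L2R) :
    V.rho b (tens Ω g) = b (tens Ω g) := by
  rw [rho_apply, V.bwd_tens hV, transAlg_tens hΩ hb, V.fwd_tens hV]

/-- If `x` commutes with the operators `W λ_s W⁻¹`, then it commutes with `W b W⁻¹` for all `b`
in the translation algebra. -/
theorem commute_rho (V : UnitaryFlow E) {x : L2E E →L[ℂ] L2E E}
    (hx : ∀ s ξ, x (V.rho (shift E s) ξ) = V.rho (shift E s) (x ξ))
    {b : L2E E →L[ℂ] L2E E} (hb : b ∈ transAlg E) (ξ : L2E E) :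
    x (V.rho b ξ) = V.rho b (x ξ) := by
  have h := mem_transAlg_iff.1 hb (V.bwd ∘L x ∘L V.fwd) (fun s ξ => by
    have h1 := hx s (V.fwd ξ)
    rw [rho_apply, rho_apply, V.bwd_fwd] at h1
    change V.bwd (x (V.fwd (shift E s ξ))) = shift E s (V.bwd (x (V.fwd ξ)))
    rw [h1, V.bwd_fwd]) (V.bwd ξ)
  change V.bwd (x (V.fwd (b (V.bwd ξ)))) = b (V.bwd (x (V.fwd (V.bwd ξ)))) at h
  rw [V.fwd_bwd] at h
  rw [rho_apply, rho_apply, ← h, V.fwd_bwd]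

/-- The vectors orthogonal to `L²(ℝ) ⊗ Ω` are approximated by elementary tensors `g ⊗ w` with `w`
orthogonal to `Ω`. -/
theorem mem_closure_span_tens {Ω : E} (hΩ : ‖Ω‖ = 1) {S : Set L2R}
    (hS : Dense (Submodule.span ℂ S : Set L2R)) {ξ : L2E E} (hξ : slice Ω ξ = 0) :
    ξ ∈ (Submodule.span ℂ {x : L2E E | ∃ g ∈ S, ∃ w, ⟪Ω, w⟫_ℂ = 0 ∧ x = tens w g}).topologicalClosure := by
  let y : L2E E →L[ℂ] L2E E := 1 - amplify (rankOne Ω Ω)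
  have hy : y ξ = ξ := by
    change ξ - amplify (rankOne Ω Ω) ξ = ξ
    rw [amplify_rankOne, hξ, map_zero, sub_zero]
  rw [← hy]
  refine map_mem_closure y.continuous (dense_span_tens hS ξ) ?_
  intro x hx
  induction hx using Submodule.span_induction with
  | mem x hx =>
    obtain ⟨g, hg, w, rfl⟩ := hx
    refine Submodule.subset_span ⟨g, hg, w - ⟪Ω, w⟫_ℂ • Ω, ?_, ?_⟩
    · rw [inner_sub_right, inner_smul_right, inner_self_one hΩ, mul_one, sub_self]
    · change tens w g - amplify (rankOne Ω Ω) (tens w g) = _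
      rw [amplify_tens, rankOne_apply, sub_eq_add_neg w, ← neg_smul, tens_add, tens_smul,
        tens_smul, neg_smul, sub_eq_add_neg]
  | zero => simp
  | add a b _ _ ha hb => rw [map_add]; exact Submodule.add_mem _ ha hb
  | smul z a _ ha => rw [map_smul]; exact Submodule.smul_mem _ _ ha

theorem mem_closure_span_fwd_tens (V : UnitaryFlow E) {Ω : E} (hΩ : ‖Ω‖ = 1)
    (hV : ∀ t, V.op t Ω = Ω) {S : Set L2R}
    (hS : Dense (Submodule.span ℂ S : Set L2R)) {ξ : L2E E} (hξ : slice Ω ξ = 0) :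
    ξ ∈ (Submodule.span ℂ {x : L2E E | ∃ g ∈ S, ∃ w, ⟪Ω, w⟫_ℂ = 0 ∧
      x = V.fwd (tens w g)}).topologicalClosure := by
  rw [← V.fwd_bwd ξ]
  refine map_mem_closure V.fwd.continuous
    (mem_closure_span_tens hΩ hS (ξ := V.bwd ξ) (by rw [V.slice_bwd hV, hξ])) ?_
  intro x hx
  induction hx using Submodule.span_induction with
  | mem x hx =>
    obtain ⟨g, hg, w, hw, rfl⟩ := hx
    exact Submodule.subset_span ⟨g, hg, w, hw, rfl⟩
  | zero => simp
  | add a b _ _ ha hb => rw [map_add]; exact Submodule.add_mem _ ha hb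
  | smul z a _ ha => rw [map_smul]; exact Submodule.smul_mem _ _ ha

/-- Mixing of the translation algebra relative to itself: if elements `a n` of the translation
algebra converge weakly to `0`, then their matrix coefficients between `g ⊗ w` and vectors `ξ`
orthogonal to `L²(ℝ) ⊗ Ω` converge to `0`, uniformly in `g`. -/
theorem tendsto_slice_bwd (V : UnitaryFlow E) {Ω : E} (hΩ : ‖Ω‖ = 1)
    (hmix : ∀ w w', ⟪Ω, w⟫_ℂ = 0 → ⟪Ω, w'⟫_ℂ = 0 →
      Tendsto (fun t => ⟪w, V.op t w'⟫_ℂ) (cocompact ℝ) (𝓝 0))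
    {a : ℕ → L2E E →L[ℂ] L2E E} (ha : ∀ n, a n ∈ transAlg E) {C : ℝ}
    (hC : ∀ n ξ, ‖a n ξ‖ ≤ C * ‖ξ‖)
    (hw : ∀ h g, Tendsto (fun n => ⟪tens Ω h, a n (tens Ω g)⟫_ℂ) atTop (𝓝 0))
    {w : E} (hwΩ : ⟪Ω, w⟫_ℂ = 0) {ξ : L2E E} (hξ : slice Ω ξ = 0) :
    Tendsto (fun n => slice w (V.bwd (a n ξ))) atTop (𝓝 0) := by
  refine tendsto_zero_of_dense_span (T := fun n => slice w ∘L V.bwd ∘L a n)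
    (C := ‖slice w‖ * C) (fun n x => ?_)
    (mem_closure_span_tens hΩ (S := Set.univ) (by simp) hξ) ?_
  · refine ((slice w).le_opNorm _).trans ?_
    rw [mul_assoc]
    refine mul_le_mul_of_nonneg_left ?_ (norm_nonneg _)
    change ‖V.bwd (a n x)‖ ≤ _
    rw [V.norm_bwd]
    exact hC n x
  · rintro _ ⟨g, -, w', hw', rfl⟩
    have h1 : ∀ n, (slice w ∘L V.bwd ∘L a n) (tens w' g)
        = bddMul (V.coeff w w') (compress Ω (a n) g) := fun n => by
      change slice w (V.bwd (a n (tens w' g))) = _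
      rw [transAlg_tens hΩ (ha n), slice_bwd_tens]
    simp only [h1]
    refine tendsto_bddMul_of_weak (V.coeff w w') ?_ (T := fun n => compress Ω (a n))
      (fun n => compress_shift_of_mem (ha n)) (fun n => norm_compress_le hΩ (hC n))
      (fun h g => ?_) g
    · exact (hmix w w' hwΩ hw').comp (Homeomorph.neg ℝ).isClosedEmbedding.tendsto_cocompact
    · simp only [compress_apply, ← inner_tens_left]
      exact hw h g

end UnitaryFlow

/-! ### Elementary tensors in the full Fock space -/

theorem PosKernel.dense_span_delta {X : Type*} (κ : PosKernel X) :
    Dense (Submodule.span ℂ (Set.range κ.delta) : Set κ.Space) := by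
  refine Dense.mono ?_ (UniformSpace.Completion.denseRange_coe (α := κ.Pre))
  rintro _ ⟨f, rfl⟩
  have h : ∀ f : X →₀ ℂ, ((show κ.Pre from f : κ.Pre) : κ.Space) ∈
      Submodule.span ℂ (Set.range κ.delta) := by
    intro f
    induction f using Finsupp.induction_linear with
    | zero =>
      have : ((0 : κ.Pre) : κ.Space) = 0 := UniformSpace.Completion.coe_zero
      exact this ▸ Submodule.zero_mem _
    | add f g hf hg =>
      have : (((show κ.Pre from f) + (show κ.Pre from g) : κ.Pre) : κ.Space)
          = ((show κ.Pre from f : κ.Pre) : κ.Space) + ((show κ.Pre from g : κ.Pre) : κ.Space) :=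
        UniformSpace.Completion.coe_add _ _
      exact this ▸ Submodule.add_mem _ hf hg
    | single x c =>
      have : ((show κ.Pre from Finsupp.single x c : κ.Pre) : κ.Space) = c • κ.delta x := by
        rw [PosKernel.delta, ← UniformSpace.Completion.coe_smul]
        congr 1
        change Finsupp.single x c = c • (Finsupp.single x (1 : ℂ) : X →₀ ℂ)
        rw [Finsupp.smul_single, smul_eq_mul, mul_one]
      exact this ▸ Submodule.smul_mem _ _ (Submodule.subset_span ⟨x, rfl⟩)
  exact h f

section FockWords

variable {H : Type*} [NormedAddCommGroup H] [InnerProductSpace ℂ H]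

variable (H) in
theorem dense_span_tensorWord :
    Dense (Submodule.span ℂ (Set.range (tensorWord : List H → Fock H)) : Set (Fock H)) :=
  (fockKernel H).dense_span_delta

theorem fock_clm_ext {F : Type*} [NormedAddCommGroup F] [NormedSpace ℂ F]
    {S T : Fock H →L[ℂ] F} (h : ∀ w, S (tensorWord w) = T (tensorWord w)) : S = T := by
  refine ContinuousLinearMap.ext_on (dense_span_tensorWord H) ?_
  rintro _ ⟨w, rfl⟩
  exact h w

theorem fock_ext {x y : Fock H} (h : ∀ w, ⟪tensorWord w, x⟫_ℂ = ⟪tensorWord w, y⟫_ℂ) : x = y := by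
  have : innerSL ℂ x = innerSL ℂ y := fock_clm_ext fun w => by
    have := congrArg (starRingEnd ℂ) (h w)
    rwa [inner_conj_symm, inner_conj_symm] at this
  refine ext_inner_right ℂ fun v => ?_
  exact congrArg (fun f => f v) this

theorem norm_vacuum : ‖vacuum H‖ = 1 := by
  have h : ⟪vacuum H, vacuum H⟫_ℂ = 1 := by
    rw [vacuum, inner_tensorWord]; rfl
  rw [@norm_eq_sqrt_re_inner ℂ, h]; simp

theorem wordInner_map_map {V : H → H} (hV : ∀ ξ η, ⟪V ξ, V η⟫_ℂ = ⟪ξ, η⟫_ℂ) (v w : List H) :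
    wordInner (v.map V) (w.map V) = wordInner v w := by
  induction v generalizing w with
  | nil => cases w <;> simp [wordInner]
  | cons a v ih => cases w <;> simp [wordInner, hV, ih]

theorem inner_secondQuant (V : H →L[ℂ] H) (hV : ∀ ξ η, ⟪V ξ, V η⟫_ℂ = ⟪ξ, η⟫_ℂ) (x y : Fock H) :
    ⟪secondQuant V hV x, secondQuant V hV y⟫_ℂ = ⟪x, y⟫_ℂ := by
  have h : ContinuousLinearMap.adjoint (secondQuant V hV) ∘L secondQuant V hV
      = ContinuousLinearMap.id ℂ (Fock H) := by
    refine fock_clm_ext fun w => fock_ext fun v => ?_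
    rw [ContinuousLinearMap.comp_apply, ContinuousLinearMap.adjoint_inner_right,
      secondQuant_tensorWord, secondQuant_tensorWord, inner_tensorWord, wordInner_map_map hV,
      ContinuousLinearMap.id_apply, inner_tensorWord]
  rw [← ContinuousLinearMap.adjoint_inner_right]
  have h2 : ContinuousLinearMap.adjoint (secondQuant V hV) (secondQuant V hV y) = y :=
    congrArg (fun T : Fock H →L[ℂ] Fock H => T y) h
  rw [h2]

theorem adjoint_creation_vacuum (ξ : H) :
    ContinuousLinearMap.adjoint (creation ξ) (tensorWord []) = 0 := by
  refine fock_ext fun v => ?_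
  rw [ContinuousLinearMap.adjoint_inner_right, creation_tensorWord, inner_tensorWord,
    inner_zero_right]
  rfl

theorem adjoint_creation_cons (ξ ζ : H) (w : List H) :
    ContinuousLinearMap.adjoint (creation ξ) (tensorWord (ζ :: w)) = ⟪ξ, ζ⟫_ℂ • tensorWord w := by
  refine fock_ext fun v => ?_
  rw [ContinuousLinearMap.adjoint_inner_right, creation_tensorWord, inner_tensorWord,
    inner_smul_right, inner_tensorWord]
  rfl

theorem wordInner_nil_append (w : List H) (η : H) : wordInner [] (w ++ [η]) = 0 := by
  cases w <;> rfl

theorem wordInner_append_nil (w : List H) (η : H) : wordInner (w ++ [η]) [] = 0 := by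
  cases w <;> rfl

theorem wordInner_append_append (v w : List H) (ξ η : H) :
    wordInner (v ++ [ξ]) (w ++ [η]) = ⟪ξ, η⟫_ℂ * wordInner v w := by
  induction v generalizing w with
  | nil =>
    cases w with
    | nil => simp [wordInner]
    | cons b w => simp [wordInner, wordInner_nil_append]
  | cons a v ih =>
    cases w with
    | nil => simp [wordInner, wordInner_append_nil]
    | cons b w =>
      simp only [List.cons_append, wordInner, ih]
      ring

/-- The right creation operator: `r(η) (ξ₁ ⊗ ⋯ ⊗ ξₙ) = ξ₁ ⊗ ⋯ ⊗ ξₙ ⊗ η`. -/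
def rightCreation (η : H) : Fock H →L[ℂ] Fock H :=
  (fockKernel H).map (fun w => w ++ [η]) ‖η‖ (norm_nonneg η) (fun v w => by
    change wordInner (v ++ [η]) (w ++ [η]) = (‖η‖ : ℂ) ^ 2 * wordInner v w
    rw [wordInner_append_append, inner_self_eq_norm_sq_to_K]; rfl)

theorem rightCreation_tensorWord (η : H) (w : List H) :
    rightCreation η (tensorWord w) = tensorWord (w ++ [η]) :=
  (fockKernel H).map_delta _ _ _ _ w

theorem adjoint_rightCreation_vacuum (η : H) :
    ContinuousLinearMap.adjoint (rightCreation η) (tensorWord []) = 0 := by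
  refine fock_ext fun v => ?_
  rw [ContinuousLinearMap.adjoint_inner_right, rightCreation_tensorWord, inner_tensorWord,
    inner_zero_right, wordInner_append_nil]

theorem adjoint_rightCreation_append (η ζ : H) (w : List H) :
    ContinuousLinearMap.adjoint (rightCreation η) (tensorWord (w ++ [ζ]))
      = ⟪η, ζ⟫_ℂ • tensorWord w := by
  refine fock_ext fun v => ?_
  rw [ContinuousLinearMap.adjoint_inner_right, rightCreation_tensorWord, inner_tensorWord,
    inner_smul_right, inner_tensorWord, wordInner_append_append]

/-- The right field operator `r(η) + r(η)^*`. -/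
def rightField (η : H) : Fock H →L[ℂ] Fock H :=
  rightCreation η + ContinuousLinearMap.adjoint (rightCreation η)

theorem adjoint_semicircular (ξ : H) :
    ContinuousLinearMap.adjoint (semicircular ξ) = semicircular ξ := by
  rw [semicircular, map_smulₛₗ, map_add, ContinuousLinearMap.adjoint_adjoint, add_comm]
  congr 1
  simp only [map_div₀, map_one, map_ofNat]

/-- Left and right fields commute if the inner product of their arguments is real. -/
theorem semicircular_rightField (ξ η : H) (h : ⟪η, ξ⟫_ℂ = ⟪ξ, η⟫_ℂ) :
    semicircular ξ ∘L rightField η = rightField η ∘L semicircular ξ := by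
  have key : (creation ξ + ContinuousLinearMap.adjoint (creation ξ)) ∘L rightField η
      = rightField η ∘L (creation ξ + ContinuousLinearMap.adjoint (creation ξ)) := by
    refine fock_clm_ext fun w => ?_
    simp only [rightField, ContinuousLinearMap.comp_apply, add_apply]
    rcases w with _ | ⟨a, w⟩
    · have e1 : (tensorWord [ξ] : Fock H) = tensorWord ([] ++ [ξ]) := rfl
      rw [adjoint_creation_vacuum, adjoint_rightCreation_vacuum, add_zero, add_zero,
        rightCreation_tensorWord, creation_tensorWord, creation_tensorWord, List.nil_append,
        adjoint_creation_cons, rightCreation_tensorWord, e1, adjoint_rightCreation_append, h]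
      rfl
    · rcases List.eq_nil_or_concat w with rfl | ⟨u, b, rfl⟩
      · have e1 : (tensorWord [a] : Fock H) = tensorWord ([] ++ [a]) := rfl
        have e2 : (tensorWord [ξ, a] : Fock H) = tensorWord ([ξ] ++ [a]) := rfl
        rw [rightCreation_tensorWord, creation_tensorWord]
        conv_lhs => rw [e1, adjoint_rightCreation_append]
        rw [List.cons_append, List.nil_append, map_add, map_smul, creation_tensorWord,
          creation_tensorWord, map_add, map_smul, adjoint_creation_cons, adjoint_creation_vacuum,
          adjoint_creation_cons, map_add, map_smul, rightCreation_tensorWord,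
          rightCreation_tensorWord, map_add, map_smul, adjoint_rightCreation_vacuum, e2,
          adjoint_rightCreation_append]
        simp only [List.cons_append, List.nil_append, smul_zero, add_zero]
        abel
      · rw [List.concat_eq_append] at *
        have e1 : ∀ c : H, (tensorWord (c :: (u ++ [b])) : Fock H) = tensorWord ((c :: u) ++ [b]) :=
          fun _ => rfl
        have e2 : (tensorWord (ξ :: a :: (u ++ [b])) : Fock H) = tensorWord ((ξ :: a :: u) ++ [b]) :=
          rfl
        rw [rightCreation_tensorWord, creation_tensorWord]
        conv_lhs => rw [e1 a, adjoint_rightCreation_append]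
        rw [List.cons_append, map_add, map_smul, creation_tensorWord,
          creation_tensorWord, map_add, map_smul, adjoint_creation_cons, adjoint_creation_cons,
          adjoint_creation_cons, map_add, map_smul, rightCreation_tensorWord,
          rightCreation_tensorWord, map_add, map_smul, e2, adjoint_rightCreation_append,
          adjoint_rightCreation_append]
        simp only [List.cons_append, smul_smul]
        rw [mul_comm ⟪η, b⟫_ℂ]
        abel
  rw [semicircular, ContinuousLinearMap.smul_comp, key, ContinuousLinearMap.comp_smul]

theorem wordInner_append_add (v w : List H) (η η' : H) :
    wordInner v (w ++ [η + η']) = wordInner v (w ++ [η]) + wordInner v (w ++ [η']) := by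
  rcases List.eq_nil_or_concat v with rfl | ⟨u, b, rfl⟩
  · simp [wordInner_nil_append]
  · rw [List.concat_eq_append, wordInner_append_append, wordInner_append_append,
      wordInner_append_append, inner_add_right, add_mul]

theorem wordInner_append_smul (v w : List H) (c : ℂ) (η : H) :
    wordInner v (w ++ [c • η]) = c * wordInner v (w ++ [η]) := by
  rcases List.eq_nil_or_concat v with rfl | ⟨u, b, rfl⟩
  · simp [wordInner_nil_append]
  · rw [List.concat_eq_append, wordInner_append_append, wordInner_append_append,
      inner_smul_right, mul_assoc]

/-- The operator `η ↦ ξ₁ ⊗ ⋯ ⊗ ξₙ ⊗ η`. -/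
def lastSlot (w : List H) : H →L[ℂ] Fock H :=
  LinearMap.mkContinuous
    { toFun η := tensorWord (w ++ [η])
      map_add' η η' := fock_ext fun v => by
        rw [inner_add_right]
        simp only [inner_tensorWord, wordInner_append_add]
      map_smul' c η := fock_ext fun v => by
        rw [RingHom.id_apply, inner_smul_right]
        simp only [inner_tensorWord, wordInner_append_smul] } ‖(tensorWord w : Fock H)‖ fun η => by
    change ‖tensorWord (w ++ [η])‖ ≤ _
    have h : ‖(tensorWord (w ++ [η]) : Fock H)‖ ^ 2 = (‖(tensorWord w : Fock H)‖ * ‖η‖) ^ 2 := by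
      have h1 := inner_tensorWord (w ++ [η]) (w ++ [η])
      rw [wordInner_append_append, ← inner_tensorWord, inner_self_eq_norm_sq_to_K,
        inner_self_eq_norm_sq_to_K, inner_self_eq_norm_sq_to_K] at h1
      rw [mul_pow, mul_comm]
      apply Complex.ofReal_injective
      simpa using h1
    exact (abs_le_of_sq_le_sq' h.le (by positivity)).2

/-- If the vectors `η` with `r(η) + r(η)^*` leaving a closed subspace invariant are total, and the
subspace contains the vacuum, then the subspace is the whole Fock space. -/
theorem eq_top_of_rightField_invariant (N : Submodule ℂ (Fock H)) (hN : IsClosed (N : Set (Fock H)))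
    (h0 : vacuum H ∈ N) {S : Set H} (hS : Dense (Submodule.span ℂ S : Set H))
    (h : ∀ η ∈ S, ∀ x ∈ N, rightField η x ∈ N) : N = ⊤ := by
  have key : ∀ n : ℕ, ∀ w : List H, w.length ≤ n → tensorWord w ∈ N := by
    intro n
    induction n with
    | zero =>
      intro w hw
      obtain rfl : w = [] := by simpa using hw
      exact h0
    | succ n ih =>
      intro w hw
      rcases List.eq_nil_or_concat w with rfl | ⟨u, b, rfl⟩
      · exact h0
      rw [List.concat_eq_append] at hw ⊢
      have hu : u.length ≤ n := by simpa using hw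
      have hclosed : ∀ η, lastSlot u η ∈ N := by
        intro η
        have h1 : η ∈ closure (Submodule.span ℂ S : Set H) := hS η
        have h2 := map_mem_closure (lastSlot u).continuous h1 (t := (N : Set (Fock H))) ?_
        · rwa [hN.closure_eq] at h2
        intro x hx
        induction hx using Submodule.span_induction with
        | mem x hx =>
          have h3 := h x hx _ (ih u hu)
          rw [rightField, add_apply, rightCreation_tensorWord] at h3
          refine (Submodule.add_mem_iff_left N ?_).1 h3
          rcases List.eq_nil_or_concat u with rfl | ⟨u', b', rfl⟩
          · rw [adjoint_rightCreation_vacuum]; exact N.zero_mem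
          · rw [List.concat_eq_append, adjoint_rightCreation_append]
            refine N.smul_mem _ (ih _ ?_)
            simp at hu; omega
        | zero => rw [map_zero]; exact N.zero_mem
        | add a b _ _ ha hb => rw [map_add]; exact N.add_mem ha hb
        | smul z a _ ha => rw [map_smul]; exact N.smul_mem _ ha
      exact hclosed b
  rw [Submodule.eq_top_iff']
  intro x
  have hx := dense_span_tensorWord H x
  have hle : Submodule.span ℂ (Set.range (tensorWord : List H → Fock H)) ≤ N := by
    rw [Submodule.span_le]
    rintro _ ⟨w, rfl⟩
    exact key _ w le_rfl
  have := closure_mono (SetLike.coe_subset_coe.2 hle) hx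
  rwa [hN.closure_eq] at this

end FockWords

/-! ### The deformed inner product and the one-particle flow -/

/-- Convergence to `0` of matrix coefficients may be checked on total sets. -/
theorem tendsto_inner_of_total {E ι : Type*} [NormedAddCommGroup E] [InnerProductSpace ℂ E]
    {l : Filter ι} {f : ι → E →L[ℂ] E} (hf : ∀ t x, ‖f t x‖ = ‖x‖) {S : Set E}
    (h : ∀ x ∈ S, ∀ y ∈ S, Tendsto (fun t => ⟪x, f t y⟫_ℂ) l (𝓝 0)) {w w' : E}
    (hw : w ∈ (Submodule.span ℂ S).topologicalClosure)
    (hw' : w' ∈ (Submodule.span ℂ S).topologicalClosure) :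
    Tendsto (fun t => ⟪w, f t w'⟫_ℂ) l (𝓝 0) := by
  have h1 : ∀ x ∈ S, Tendsto (fun t => ⟪x, f t w'⟫_ℂ) l (𝓝 0) := fun x hx =>
    tendsto_zero_of_dense_span (T := fun t => innerSL ℂ x ∘L f t) (C := ‖x‖)
      (fun t y => by
        have := norm_inner_le_norm (𝕜 := ℂ) x (f t y)
        rwa [hf] at this) hw' (fun y hy => h x hx y hy)
  have h2 := tendsto_zero_of_dense_span (T := fun t => innerSL ℂ (f t w')) (C := ‖w'‖)
    (l := l) (fun t y => by
        have := norm_inner_le_norm (𝕜 := ℂ) (f t w') y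
        rwa [hf] at this) hw (fun y hy => by
        have := (h1 y hy).star
        rw [star_zero] at this
        refine this.congr fun t => ?_
        exact inner_conj_symm _ _)
  have := h2.star
  rw [star_zero] at this
  exact this.congr fun t => inner_conj_symm _ _

/-- A family of isometries that is strongly continuous on a total set is strongly continuous. -/
theorem continuous_of_total {E : Type*} [NormedAddCommGroup E] [InnerProductSpace ℂ E]
    {f : ℝ → E →L[ℂ] E} (hf : ∀ t x, ‖f t x‖ = ‖x‖) {S : Set E}
    (hS : Dense (Submodule.span ℂ S : Set E))
    (h : ∀ x ∈ S, Continuous fun t => f t x) (x : E) : Continuous fun t => f t x := by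
  rw [continuous_iff_continuousAt]
  intro s
  rw [ContinuousAt, ← tendsto_sub_nhds_zero_iff]
  refine tendsto_zero_of_dense_span (T := fun t => f t - f s) (C := 2) (fun t y => ?_) (hS x)
    fun y hy => ?_
  · refine (norm_sub_le _ _).trans ?_
    have h1 := hf t y
    have h2 := hf s y
    change ‖f t y‖ + ‖f s y‖ ≤ _
    linarith
  · exact tendsto_sub_nhds_zero_iff.2 ((h y hy).tendsto s)

namespace Cplx

variable {H : Type*} [NormedAddCommGroup H]

theorem continuous_mk : Continuous fun p : H × H => mk p.1 p.2 :=
  WithLp.prod_continuous_toLp 2 H H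

variable [InnerProductSpace ℝ H]

theorem eq_mk_add (x : Cplx H) : x = mk x.re 0 + Complex.I • mk x.im 0 := by
  apply ext <;> simp

/-- The complex conjugation `a + i b ↦ a - i b`. -/
def conj : Cplx H →L⋆[ℂ] Cplx H :=
  LinearMap.mkContinuous
    { toFun x := mk x.re (-x.im)
      map_add' x y := by apply ext <;> simp [add_comm]
      map_smul' z x := by apply ext <;> simp; abel } 1 fun x => by
    have h : ‖mk x.re (-x.im)‖ ^ 2 = ‖x‖ ^ 2 := by rw [norm_sq, norm_sq]; simp
    rw [one_mul]
    exact ((sq_eq_sq₀ (norm_nonneg _) (norm_nonneg _)).1 h).le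

theorem conj_apply (x : Cplx H) : conj x = mk x.re (-x.im) := rfl

theorem conj_conj (x : Cplx H) : conj (conj x) = x := by
  apply ext <;> simp [conj_apply]

theorem conj_mk_zero (a : H) : conj (mk a 0) = mk a 0 := by
  apply ext <;> simp [conj_apply]

theorem inner_conj_conj (x y : Cplx H) : ⟪conj x, conj y⟫_ℂ = (starRingEnd ℂ) ⟪x, y⟫_ℂ := by
  rw [inner_def, inner_def]
  apply Complex.ext <;> simp [conj_apply]
  ring

end Cplx

namespace OrthRep

variable {H : Type*} [NormedAddCommGroup H] [InnerProductSpace ℝ H]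

theorem norm_pre_sq (U : OrthRep H) (x : Cplx H) :
    ‖(show U.Pre from x : U.Pre)‖ ^ 2 = RCLike.re ⟪x, U.deformation x⟫_ℂ := by
  rw [← @inner_self_eq_norm_sq ℂ]
  rfl

/-- The map from the complexification of `H` to the completion for the deformed inner product. -/
def toSpace (U : OrthRep H) : Cplx H →L[ℂ] U.Space :=
  LinearMap.mkContinuous
    { toFun x := ((show U.Pre from x : U.Pre) : U.Space)
      map_add' x y := UniformSpace.Completion.coe_add (show U.Pre from x) (show U.Pre from y)
      map_smul' c x := UniformSpace.Completion.coe_smul c (show U.Pre from x) }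
    (Real.sqrt ‖U.deformation‖) fun x => by
    change ‖((show U.Pre from x : U.Pre) : U.Space)‖ ≤ _
    rw [UniformSpace.Completion.norm_coe]
    refine le_of_sq_le_sq ?_ (by positivity)
    rw [norm_pre_sq, mul_pow, Real.sq_sqrt (by positivity)]
    refine (RCLike.re_le_norm _).trans ((norm_inner_le_norm _ _).trans ?_)
    have := U.deformation.le_opNorm x
    nlinarith [norm_nonneg x]

theorem incl_eq (U : OrthRep H) (ξ : H) : U.incl ξ = U.toSpace (Cplx.mk ξ 0) := rfl

theorem denseRange_toSpace (U : OrthRep H) : DenseRange U.toSpace :=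
  UniformSpace.Completion.denseRange_coe (α := U.Pre)

theorem inner_toSpace (U : OrthRep H) (x y : Cplx H) :
    ⟪U.toSpace x, U.toSpace y⟫_ℂ = ⟪x, U.deformation y⟫_ℂ :=
  UniformSpace.Completion.inner_coe _ _

theorem continuous_cop (U : OrthRep H) (x : Cplx H) : Continuous fun t => U.cop t x :=
  Cplx.continuous_mk.comp ((U.continuous_op x.re).prodMk (U.continuous_op x.im))

theorem dense_span_range_toSpace (U : OrthRep H) :
    Dense (Submodule.span ℂ (Set.range U.toSpace) : Set U.Space) :=
  U.denseRange_toSpace.mono Submodule.subset_span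

theorem tendsto_inner_cop (U : OrthRep H) (hU : U.IsMixing) (x y : Cplx H) :
    Tendsto (fun t => ⟪x, U.cop t y⟫_ℂ) (cocompact ℝ) (𝓝 0) := by
  have h (a b : H) : Tendsto (fun t => ((⟪b, U.op t a⟫_ℝ : ℝ) : ℂ)) (cocompact ℝ) (𝓝 0) := by
    have h1 := (Complex.continuous_ofReal.tendsto 0).comp (hU a b)
    rw [Complex.ofReal_zero] at h1
    refine h1.congr fun t => ?_
    rw [Function.comp_apply, real_inner_comm]
  have h2 := ((h y.re x.re).add (h y.im x.im)).add
    (((h y.im x.re).sub (h y.re x.im)).mul_const Complex.I)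
  simp only [add_zero, sub_zero, zero_mul] at h2
  refine h2.congr fun t => ?_
  rw [Cplx.inner_def]
  apply Complex.ext <;> simp [cop]

variable [CompleteSpace H]

theorem uop_toSpace (U : OrthRep H) (t : ℝ) (x : Cplx H) :
    U.uop t (U.toSpace x) = U.toSpace (U.cop t x) :=
  complMap_coe _ _ _ _

theorem norm_uop (U : OrthRep H) (t : ℝ) (x : U.Space) : ‖U.uop t x‖ = ‖x‖ := by
  rw [@norm_eq_sqrt_re_inner ℂ, @norm_eq_sqrt_re_inner ℂ, U.inner_uop]

theorem uop_add (U : OrthRep H) (s t : ℝ) (x : U.Space) :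
    U.uop (s + t) x = U.uop s (U.uop t x) := by
  have : U.uop (s + t) = U.uop s ∘L U.uop t := by
    refine ContinuousLinearMap.ext_on U.dense_span_range_toSpace ?_
    rintro _ ⟨x, rfl⟩
    rw [ContinuousLinearMap.comp_apply, uop_toSpace, uop_toSpace, uop_toSpace, cop_add]
  rw [this]; rfl

theorem continuous_uop (U : OrthRep H) (x : U.Space) : Continuous fun t => U.uop t x := by
  refine continuous_of_total U.norm_uop U.dense_span_range_toSpace ?_ x
  rintro _ ⟨x, rfl⟩
  simp only [uop_toSpace]
  exact U.toSpace.continuous.comp (U.continuous_cop x)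

theorem continuous_wordInner (U : OrthRep H) (v w : List U.Space) :
    Continuous fun t => wordInner v (w.map (U.uop t)) := by
  induction v generalizing w with
  | nil => cases w <;> exact continuous_const
  | cons a v ih =>
    cases w with
    | nil => exact continuous_const
    | cons b w => exact (continuous_const.inner (U.continuous_uop b)).mul (ih w)

theorem inner_fockOp (U : OrthRep H) (t : ℝ) (x y : Fock U.Space) :
    ⟪U.fockOp t x, U.fockOp t y⟫_ℂ = ⟪x, y⟫_ℂ :=
  inner_secondQuant _ _ x y

theorem norm_fockOp (U : OrthRep H) (t : ℝ) (x : Fock U.Space) : ‖U.fockOp t x‖ = ‖x‖ := by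
  rw [@norm_eq_sqrt_re_inner ℂ, @norm_eq_sqrt_re_inner ℂ, U.inner_fockOp]

theorem fockOp_tensorWord (U : OrthRep H) (t : ℝ) (w : List U.Space) :
    U.fockOp t (tensorWord w) = tensorWord (w.map (U.uop t)) :=
  secondQuant_tensorWord _ _ w

theorem fockOp_add (U : OrthRep H) (s t : ℝ) (x : Fock U.Space) :
    U.fockOp (s + t) x = U.fockOp s (U.fockOp t x) := by
  have : U.fockOp (s + t) = U.fockOp s ∘L U.fockOp t := by
    refine fock_clm_ext fun w => ?_
    rw [ContinuousLinearMap.comp_apply, fockOp_tensorWord, fockOp_tensorWord, fockOp_tensorWord,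
      List.map_map]
    congr 2
    funext x
    exact U.uop_add s t x
  rw [this]; rfl

theorem continuous_fockOp (U : OrthRep H) (x : Fock U.Space) :
    Continuous fun t => U.fockOp t x := by
  refine continuous_of_total U.norm_fockOp (dense_span_tensorWord U.Space) ?_ x
  rintro _ ⟨w, rfl⟩
  rw [continuous_iff_continuousAt]
  intro s
  rw [ContinuousAt, tendsto_iff_norm_sub_tendsto_zero]
  have h : ∀ t, ‖U.fockOp t (tensorWord w) - U.fockOp s (tensorWord w)‖ ^ 2
      = 2 * ‖(tensorWord w : Fock U.Space)‖ ^ 2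
        - 2 * (wordInner (w.map (U.uop s)) (w.map (U.uop t))).re := by
    intro t
    rw [@norm_sub_sq ℂ, U.norm_fockOp, U.norm_fockOp, inner_re_symm, fockOp_tensorWord,
      fockOp_tensorWord, inner_tensorWord]
    simp only [RCLike.re_to_complex]
    ring
  have hc : Continuous fun t => ‖U.fockOp t (tensorWord w) - U.fockOp s (tensorWord w)‖ ^ 2 := by
    simp only [h]
    exact continuous_const.sub (continuous_const.mul
      (Complex.continuous_re.comp (U.continuous_wordInner _ w)))
  have h2 := (hc.tendsto s).sqrt
  simpa using h2

/-- The second quantization of `U`, as a flow on the Fock space. -/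
def flow (U : OrthRep H) : UnitaryFlow (Fock U.Space) where
  op := U.fockOp
  inner_op := U.inner_fockOp
  op_add := U.fockOp_add
  continuous_op := U.continuous_fockOp

theorem flow_vacuum (U : OrthRep H) (t : ℝ) : U.flow.op t (vacuum U.Space) = vacuum U.Space :=
  U.fockOp_tensorWord t []

/-! ### Mixing of the second quantization -/

theorem tendsto_inner_uop (U : OrthRep H) (hU : U.IsMixing) (x y : U.Space) :
    Tendsto (fun t => ⟪x, U.uop t y⟫_ℂ) (cocompact ℝ) (𝓝 0) := by
  refine tendsto_inner_of_total U.norm_uop (S := Set.range U.toSpace) ?_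
    (U.dense_span_range_toSpace x) (U.dense_span_range_toSpace y)
  rintro _ ⟨x, rfl⟩ _ ⟨y, rfl⟩
  simp only [uop_toSpace, inner_toSpace, ← U.deformation_symm]
  exact U.tendsto_inner_cop hU _ y

theorem tendsto_wordInner (U : OrthRep H) (hU : U.IsMixing) {v : List U.Space} (hv : v ≠ [])
    (w : List U.Space) :
    Tendsto (fun t => wordInner v (w.map (U.uop t))) (cocompact ℝ) (𝓝 0) := by
  rcases v with _ | ⟨a, v⟩
  · exact absurd rfl hv
  rcases w with _ | ⟨b, w⟩
  · exact tendsto_const_nhds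
  refine (U.tendsto_inner_uop hU a b).zero_mul_isBoundedUnder_le ?_
  refine isBoundedUnder_of ⟨‖(tensorWord v : Fock U.Space)‖ * ‖(tensorWord w : Fock U.Space)‖,
    fun t => ?_⟩
  rw [Function.comp_apply]
  change ‖wordInner v (w.map (U.uop t))‖ ≤ _
  rw [← inner_tensorWord, ← fockOp_tensorWord, ← U.norm_fockOp t (tensorWord w)]
  exact norm_inner_le_norm _ _

/-- The orthogonal complement of the vacuum is spanned by the tensors of positive degree. -/
theorem mem_closure_span_words {E : Type*} [NormedAddCommGroup E] [InnerProductSpace ℂ E]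
    {x : Fock E} (hx : ⟪vacuum E, x⟫_ℂ = 0) :
    x ∈ (Submodule.span ℂ {y : Fock E | ∃ w ≠ [], y = tensorWord w}).topologicalClosure := by
  let P : Fock E →L[ℂ] Fock E := 1 - rankOne (vacuum E) (vacuum E)
  have hP : ∀ y, P y = y - ⟪vacuum E, y⟫_ℂ • vacuum E := fun y => rfl
  have hPx : P x = x := by rw [hP, hx, zero_smul, sub_zero]
  rw [← hPx]
  refine map_mem_closure P.continuous (dense_span_tensorWord E x) ?_
  intro y hy
  induction hy using Submodule.span_induction with
  | mem y hy =>
    obtain ⟨w, rfl⟩ := hy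
    rcases w with _ | ⟨a, w⟩
    · have : P (tensorWord []) = 0 := by
        change P (vacuum E) = 0
        rw [hP, inner_self_one norm_vacuum, one_smul, sub_self]
      rw [this]; exact Submodule.zero_mem _
    · refine Submodule.subset_span ⟨a :: w, by simp, ?_⟩
      rw [hP, vacuum, inner_tensorWord]
      simp [wordInner]
  | zero => simp
  | add a b _ _ ha hb => rw [map_add]; exact Submodule.add_mem _ ha hb
  | smul z a _ ha => rw [map_smul]; exact Submodule.smul_mem _ _ ha

/-- The second quantization of a mixing representation is mixing on the orthogonal complement of
the vacuum. -/
theorem flow_mixing (U : OrthRep H) (hU : U.IsMixing) (w w' : Fock U.Space)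
    (hw : ⟪vacuum U.Space, w⟫_ℂ = 0) (hw' : ⟪vacuum U.Space, w'⟫_ℂ = 0) :
    Tendsto (fun t => ⟪w, U.flow.op t w'⟫_ℂ) (cocompact ℝ) (𝓝 0) := by
  refine tendsto_inner_of_total U.norm_fockOp ?_ (mem_closure_span_words hw)
    (mem_closure_span_words hw')
  rintro _ ⟨v, hv, rfl⟩ _ ⟨w, -, rfl⟩
  simp only [fockOp_tensorWord, inner_tensorWord]
  exact U.tendsto_wordInner hU hv w

end OrthRep

namespace OrthRep

variable {H : Type*} [NormedAddCommGroup H] [InnerProductSpace ℝ H]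

/-! ### Reflection of the deformation and the real dual subspace -/

theorem cop_conj (U : OrthRep H) (t : ℝ) (x : Cplx H) : U.cop t (Cplx.conj x) = Cplx.conj (U.cop t x) := by
  apply Cplx.ext <;> simp [cop, Cplx.conj_apply]

theorem IsSpectralMeasure.conj {U : OrthRep H} {x : Cplx H} {μ : Measure ℝ}
    (h : U.IsSpectralMeasure x μ) : U.IsSpectralMeasure (Cplx.conj x) (μ.map fun s => -s) := by
  have := h.1
  refine ⟨inferInstance, fun t => ?_⟩
  rw [cop_conj, Cplx.inner_conj_conj, h.2, ← integral_conj,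
    integral_map (by fun_prop) (by fun_prop)]
  refine integral_congr_ae (Eventually.of_forall fun s => ?_)
  simp only [← Complex.exp_conj]
  congr 1
  simp

theorem IsSpectralMeasure.norm_sq {U : OrthRep H} {x : Cplx H} {μ : Measure ℝ}
    (h : U.IsSpectralMeasure x μ) : ‖x‖ ^ 2 = μ.real Set.univ := by
  have h0 := h.2 0
  have h1 : U.cop 0 x = x := by
    have h2 := U.cop_add 0 0 x
    rw [add_zero] at h2
    exact ((U.cop 0).injective h2).symm
  rw [h1, inner_self_eq_norm_sq_to_K] at h0
  simp only [Complex.ofReal_zero, zero_mul, Complex.exp_zero, integral_const] at h0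
  apply Complex.ofReal_injective
  simpa using h0

theorem integrable_density {μ : Measure ℝ} [IsFiniteMeasure μ] :
    Integrable (fun x : ℝ => 2 / (1 + Real.exp (-x))) μ := by
  refine Integrable.of_bound (C := 2) (Continuous.aestronglyMeasurable ?_)
    (Eventually.of_forall fun x => ?_)
  · exact continuous_const.div (by fun_prop) fun x => by positivity
  · rw [Real.norm_of_nonneg (by positivity), div_le_iff₀ (by positivity)]
    nlinarith [Real.exp_pos (-x)]

theorem IsDeformation.add_conj {U : OrthRep H} {B : Cplx H →L[ℂ] Cplx H} (hB : U.IsDeformation B)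
    (x : Cplx H) : ⟪Cplx.conj x, B (Cplx.conj x)⟫_ℂ + ⟪x, B x⟫_ℂ = 2 * ⟪x, x⟫_ℂ := by
  obtain ⟨μ, hμ, h1⟩ := hB x
  obtain ⟨ν, hν, h2⟩ := hB (Cplx.conj x)
  have : IsFiniteMeasure μ := hμ.1
  have hνμ : ν = μ.map fun s => -s := hν.eq hμ.conj fun t => rfl
  rw [h1, h2, hνμ, integral_map (by fun_prop) integrable_density.1, ← Complex.ofReal_add,
    ← integral_add ?_ integrable_density, inner_self_eq_norm_sq_to_K]
  · have : ∀ a : ℝ, 2 / (1 + Real.exp (- -a)) + 2 / (1 + Real.exp (-a)) = 2 := fun a => by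
      rw [neg_neg, Real.exp_neg]
      have := Real.exp_pos a
      field_simp
      ring
    simp only [this, integral_const, smul_eq_mul]
    have h3 : ((‖x‖ ^ 2 : ℝ) : ℂ) = (μ.real Set.univ : ℝ) := congrArg _ hμ.norm_sq
    simp only [Complex.ofReal_mul, ← h3]
    simp [mul_comm]
  · exact (integrable_map_measure (f := fun s : ℝ => -s) integrable_density.1 (by fun_prop)).1
      integrable_density

/-- The reflection formula `C B C = 2 - B` for `B = 2 / (1 + A⁻¹)` and the complex conjugation
`C`, which reflects `log A`. -/
theorem IsDeformation.conj_conj {U : OrthRep H} [CompleteSpace H] {B : Cplx H →L[ℂ] Cplx H}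
    (hB : U.IsDeformation B) (x : Cplx H) :
    Cplx.conj (B (Cplx.conj x)) = (2 : ℂ) • x - B x := by
  let S : Cplx H →L[ℂ] Cplx H := (Cplx.conj : Cplx H →L⋆[ℂ] Cplx H).comp
    ((B : Cplx H →L[ℂ] Cplx H).comp (Cplx.conj : Cplx H →L⋆[ℂ] Cplx H))
  have hS : S = (2 : ℂ) • ContinuousLinearMap.id ℂ (Cplx H) - B := by
    rw [← ContinuousLinearMap.coe_inj, ← ext_inner_map]
    intro y
    obtain ⟨ν, hν, h2⟩ := hB (Cplx.conj y)
    have h := hB.add_conj y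
    have e1 : ⟪y, S y⟫_ℂ = ⟪Cplx.conj y, B (Cplx.conj y)⟫_ℂ := by
      have h3 := Cplx.inner_conj_conj (Cplx.conj y) (B (Cplx.conj y))
      rw [h2, Complex.conj_ofReal, ← h2, Cplx.conj_conj] at h3
      exact h3
    have e2 : ⟪y, S y⟫_ℂ = ⟪y, ((2 : ℂ) • ContinuousLinearMap.id ℂ (Cplx H) - B) y⟫_ℂ := by
      rw [e1]
      change _ = ⟪y, (2 : ℂ) • y - B y⟫_ℂ
      rw [inner_sub_right, inner_smul_right, ← h]
      ring
    have e3 := congrArg (starRingEnd ℂ) e2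
    rwa [inner_conj_symm, inner_conj_symm] at e3
  exact congrArg (fun T : Cplx H →L[ℂ] Cplx H => T x) hS

theorem IsDeformation.injective {U : OrthRep H} {B : Cplx H →L[ℂ] Cplx H}
    (hB : U.IsDeformation B) {x : Cplx H} (hx : B x = 0) : x = 0 := by
  obtain ⟨μ, hμ, h1⟩ := hB x
  have : IsFiniteMeasure μ := hμ.1
  rw [hx, inner_zero_right] at h1
  have h2 : ∫ s : ℝ, 2 / (1 + Real.exp (-s)) ∂μ = 0 := by exact_mod_cast h1.symm
  rw [integral_eq_zero_iff_of_nonneg (fun s => by positivity) integrable_density] at h2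
  have h3 : μ = 0 := by
    rw [← ae_eq_bot, ← Filter.eventually_false_iff_eq_bot]
    filter_upwards [h2] with s hs
    have : 0 < 2 / (1 + Real.exp (-s)) := by positivity
    exact this.ne' hs
  have h4 := hμ.norm_sq
  rw [h3] at h4
  simpa using h4

theorem deformation_cases (U : OrthRep H) : U.IsDeformation U.deformation ∨ U.deformation = 0 := by
  unfold deformation
  split_ifs with h
  · exact Or.inl h.choose_spec
  · exact Or.inr rfl

/-- The operators on the Fock space that commute with the left fields `s(ξ)`, `ξ ∈ H_ℝ`. -/
def fieldCommutant (U : OrthRep H) : Submodule ℂ (Fock U.Space →L[ℂ] Fock U.Space) where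
  carrier := {y | ∀ a : H, semicircular (U.incl a) ∘L y = y ∘L semicircular (U.incl a)}
  add_mem' h h' a := by
    rw [ContinuousLinearMap.comp_add, ContinuousLinearMap.add_comp, h a, h' a]
  zero_mem' a := by simp
  smul_mem' c y h a := by
    rw [ContinuousLinearMap.comp_smul, ContinuousLinearMap.smul_comp, h a]

theorem adjoint_mem_fieldCommutant {U : OrthRep H} {y : Fock U.Space →L[ℂ] Fock U.Space}
    (hy : y ∈ U.fieldCommutant) : ContinuousLinearMap.adjoint y ∈ U.fieldCommutant := by
  intro a
  have := congrArg ContinuousLinearMap.adjoint (hy a)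
  rw [ContinuousLinearMap.adjoint_comp, ContinuousLinearMap.adjoint_comp,
    adjoint_semicircular] at this
  exact this.symm

theorem arakiWoods_commute {U : OrthRep H} {x y : Fock U.Space →L[ℂ] Fock U.Space}
    (hx : x ∈ U.arakiWoods) (hy : y ∈ U.fieldCommutant) (z : Fock U.Space) :
    y (x z) = x (y z) := by
  have h := mem_vnGenerated_iff.1 hx y (by
    rintro _ ⟨a, rfl⟩
    rw [ContinuousLinearMap.star_eq_adjoint, adjoint_semicircular]
    exact ⟨hy a, hy a⟩)
  exact congrArg (fun T => T z) h

variable [CompleteSpace H]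

/-- The image of a real vector under `2 - B` has real inner products with all real vectors. -/
theorem inner_incl_real (U : OrthRep H) (a b : H) :
    ⟪U.toSpace ((2 : ℂ) • Cplx.mk b 0 - U.deformation (Cplx.mk b 0)), U.incl a⟫_ℂ
      = ⟪U.incl a, U.toSpace ((2 : ℂ) • Cplx.mk b 0 - U.deformation (Cplx.mk b 0))⟫_ℂ := by
  rw [incl_eq, ← inner_conj_symm, inner_toSpace]
  rcases U.deformation_cases with h | h
  · have h1 : ∀ x, U.deformation (Cplx.conj x) = Cplx.conj ((2 : ℂ) • x - U.deformation x) :=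
      fun x => by rw [← h.conj_conj, Cplx.conj_conj]
    have h2 : ∀ x, Cplx.conj (U.deformation x)
        = (2 : ℂ) • Cplx.conj x - U.deformation (Cplx.conj x) := fun x => by
      rw [← h.conj_conj, Cplx.conj_conj]
    rw [← Cplx.inner_conj_conj, Cplx.conj_mk_zero, h2, map_sub, h2, Cplx.conj_mk_zero,
      map_smulₛₗ, Cplx.conj_mk_zero]
    simp only [map_sub, map_smul, map_ofNat]
    congr 1
    module
  · simp [h]

/-- The operator `2 - B` has dense range. -/
theorem denseRange_two_sub (U : OrthRep H) :
    DenseRange ((2 : ℂ) • ContinuousLinearMap.id ℂ (Cplx H) - U.deformation) := by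
  set D := (2 : ℂ) • ContinuousLinearMap.id ℂ (Cplx H) - U.deformation with hD
  have hDx : ∀ x, D x = (2 : ℂ) • x - U.deformation x := fun x => rfl
  have hinj : ∀ x, D x = 0 → x = 0 := by
    intro x hx
    rw [hDx] at hx
    rcases U.deformation_cases with h | h
    · rw [← h.conj_conj] at hx
      have h1 := congrArg Cplx.conj hx
      rw [Cplx.conj_conj, map_zero] at h1
      have h2 := congrArg Cplx.conj (h.injective h1)
      rwa [Cplx.conj_conj, map_zero] at h2
    · simpa [h] using hx
  have hsymm : ∀ x y, ⟪D x, y⟫_ℂ = ⟪x, D y⟫_ℂ := by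
    intro x y
    rw [hDx, hDx, inner_sub_left, inner_sub_right, inner_smul_left, inner_smul_right,
      U.deformation_symm, map_ofNat]
  have : Dense ((LinearMap.range (D : Cplx H →ₗ[ℂ] Cplx H)) : Set (Cplx H)) := by
    rw [Submodule.dense_iff_topologicalClosure_eq_top, Submodule.topologicalClosure_eq_top_iff,
      Submodule.eq_bot_iff]
    intro y hy
    rw [Submodule.mem_orthogonal] at hy
    refine hinj y ?_
    rw [← inner_self_eq_zero (𝕜 := ℂ), ← hsymm]
    exact hy _ ⟨_, rfl⟩
  exact this

/-- The vectors of the one-particle space whose inner products with `H_ℝ` are real. -/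
def realDual (U : OrthRep H) : Set U.Space := {η | ∀ a : H, ⟪η, U.incl a⟫_ℂ = ⟪U.incl a, η⟫_ℂ}

theorem dense_span_realDual (U : OrthRep H) :
    Dense (Submodule.span ℂ U.realDual : Set U.Space) := by
  have h := U.denseRange_toSpace.comp U.denseRange_two_sub U.toSpace.continuous
  refine Dense.mono ?_ h
  rintro _ ⟨x, rfl⟩
  have h1 : x = Cplx.mk x.re 0 + Complex.I • Cplx.mk x.im 0 := Cplx.eq_mk_add x
  rw [h1, Function.comp_apply, map_add, map_smul, map_add, map_smul]
  exact Submodule.add_mem _ (Submodule.subset_span fun a => U.inner_incl_real a _)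
    (Submodule.smul_mem _ _ (Submodule.subset_span fun a => U.inner_incl_real a _))

/-- The vacuum is cyclic for the commutant of the free Araki-Woods algebra. -/
theorem closure_fieldCommutant_vacuum (U : OrthRep H) (x : Fock U.Space) :
    x ∈ closure {z | ∃ y ∈ U.fieldCommutant, z = y (vacuum U.Space)} := by
  let ev : (Fock U.Space →L[ℂ] Fock U.Space) →ₗ[ℂ] Fock U.Space :=
    (ContinuousLinearMap.apply ℂ (Fock U.Space) (vacuum U.Space)).toLinearMap
  let N := (U.fieldCommutant.map ev).topologicalClosure
  have hN : N = ⊤ := by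
    refine eq_top_of_rightField_invariant N (Submodule.isClosed_topologicalClosure _) ?_
      U.dense_span_realDual fun η hη z hz => ?_
    · refine Submodule.le_topologicalClosure _ ⟨1, fun a => ?_, rfl⟩
      ext z; rfl
    · refine map_mem_closure (rightField η).continuous hz ?_
      rintro _ ⟨y, hy, rfl⟩
      refine ⟨rightField η ∘L y, fun a => ?_, rfl⟩
      rw [← ContinuousLinearMap.comp_assoc, semicircular_rightField _ _ (hη a),
        ContinuousLinearMap.comp_assoc, hy a, ContinuousLinearMap.comp_assoc]
  have hx : x ∈ N := hN ▸ Submodule.mem_top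
  refine closure_mono ?_ hx
  rintro _ ⟨y, hy, rfl⟩
  exact ⟨y, hy, rfl⟩

theorem fockOp_creation (U : OrthRep H) (t : ℝ) (ξ : U.Space) (z : Fock U.Space) :
    U.fockOp t (creation ξ z) = creation (U.uop t ξ) (U.fockOp t z) := by
  have : U.fockOp t ∘L creation ξ = creation (U.uop t ξ) ∘L U.fockOp t := fock_clm_ext fun w => by
    rw [ContinuousLinearMap.comp_apply, ContinuousLinearMap.comp_apply, creation_tensorWord,
      fockOp_tensorWord, fockOp_tensorWord, creation_tensorWord, List.map_cons]
  exact congrArg (fun T => T z) this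

theorem fockOp_op_neg (U : OrthRep H) (t : ℝ) (z : Fock U.Space) :
    U.fockOp t (U.fockOp (-t) z) = z := U.flow.op_op_neg t z

theorem fockOp_neg_op (U : OrthRep H) (t : ℝ) (z : Fock U.Space) :
    U.fockOp (-t) (U.fockOp t z) = z := U.flow.op_neg_op t z

theorem fockOp_adjoint_creation (U : OrthRep H) (t : ℝ) (ξ : U.Space) (z : Fock U.Space) :
    U.fockOp t (ContinuousLinearMap.adjoint (creation ξ) z)
      = ContinuousLinearMap.adjoint (creation (U.uop t ξ)) (U.fockOp t z) := by
  refine ext_inner_left ℂ fun v => ?_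
  rw [ContinuousLinearMap.adjoint_inner_right, ← U.inner_fockOp (-t), U.fockOp_neg_op,
    ContinuousLinearMap.adjoint_inner_right, ← U.inner_fockOp t, fockOp_creation, fockOp_op_neg]

theorem uop_incl (U : OrthRep H) (t : ℝ) (a : H) : U.uop t (U.incl a) = U.incl (U.op t a) := by
  rw [incl_eq, uop_toSpace, incl_eq]
  congr 1
  apply Cplx.ext <;> simp [cop]

theorem fockOp_semicircular (U : OrthRep H) (t : ℝ) (a : H) (z : Fock U.Space) :
    U.fockOp t (semicircular (U.incl a) z) = semicircular (U.incl (U.op t a)) (U.fockOp t z) := by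
  have h : ∀ (ξ : U.Space) (z : Fock U.Space), semicircular ξ z
      = (1 / 2 : ℂ) • (creation ξ z + ContinuousLinearMap.adjoint (creation ξ) z) :=
    fun _ _ => rfl
  rw [h, h, map_smul, map_add, fockOp_creation, fockOp_adjoint_creation, uop_incl]

theorem conj_mem_fieldCommutant {U : OrthRep H} {y : Fock U.Space →L[ℂ] Fock U.Space}
    (hy : y ∈ U.fieldCommutant) (t : ℝ) :
    U.fockOp (-t) ∘L y ∘L U.fockOp t ∈ U.fieldCommutant := by
  intro a
  refine ContinuousLinearMap.ext fun z => ?_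
  have h1 := congrArg (fun T => T (U.fockOp t z)) (hy (U.op t a))
  simp only [ContinuousLinearMap.comp_apply] at h1 ⊢
  rw [fockOp_semicircular, ← h1]
  have h2 := U.fockOp_semicircular t a (U.fockOp (-t) (y (U.fockOp t z)))
  rw [fockOp_op_neg] at h2
  rw [← h2, fockOp_neg_op]

/-! ### Commutation relations in the continuous core -/

theorem groupAlgebra_le_core {U : OrthRep H} {x : U.CoreSpace →L[ℂ] U.CoreSpace}
    (hx : x ∈ U.groupAlgebra) : x ∈ U.continuousCore :=
  vnGenerated_mono Set.subset_union_right hx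

/-- A `*`-closed family of operators that commutes with the generators of the core commutes with
the core. -/
theorem core_commute {U : OrthRep H} {x : U.CoreSpace →L[ℂ] U.CoreSpace}
    (hx : x ∈ U.continuousCore) {Z : Set (U.CoreSpace →L[ℂ] U.CoreSpace)}
    (hZ : ∀ z ∈ Z, ContinuousLinearMap.adjoint z ∈ Z)
    (h1 : ∀ z ∈ Z, ∀ y ∈ U.arakiWoods, ∀ T, U.IsPi y T → T ∘L z = z ∘L T)
    (h2 : ∀ z ∈ Z, ∀ s ξ, z (shift _ s ξ) = shift _ s (z ξ)) {z : U.CoreSpace →L[ℂ] U.CoreSpace}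
    (hz : z ∈ Z) (ξ : U.CoreSpace) : x (z ξ) = z (x ξ) := by
  have key : ∀ z ∈ Z, ∀ g ∈ ({T | ∃ x ∈ U.arakiWoods, U.IsPi x T} ∪ {T | ∃ s : ℝ, T = U.lam s} :
      Set (U.CoreSpace →L[ℂ] U.CoreSpace)), g * z = z * g := by
    rintro z hz g (⟨y, hy, hg⟩ | ⟨s, rfl⟩)
    · exact h1 z hz y hy g hg
    · exact ContinuousLinearMap.ext fun ξ => (h2 z hz s ξ).symm
  have h := mem_vnGenerated_iff.1 hx z fun g hg => ⟨key z hz g hg, by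
    have h3 := congrArg star (key _ (hZ z hz) g hg)
    rw [← ContinuousLinearMap.star_eq_adjoint, star_mul, star_mul, star_star] at h3
    exact h3.symm⟩
  exact (congrArg (fun T => T ξ) h).symm

theorem core_commute_amplify {U : OrthRep H} {x : U.CoreSpace →L[ℂ] U.CoreSpace}
    (hx : x ∈ U.continuousCore) {y : Fock U.Space →L[ℂ] Fock U.Space} (hy : y ∈ U.fieldCommutant)
    (ξ : U.CoreSpace) : x (amplify y ξ) = amplify y (x ξ) := by
  refine core_commute hx (Z := {z | ∃ y ∈ U.fieldCommutant, z = amplify y}) ?_ ?_ ?_ ⟨y, hy, rfl⟩ ξ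
  · rintro _ ⟨y, hy, rfl⟩
    exact ⟨_, adjoint_mem_fieldCommutant hy, adjoint_amplify y⟩
  · rintro _ ⟨y, hy, rfl⟩ a ha T hT
    refine ContinuousLinearMap.ext fun ξ => Lp.ext ?_
    filter_upwards [hT (amplify y ξ), amplify_ae y ξ, amplify_ae y (T ξ), hT ξ] with t e1 e2 e3 e4
    rw [ContinuousLinearMap.comp_apply, ContinuousLinearMap.comp_apply, e1, e2, e3, e4]
    simp only [modular, ContinuousLinearMap.comp_apply, neg_neg]
    have h := arakiWoods_commute ha (conj_mem_fieldCommutant hy t) (U.fockOp (-t) (ξ t))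
    simp only [ContinuousLinearMap.comp_apply, fockOp_op_neg] at h
    rw [← h, fockOp_op_neg]
  · rintro _ ⟨y, hy, rfl⟩ s ξ
    exact amplify_shift y s ξ

theorem core_commute_rho_shift {U : OrthRep H} {x : U.CoreSpace →L[ℂ] U.CoreSpace}
    (hx : x ∈ U.continuousCore) (s : ℝ) (ξ : U.CoreSpace) :
    x (U.flow.rho (shift _ s) ξ) = U.flow.rho (shift _ s) (x ξ) := by
  refine core_commute hx (Z := {z | ∃ s, z = U.flow.rho (shift _ s)}) ?_ ?_ ?_ ⟨s, rfl⟩ ξ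
  · rintro _ ⟨s, rfl⟩
    refine ⟨-s, ?_⟩
    symm
    rw [ContinuousLinearMap.eq_adjoint_iff]
    intro ξ η
    rw [U.flow.inner_rho_left, star_shift, neg_neg]
  · rintro _ ⟨s, rfl⟩ a ha T hT
    refine ContinuousLinearMap.ext fun ξ => Lp.ext ?_
    rw [ContinuousLinearMap.comp_apply, ContinuousLinearMap.comp_apply, U.flow.rho_shift,
      U.flow.rho_shift]
    filter_upwards [hT (amplify (U.flow.op s) (shift _ s ξ)), amplify_ae (U.flow.op s) (shift _ s ξ),
      shift_ae s ξ, amplify_ae (U.flow.op s) (shift _ s (T ξ)), shift_ae s (T ξ), ae_shift (hT ξ) s]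
      with t e1 e2 e3 e4 e5 e6
    rw [e1, e2, e3, e4, e5, e6]
    simp only [modular, ContinuousLinearMap.comp_apply, neg_neg]
    change U.fockOp t (a (U.fockOp (-t) (U.fockOp s (ξ (t - s)))))
      = U.fockOp s (U.fockOp (t - s) (a (U.fockOp (-(t - s)) (ξ (t - s)))))
    rw [← fockOp_add, ← fockOp_add]
    congr 3
    · ring
    · congr 1; ring
  · rintro _ ⟨s, rfl⟩ t ξ
    rw [U.flow.rho_shift, U.flow.rho_shift, ← shift_add, ← amplify_shift, ← shift_add, add_comm]

/-- The core commutes with the right multiplications by elements of `L(ℝ)`. -/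
theorem core_commute_rho {U : OrthRep H} {x b : U.CoreSpace →L[ℂ] U.CoreSpace}
    (hx : x ∈ U.continuousCore) (hb : b ∈ U.groupAlgebra) (ξ : U.CoreSpace) :
    x (U.flow.rho b ξ) = U.flow.rho b (x ξ) :=
  U.flow.commute_rho (core_commute_rho_shift hx) hb ξ

/-- The vectors `g ⊗ Ω` separate the core. -/
theorem core_eq_zero {U : OrthRep H} {x : U.CoreSpace →L[ℂ] U.CoreSpace}
    (hx : x ∈ U.continuousCore) (h : ∀ g, x (tens (vacuum U.Space) g) = 0) : x = 0 := by
  refine clm_ext_tens fun g w => ?_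
  have h1 := map_mem_closure (x ∘L tensRight g).continuous (U.closure_fieldCommutant_vacuum w)
    (t := {0}) ?_
  · rw [closure_singleton] at h1
    exact h1
  · rintro _ ⟨y, hy, rfl⟩
    change x (tens (y (vacuum U.Space)) g) = 0
    rw [← amplify_tens, core_commute_amplify hx hy, h, map_zero]

theorem core_tens_shift {U : OrthRep H} {x : U.CoreSpace →L[ℂ] U.CoreSpace}
    (hx : x ∈ U.continuousCore) (s : ℝ) (g : L2R) :
    x (tens (vacuum U.Space) (shift ℂ s g))
      = U.flow.rho (shift _ s) (x (tens (vacuum U.Space) g)) := by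
  rw [tens_shift, ← U.flow.rho_tens norm_vacuum U.flow_vacuum (shift_mem_transAlg s),
    core_commute_rho_shift hx]

/-- The conditional expectation of the core onto `L(ℝ)`. -/
theorem exists_expectation {U : OrthRep H} {x : U.CoreSpace →L[ℂ] U.CoreSpace}
    (hx : x ∈ U.continuousCore) : ∃ e ∈ U.groupAlgebra, ∀ g, e (tens (vacuum U.Space) g)
      = tens (vacuum U.Space) (slice (vacuum U.Space) (x (tens (vacuum U.Space) g))) := by
  obtain ⟨e, he, h⟩ := exists_transAlg_of_shift (E := Fock U.Space)
    (T := compress (vacuum U.Space) x) (fun s g => by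
      rw [compress_apply, core_tens_shift hx, UnitaryFlow.rho_apply, U.flow.slice_fwd U.flow_vacuum,
        slice_shift, U.flow.slice_bwd U.flow_vacuum, compress_apply])
  exact ⟨e, he, fun g => h _ g⟩

end OrthRep

/-! ### Diffuse von Neumann algebras contain symmetries that are weakly close to zero -/

section Diffuse

variable {K : Type*} [NormedAddCommGroup K] [InnerProductSpace ℂ K] [CompleteSpace K]

/-- The orthogonal projection onto the orthogonal complement of `L`. -/
def coproj (L : Submodule ℂ K) : K →L[ℂ] K := 1 - L.topologicalClosure.starProjection

theorem coproj_apply (L : Submodule ℂ K) (x : K) :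
    coproj L x = x - L.topologicalClosure.starProjection x := rfl

theorem isStarProjection_coproj (L : Submodule ℂ K) : IsStarProjection (coproj L) :=
  isStarProjection_starProjection.one_sub

theorem inner_proj {p : K →L[ℂ] K} (hp : IsStarProjection p) (x y : K) : ⟪p x, y⟫_ℂ = ⟪x, p y⟫_ℂ := by
  rw [← ContinuousLinearMap.adjoint_inner_left, ← ContinuousLinearMap.star_eq_adjoint,
    hp.isSelfAdjoint.star_eq]

theorem proj_proj {p : K →L[ℂ] K} (hp : IsStarProjection p) (x : K) : p (p x) = p x :=
  congrArg (fun T : K →L[ℂ] K => T x) hp.isIdempotentElem.eq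

theorem norm_proj_sq {p : K →L[ℂ] K} (hp : IsStarProjection p) (x : K) :
    ((‖p x‖ ^ 2 : ℝ) : ℂ) = ⟪x, p x⟫_ℂ := by
  rw [← proj_proj hp x, ← inner_proj hp, proj_proj hp, inner_self_eq_norm_sq_to_K]
  simp

theorem coproj_ker {p : K →L[ℂ] K} (hp : IsStarProjection p) :
    coproj (LinearMap.ker (p : K →ₗ[ℂ] K)) = p := by
  ext x
  have hcl : (LinearMap.ker (p : K →ₗ[ℂ] K)).topologicalClosure = LinearMap.ker (p : K →ₗ[ℂ] K) :=
    IsClosed.submodule_topologicalClosure_eq (ContinuousLinearMap.isClosed_ker p)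
  have h : (LinearMap.ker (p : K →ₗ[ℂ] K)).topologicalClosure.starProjection x = x - p x := by
    refine Submodule.eq_starProjection_of_mem_of_inner_eq_zero ?_ fun w hw => ?_
    · rw [hcl]
      change p (x - p x) = 0
      rw [map_sub, proj_proj hp, sub_self]
    · rw [hcl] at hw
      have hw' : p w = 0 := hw
      rw [sub_sub_cancel, inner_proj hp, hw', inner_zero_right]
  rw [coproj_apply, h, sub_sub_cancel]

/-- The mass `∑ ‖p f‖²` of an operator on a finite set of vectors. -/
def mass (F : Finset K) (p : K →L[ℂ] K) : ℝ := ∑ f ∈ F, ‖p f‖ ^ 2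

/-- The sum of the squares of the matrix coefficients of `u` on a finite set of vectors. -/
def coeffSum (F : Finset K) (u : K →L[ℂ] K) : ℝ := ∑ f ∈ F, ∑ g ∈ F, ‖⟪f, u g⟫_ℂ‖ ^ 2

/-- There is a symmetry of `p` in `𝒜` with small matrix coefficients. -/
def HasSmallSymmetry (𝒜 : Set (K →L[ℂ] K)) (F : Finset K) (ε : ℝ) (p : K →L[ℂ] K) : Prop :=
  ∃ u ∈ 𝒜, IsSelfAdjoint u ∧ u * u = p ∧ u * p = u ∧ coeffSum F u ≤ ε * mass F p

theorem hasSmallSymmetry_of_mass {𝒜 : Set (K →L[ℂ] K)} {F : Finset K} {ε : ℝ} {p : K →L[ℂ] K}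
    (hp : IsStarProjection p) (hpA : p ∈ 𝒜) (h : mass F p ≤ ε) : HasSmallSymmetry 𝒜 F ε p := by
  refine ⟨p, hpA, hp.isSelfAdjoint, hp.isIdempotentElem.eq, hp.isIdempotentElem.eq, ?_⟩
  have h0 : 0 ≤ mass F p := Finset.sum_nonneg fun f _ => by positivity
  calc coeffSum F p ≤ ∑ f ∈ F, ∑ g ∈ F, ‖p f‖ ^ 2 * ‖p g‖ ^ 2 := by
        refine Finset.sum_le_sum fun f _ => Finset.sum_le_sum fun g _ => ?_
        rw [← mul_pow, ← proj_proj hp g, ← inner_proj hp, proj_proj hp]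
        exact pow_le_pow_left₀ (norm_nonneg _) (norm_inner_le_norm _ _) 2
    _ = mass F p * mass F p := by rw [mass, Finset.sum_mul_sum]
    _ ≤ _ := mul_le_mul_of_nonneg_right h h0

theorem mass_add {F : Finset K} {r s : K →L[ℂ] K} (hr : IsStarProjection r) (hrs : r * s = 0) :
    mass F (r + s) = mass F r + mass F s := by
  rw [mass, mass, mass, ← Finset.sum_add_distrib]
  refine Finset.sum_congr rfl fun f _ => ?_
  have h : ⟪r f, s f⟫_ℂ = 0 := by
    have : r (s f) = 0 := congrArg (fun T : K →L[ℂ] K => T f) hrs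
    rw [inner_proj hr, this, inner_zero_right]
  have := norm_add_sq (𝕜 := ℂ) (r f) (s f)
  rw [h] at this
  simpa using this

/-- Symmetries of orthogonal projections may be added with a choice of sign, by the parallelogram
law for their matrix coefficients. -/
theorem HasSmallSymmetry.add {𝒜 : Set (K →L[ℂ] K)} (hadd : ∀ x ∈ 𝒜, ∀ y ∈ 𝒜, x + y ∈ 𝒜)
    (hsub : ∀ x ∈ 𝒜, ∀ y ∈ 𝒜, x - y ∈ 𝒜) {F : Finset K} {ε : ℝ} {r s : K →L[ℂ] K}
    (hr : IsStarProjection r) (hs : IsStarProjection s) (hrs : r * s = 0)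
    (h1 : HasSmallSymmetry 𝒜 F ε r) (h2 : HasSmallSymmetry 𝒜 F ε s) :
    HasSmallSymmetry 𝒜 F ε (r + s) := by
  obtain ⟨u, huA, hu, huu, hur, hu1⟩ := h1
  obtain ⟨v, hvA, hv, hvv, hvs, hv1⟩ := h2
  have hsr : s * r = 0 := by
    have := congrArg star hrs
    rwa [star_mul, hr.isSelfAdjoint.star_eq, hs.isSelfAdjoint.star_eq, star_zero] at this
  have hsv : s * v = v := by
    have := congrArg star hvs
    rwa [star_mul, hv.star_eq, hs.isSelfAdjoint.star_eq] at this
  have hru : r * u = u := by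
    have := congrArg star hur
    rwa [star_mul, hu.star_eq, hr.isSelfAdjoint.star_eq] at this
  have huv : u * v = 0 := by
    rw [← hur, ← hsv, mul_assoc, ← mul_assoc r, hrs, zero_mul, mul_zero]
  have hvu : v * u = 0 := by
    rw [← hvs, ← hru, mul_assoc, ← mul_assoc s, hsr, zero_mul, mul_zero]
  have hus : u * s = 0 := by rw [← hur, mul_assoc, hrs, mul_zero]
  have hvr : v * r = 0 := by rw [← hvs, mul_assoc, hsr, mul_zero]
  have hpar : coeffSum F (u + v) + coeffSum F (u - v) = 2 * (coeffSum F u + coeffSum F v) := by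
    simp only [coeffSum, ← Finset.sum_add_distrib, Finset.mul_sum]
    refine Finset.sum_congr rfl fun f _ => Finset.sum_congr rfl fun g _ => ?_
    rw [add_apply, sub_apply, inner_add_right, inner_sub_right]
    have := parallelogram_law_with_norm ℝ ⟪f, u g⟫_ℂ ⟪f, v g⟫_ℂ
    linarith
  have hm := mass_add (F := F) hr hrs
  rcases le_total (coeffSum F (u + v)) (coeffSum F (u - v)) with h | h
  · refine ⟨u + v, hadd u huA v hvA, hu.add hv, ?_, ?_, ?_⟩
    · rw [add_mul, mul_add, mul_add, huu, hvv, huv, hvu]; abel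
    · rw [add_mul, mul_add, mul_add, hur, hvs, hus, hvr]; abel
    · rw [hm, mul_add]; linarith
  · refine ⟨u - v, hsub u huA v hvA, hu.sub hv, ?_, ?_, ?_⟩
    · rw [sub_mul, mul_sub, mul_sub, huu, hvv, huv, hvu]; abel
    · rw [sub_mul, mul_add, mul_add, hur, hvs, hus, hvr]; abel
    · rw [hm, mul_add]; linarith

/-- A diffuse von Neumann algebra contains symmetries whose matrix coefficients on a given finite
set of vectors are small. Otherwise, by Zorn's lemma, some projection without such symmetries would
be minimal with this property; but it is the sum of two smaller projections. -/
theorem exists_small_symmetry {𝒜 : Set (K →L[ℂ] K)} {q : K →L[ℂ] K} (hq : IsStarProjection q)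
    (hqA : q ∈ 𝒜)
    (hA : ∀ x, x ∈ 𝒜 ↔ q * x * q = x ∧ x ∈ Set.centralizer (Set.centralizer 𝒜))
    (hdiff : ∀ p ∈ 𝒜, IsStarProjection p → p ≠ 0 →
      ∃ r ∈ 𝒜, IsStarProjection r ∧ p * r = r ∧ r ≠ 0 ∧ r ≠ p) (F : Finset K) {ε : ℝ} (hε : 0 < ε) :
    HasSmallSymmetry 𝒜 F ε q := by
  have hadd : ∀ x ∈ 𝒜, ∀ y ∈ 𝒜, x + y ∈ 𝒜 := fun x hx y hy => by
    rw [hA] at hx hy ⊢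
    refine ⟨by rw [mul_add, add_mul, hx.1, hy.1], fun z hz => ?_⟩
    rw [mul_add, add_mul, hx.2 z hz, hy.2 z hz]
  have hsub : ∀ x ∈ 𝒜, ∀ y ∈ 𝒜, x - y ∈ 𝒜 := fun x hx y hy => by
    rw [hA] at hx hy ⊢
    refine ⟨by rw [mul_sub, sub_mul, hx.1, hy.1], fun z hz => ?_⟩
    rw [mul_sub, sub_mul, hx.2 z hz, hy.2 z hz]
  by_contra hbad
  let S : Set (Submodule ℂ K) := {L | coproj L ∈ 𝒜 ∧ ¬ HasSmallSymmetry 𝒜 F ε (coproj L)}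
  have hstart : LinearMap.ker (q : K →ₗ[ℂ] K) ∈ S := by
    change coproj _ ∈ 𝒜 ∧ ¬ HasSmallSymmetry 𝒜 F ε (coproj _)
    rw [coproj_ker hq]
    exact ⟨hqA, hbad⟩
  have hchain : ∀ c ⊆ S, IsChain (· ≤ ·) c → ∀ y ∈ c, ∃ ub ∈ S, ∀ z ∈ c, z ≤ ub := by
    intro c hcS hc y hy
    have : Nonempty c := ⟨⟨y, hy⟩⟩
    have : IsDirectedOrder c := ⟨fun a b => by
      rcases hc.total a.2 b.2 with h | h
      · exact ⟨b, h, le_rfl⟩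
      · exact ⟨a, le_rfl, h⟩⟩
    let Lsup : Submodule ℂ K := ⨆ L : c, (L : Submodule ℂ K).topologicalClosure
    have hlim : ∀ x, Tendsto (fun L : c => coproj (L : Submodule ℂ K) x) atTop
        (𝓝 (coproj Lsup x)) := fun x =>
      tendsto_const_nhds.sub (Submodule.starProjection_tendsto_closure_iSup
        (fun L : c => (L : Submodule ℂ K).topologicalClosure)
        (fun a b h => Submodule.topologicalClosure_mono h) x)
    have hle : ∀ L : c, (L : Submodule ℂ K) ≤ Lsup := fun L =>
      (Submodule.le_topologicalClosure _).trans
        (le_iSup (fun L : c => (L : Submodule ℂ K).topologicalClosure) L)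
    refine ⟨Lsup, ⟨?_, fun hgood => ?_⟩, fun z hz => hle ⟨z, hz⟩⟩
    · rw [hA]
      constructor
      · ext x
        have h1 : Tendsto (fun L : c => q (coproj (L : Submodule ℂ K) (q x))) atTop
            (𝓝 (q (coproj Lsup (q x)))) := (q.continuous.tendsto _).comp (hlim (q x))
        refine tendsto_nhds_unique h1 ((hlim x).congr fun L => ?_)
        exact (congrArg (fun T : K →L[ℂ] K => T x) ((hA _).1 (hcS L.2).1).1).symm
      · intro z hz
        ext x
        have h1 : Tendsto (fun L : c => z (coproj (L : Submodule ℂ K) x)) atTop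
            (𝓝 (z (coproj Lsup x))) := (z.continuous.tendsto _).comp (hlim x)
        refine tendsto_nhds_unique h1 ((hlim (z x)).congr fun L => ?_)
        exact (congrArg (fun T : K →L[ℂ] K => T x) (((hA _).1 (hcS L.2).1).2 z hz)).symm
    · have hmass : Tendsto (fun L : c => mass F (coproj (L : Submodule ℂ K) - coproj Lsup)) atTop
          (𝓝 0) := by
        have h1 : Tendsto (fun L : c => ∑ f ∈ F, ‖coproj (L : Submodule ℂ K) f - coproj Lsup f‖ ^ 2)
            atTop (𝓝 (∑ f ∈ F, ‖coproj Lsup f - coproj Lsup f‖ ^ 2)) :=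
          tendsto_finsetSum _ fun f _ => (((hlim f).sub_const _).norm).pow 2
        have h2 : ∑ f ∈ F, ‖coproj Lsup f - coproj Lsup f‖ ^ 2 = 0 := by simp
        rw [h2] at h1
        exact h1
      obtain ⟨L, hL⟩ := (hmass.eventually (gt_mem_nhds hε)).exists
      have hLs := isStarProjection_coproj (L : Submodule ℂ K)
      have hls := isStarProjection_coproj Lsup
      have hmul : coproj (L : Submodule ℂ K) * coproj Lsup = coproj Lsup := by
        ext x
        change coproj (L : Submodule ℂ K) (coproj Lsup x) = coproj Lsup x
        rw [coproj_apply (L : Submodule ℂ K), sub_eq_self]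
        rw [Submodule.starProjection_apply_eq_zero_iff]
        have h1 : coproj Lsup x ∈ Lsup.topologicalClosureᗮ :=
          Submodule.sub_starProjection_mem_orthogonal x
        exact Submodule.orthogonal_le (Submodule.topologicalClosure_mono (hle L)) h1
      have hmul' : coproj Lsup * coproj (L : Submodule ℂ K) = coproj Lsup := by
        have := congrArg star hmul
        rwa [star_mul, hLs.isSelfAdjoint.star_eq, hls.isSelfAdjoint.star_eq] at this
      have hdp : IsStarProjection (coproj (L : Submodule ℂ K) - coproj Lsup) := by
        refine ⟨?_, hLs.isSelfAdjoint.sub hls.isSelfAdjoint⟩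
        change _ * _ = _
        rw [sub_mul, mul_sub, mul_sub, hmul, hmul', hLs.isIdempotentElem.eq,
          hls.isIdempotentElem.eq, sub_self, sub_zero]
      have hor : coproj Lsup * (coproj (L : Submodule ℂ K) - coproj Lsup) = 0 := by
        rw [mul_sub, hmul', hls.isIdempotentElem.eq, sub_self]
      have hLsA : coproj (L : Submodule ℂ K) ∈ 𝒜 := (hcS L.2).1
      have hsupA : coproj Lsup ∈ 𝒜 := by
        obtain ⟨u, huA, hu, huu, -, -⟩ := hgood
        rw [← huu, hA]
        rw [hA] at huA
        constructor
        · have h1 : q * u = u := by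
            rw [← huA.1, ← mul_assoc, ← mul_assoc, hq.isIdempotentElem.eq]
          have h2 : u * q = u := by
            rw [← huA.1, mul_assoc, hq.isIdempotentElem.eq]
          rw [← mul_assoc, h1, mul_assoc, h2]
        · intro z hz
          rw [← mul_assoc, huA.2 z hz, mul_assoc, huA.2 z hz, mul_assoc]
      have h2 := hasSmallSymmetry_of_mass (F := F) hdp (hsub _ hLsA _ hsupA) hL.le
      have h3 := HasSmallSymmetry.add hadd hsub hls hdp hor hgood h2
      rw [add_sub_cancel] at h3
      exact (hcS L.2).2 h3
  obtain ⟨m, -, hm⟩ := zorn_le_nonempty₀ S hchain _ hstart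
  set p := coproj m with hpdef
  have hp : IsStarProjection p := isStarProjection_coproj m
  have hpA : p ∈ 𝒜 := hm.prop.1
  have hmass0 : mass F (0 : K →L[ℂ] K) = 0 := by simp [mass]
  have hp0 : p ≠ 0 := by
    intro h0
    refine hm.prop.2 ?_
    rw [← hpdef, h0]
    refine hasSmallSymmetry_of_mass (IsStarProjection.zero _) (h0 ▸ hpA) ?_
    rw [hmass0]; exact hε.le
  obtain ⟨r, hrA, hr, hpr, hr0, hrp⟩ := hdiff p hpA hp hp0
  have hrp' : r * p = r := by
    have := congrArg star hpr
    rwa [star_mul, hp.isSelfAdjoint.star_eq, hr.isSelfAdjoint.star_eq] at this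
  -- a projection below `p` without a small symmetry is equal to `p`, by minimality
  have hmin : ∀ r' ∈ 𝒜, IsStarProjection r' → r' * p = r' → p * r' = r' →
      ¬ HasSmallSymmetry 𝒜 F ε r' → r' = p := by
    intro r' hr'A hr' h1 h1' h2
    have hmem : LinearMap.ker (r' : K →ₗ[ℂ] K) ∈ S := by
      change coproj _ ∈ 𝒜 ∧ ¬ HasSmallSymmetry 𝒜 F ε (coproj _)
      rw [coproj_ker hr']
      exact ⟨hr'A, h2⟩
    have hmle : m ≤ LinearMap.ker (r' : K →ₗ[ℂ] K) := by
      intro x hx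
      have hpx : p x = 0 := by
        rw [hpdef, coproj_apply, sub_eq_zero, eq_comm, Submodule.starProjection_eq_self_iff]
        exact Submodule.le_topologicalClosure _ hx
      change r' x = 0
      rw [← h1]
      change r' (p x) = 0
      rw [hpx, map_zero]
    have hle := hm.le_of_ge hmem hmle
    ext x
    have h3 : x - r' x ∈ m := hle (by
      change r' (x - r' x) = 0
      rw [map_sub, proj_proj hr', sub_self])
    have h4 : p (x - r' x) = 0 := by
      rw [hpdef, coproj_apply, sub_eq_zero, eq_comm, Submodule.starProjection_eq_self_iff]
      exact Submodule.le_topologicalClosure _ h3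
    have h5 : p (r' x) = r' x := congrArg (fun T : K →L[ℂ] K => T x) h1'
    rw [map_sub, h5, sub_eq_zero] at h4
    exact h4.symm
  have hsp : IsStarProjection (p - r) := by
    refine ⟨?_, hp.isSelfAdjoint.sub hr.isSelfAdjoint⟩
    change _ * _ = _
    rw [sub_mul, mul_sub, mul_sub, hpr, hrp', hp.isIdempotentElem.eq, hr.isIdempotentElem.eq,
      sub_self, sub_zero]
  have hor : r * (p - r) = 0 := by rw [mul_sub, hrp', hr.isIdempotentElem.eq, sub_self]
  have hrgood : HasSmallSymmetry 𝒜 F ε r := by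
    by_contra h
    exact hrp (hmin r hrA hr hrp' hpr h)
  have hsgood : HasSmallSymmetry 𝒜 F ε (p - r) := by
    by_contra h
    have := hmin (p - r) (hsub _ hpA _ hrA) hsp
      (by rw [sub_mul, hrp', hp.isIdempotentElem.eq])
      (by rw [mul_sub, hpr, hp.isIdempotentElem.eq]) h
    exact hr0 (sub_eq_self.1 this)
  have h := HasSmallSymmetry.add hadd hsub hr hsp hor hrgood hsgood
  rw [add_sub_cancel] at h
  exact hm.prop.2 h

end Diffuse

/-! ### Matrices of operators as operators -/

section MatOp

variable {k : ℕ} {G : Type*} [NormedAddCommGroup G] [InnerProductSpace ℂ G] [CompleteSpace G]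

/-- The operator on `G ⊕ ⋯ ⊕ G` given by a matrix of operators on `G`. -/
def matOp (x : Matrix (Fin k) (Fin k) (G →L[ℂ] G)) :
    lp (fun _ : Fin k => G) 2 →L[ℂ] lp (fun _ : Fin k => G) 2 :=
  lpOp (fun i => ∑ j, x i j ∘L lp.evalCLM ℂ (fun _ : Fin k => G) 2 j) fun _ => Memℓp.all _

theorem matOp_apply (x : Matrix (Fin k) (Fin k) (G →L[ℂ] G)) (ξ : lp (fun _ : Fin k => G) 2)
    (i : Fin k) : matOp x ξ i = ∑ j, x i j (ξ j) := by
  rw [matOp, lpOp_apply, sum_apply]; rfl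

theorem matOp_single (x : Matrix (Fin k) (Fin k) (G →L[ℂ] G)) (i j : Fin k) (v : G) :
    matOp x (lp.single (E := fun _ : Fin k => G) 2 j v) i = x i j v := by
  rw [matOp_apply, Finset.sum_eq_single j]
  · rw [lp.single_apply_self]
  · intro l _ hl
    rw [lp.single_apply_ne (E := fun _ : Fin k => G) 2 j v hl, map_zero]
  · simp

theorem matOp_mul (x y : Matrix (Fin k) (Fin k) (G →L[ℂ] G)) :
    matOp (x * y) = matOp x * matOp y := by
  refine ContinuousLinearMap.ext fun ξ => lp.ext (funext fun i => ?_)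
  change matOp (x * y) ξ i = matOp x (matOp y ξ) i
  simp only [matOp_apply, Matrix.mul_apply, sum_apply, map_sum]
  exact Finset.sum_comm

theorem matOp_star (x : Matrix (Fin k) (Fin k) (G →L[ℂ] G)) : matOp (star x) = star (matOp x) := by
  rw [ContinuousLinearMap.star_eq_adjoint, ContinuousLinearMap.eq_adjoint_iff]
  intro ξ η
  rw [lp.inner_eq_tsum, lp.inner_eq_tsum, tsum_fintype, tsum_fintype]
  simp only [matOp_apply, sum_inner, inner_sum, Matrix.star_apply,
    ContinuousLinearMap.star_eq_adjoint, ContinuousLinearMap.adjoint_inner_left]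
  exact Finset.sum_comm

theorem matOp_injective : Function.Injective (matOp (k := k) (G := G)) := by
  intro x y h
  ext i j v
  rw [← matOp_single, h, matOp_single]

theorem matOp_surjective : Function.Surjective (matOp (k := k) (G := G)) := by
  intro S
  let sg : Fin k → G →L[ℂ] lp (fun _ : Fin k => G) 2 := fun j =>
    lp.singleContinuousLinearMap ℂ (fun _ : Fin k => G) 2 j
  refine ⟨fun i j => lp.evalCLM ℂ (fun _ : Fin k => G) 2 i ∘L S ∘L sg j, ?_⟩
  refine ContinuousLinearMap.ext fun ξ => lp.ext (funext fun i => ?_)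
  refine (matOp_apply _ ξ i).trans ?_
  change ∑ j, lp.evalCLM ℂ (fun _ : Fin k => G) 2 i (S (sg j (ξ j)))
    = lp.evalCLM ℂ (fun _ : Fin k => G) 2 i (S ξ)
  rw [← map_sum, ← map_sum]
  congr 2
  ext l
  have : (∑ j, sg j (ξ j)) l = ∑ j, sg j (ξ j) l :=
    map_sum (lp.evalCLM ℂ (fun _ : Fin k => G) 2 l) _ _
  rw [this, Finset.sum_eq_single l]
  · exact lp.single_apply_self (E := fun _ : Fin k => G) 2 l _
  · intro j _ hj
    exact lp.single_apply_ne (E := fun _ : Fin k => G) 2 j _ hj.symm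
  · simp

theorem matOp_mem_centralizer {S : Set (Matrix (Fin k) (Fin k) (G →L[ℂ] G))}
    {x : Matrix (Fin k) (Fin k) (G →L[ℂ] G)} :
    matOp x ∈ Set.centralizer (matOp '' S) ↔ x ∈ Set.centralizer S := by
  simp only [Set.mem_centralizer_iff, Set.forall_mem_image, ← matOp_mul, matOp_injective.eq_iff]

theorem centralizer_matOp_image (S : Set (Matrix (Fin k) (Fin k) (G →L[ℂ] G))) :
    Set.centralizer (matOp '' S) = matOp '' Set.centralizer S := by
  ext T
  obtain ⟨x, rfl⟩ := matOp_surjective T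
  rw [matOp_mem_centralizer, matOp_injective.mem_set_image]

theorem isStarProjection_matOp {p : Matrix (Fin k) (Fin k) (G →L[ℂ] G)} :
    IsStarProjection (matOp p) ↔ IsStarProjection p := by
  rw [isStarProjection_iff, isStarProjection_iff, IsIdempotentElem, IsIdempotentElem,
    isSelfAdjoint_iff, isSelfAdjoint_iff, ← matOp_mul, ← matOp_star, matOp_injective.eq_iff,
    matOp_injective.eq_iff]

theorem matOp_zero : matOp (0 : Matrix (Fin k) (Fin k) (G →L[ℂ] G)) = 0 := by
  refine ContinuousLinearMap.ext fun ξ => lp.ext (funext fun i => ?_)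
  rw [matOp_apply]
  simp

theorem norm_symmetry_le {K : Type*} [NormedAddCommGroup K] [InnerProductSpace ℂ K]
    [CompleteSpace K] {q u : K →L[ℂ] K} (hq : IsStarProjection q) (hu : IsSelfAdjoint u)
    (huu : u * u = q) (x : K) : ‖u x‖ ≤ ‖x‖ := by
  have h1 : ‖q x‖ ≤ ‖x‖ := by
    have h := norm_proj_sq hq x
    have h2 : ‖q x‖ ^ 2 ≤ ‖x‖ * ‖q x‖ := by
      have h3 := norm_inner_le_norm (𝕜 := ℂ) x (q x)
      rwa [← h, Complex.norm_real, Real.norm_of_nonneg (by positivity)] at h3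
    by_contra hlt
    push Not at hlt
    nlinarith [norm_nonneg x]
  have h2 : ⟪u x, u x⟫_ℂ = ⟪q x, q x⟫_ℂ := by
    rw [← inner_proj hq, proj_proj hq, ← huu, ← ContinuousLinearMap.adjoint_inner_left,
      ← ContinuousLinearMap.star_eq_adjoint, hu.star_eq]
    rfl
  have h3 : ‖u x‖ = ‖q x‖ := by rw [@norm_eq_sqrt_re_inner ℂ, @norm_eq_sqrt_re_inner ℂ, h2]
  exact h3.trans_le h1

/-- Weak convergence to `0` of a bounded sequence may be tested on a dense sequence of vectors. -/
theorem tendsto_inner_of_denseRange {K : Type*} [NormedAddCommGroup K] [InnerProductSpace ℂ K]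
    {T : ℕ → K →L[ℂ] K} {C : ℝ} (hT : ∀ n x, ‖T n x‖ ≤ C * ‖x‖) {d : ℕ → K} (hd : DenseRange d)
    (h : ∀ a b, Tendsto (fun n => ⟪d a, T n (d b)⟫_ℂ) atTop (𝓝 0)) (x y : K) :
    Tendsto (fun n => ⟪x, T n y⟫_ℂ) atTop (𝓝 0) := by
  have hd' : ∀ g : K, g ∈ (Submodule.span ℂ (Set.range d)).topologicalClosure := fun g =>
    closure_mono Submodule.subset_span (hd g)
  have h1 : ∀ a y, Tendsto (fun n => ⟪d a, T n y⟫_ℂ) atTop (𝓝 0) := by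
    intro a y
    refine tendsto_zero_of_dense_span (C := ‖d a‖ * C) (T := fun n => innerSL ℂ (d a) ∘L T n)
      (fun n x => ?_) (hd' y) ?_
    · rw [mul_assoc]
      exact (norm_inner_le_norm (𝕜 := ℂ) (d a) (T n x)).trans
        (mul_le_mul_of_nonneg_left (hT n x) (norm_nonneg _))
    · rintro _ ⟨b, rfl⟩
      exact h a b
  have h2 : Tendsto (fun n => ⟪T n y, x⟫_ℂ) atTop (𝓝 0) := by
    refine tendsto_zero_of_dense_span (C := C * ‖y‖) (T := fun n => innerSL ℂ (T n y))
      (fun n z => ?_) (hd' x) ?_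
    · exact (norm_inner_le_norm (𝕜 := ℂ) (T n y) z).trans
        (mul_le_mul_of_nonneg_right (hT n y) (norm_nonneg _))
    · rintro _ ⟨a, rfl⟩
      have h4 := (Complex.continuous_conj.tendsto 0).comp (h1 a y)
      rw [map_zero] at h4
      exact h4.congr fun n => inner_conj_symm (T n y) (d a)
  have h4 := (Complex.continuous_conj.tendsto 0).comp h2
  rw [map_zero] at h4
  exact h4.congr fun n => inner_conj_symm x (T n y)

end MatOp

namespace OrthRep

variable {H : Type*} [NormedAddCommGroup H] [InnerProductSpace ℝ H] {k : ℕ}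

/-- A diffuse von Neumann algebra of matrices contains a sequence of symmetries whose matrix
coefficients on `L²(ℝ) ⊗ Ω` converge to `0`. -/
theorem exists_weakly_null_symmetries {U : OrthRep H} {q : U.Amp k} (hq : IsStarProjection q)
    {A : Set (U.Amp k)} (hA : U.IsVNAlgebraWithUnit q A) (hdiff : U.IsDiffuse A) :
    ∃ u : ℕ → U.Amp k, (∀ n, u n ∈ A) ∧ (∀ n, star (u n) = u n) ∧ (∀ n, u n * u n = q) ∧
      (∀ n i j ξ, ‖u n i j ξ‖ ≤ ‖ξ‖) ∧
      ∀ i j h g, Tendsto (fun n => ⟪tens (vacuum U.Space) h, u n i j (tens (vacuum U.Space) g)⟫_ℂ)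
        atTop (𝓝 0) := by
  classical
  have : Fact ((2 : ℝ≥0∞) ≠ ∞) := ⟨ENNReal.ofNat_ne_top⟩
  have : TopologicalSpace.SeparableSpace L2R :=
    inferInstanceAs (TopologicalSpace.SeparableSpace (Lp ℂ 2 (volume : Measure ℝ)))
  have hq' : IsStarProjection (matOp q) := isStarProjection_matOp.2 hq
  let d : ℕ → L2R := TopologicalSpace.denseSeq L2R
  let f : Fin k → ℕ → lp (fun _ : Fin k => U.CoreSpace) 2 := fun j m =>
    lp.single (E := fun _ : Fin k => U.CoreSpace) 2 j (tens (vacuum U.Space) (d m))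
  let F : ℕ → Finset (lp (fun _ : Fin k => U.CoreSpace) 2) := fun n =>
    (Finset.univ ×ˢ Finset.range n).image fun p => f p.1 p.2
  have hF0 : ∀ n, 0 ≤ mass (F n) (matOp q) := fun n => Finset.sum_nonneg fun _ _ => by positivity
  have key : ∀ n : ℕ, HasSmallSymmetry (matOp '' A) (F n)
      (1 / ((n + 1) * (mass (F n) (matOp q) + 1))) (matOp q) := by
    intro n
    refine exists_small_symmetry hq' (Set.mem_image_of_mem _ hA.unit_mem) ?_ ?_ (F n) ?_
    · intro T
      obtain ⟨x, rfl⟩ := matOp_surjective T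
      rw [matOp_injective.mem_set_image, centralizer_matOp_image, matOp_mem_centralizer,
        hA.mem_iff, ← matOp_mul, ← matOp_mul, matOp_injective.eq_iff]
    · rintro _ ⟨p, hp, rfl⟩ hpp hp0
      obtain ⟨r, hr, h1, h2, h3, h4⟩ := hdiff p hp (isStarProjection_matOp.1 hpp)
        (fun h => hp0 (by rw [h, matOp_zero]))
      refine ⟨matOp r, ⟨r, hr, rfl⟩, isStarProjection_matOp.2 h1, by rw [← matOp_mul, h2],
        fun h => h3 (matOp_injective (h.trans matOp_zero.symm)), fun h => h4 (matOp_injective h)⟩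
    · have := hF0 n
      positivity
  have key2 : ∀ n : ℕ, ∃ u ∈ A, star u = u ∧ u * u = q ∧
      coeffSum (F n) (matOp u) ≤ 1 / ((n : ℝ) + 1) := by
    intro n
    obtain ⟨_, ⟨u, hu, rfl⟩, h1, h2, -, h3⟩ := key n
    refine ⟨u, hu, ?_, ?_, h3.trans ?_⟩
    · exact matOp_injective (by rw [matOp_star]; exact h1)
    · exact matOp_injective (by rw [matOp_mul]; exact h2)
    · have := hF0 n
      rw [div_mul_eq_mul_div, one_mul, div_le_div_iff₀ (by positivity) (by positivity)]
      nlinarith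
  choose u huA hus huu huF using key2
  have hnorm : ∀ n i j ξ, ‖u n i j ξ‖ ≤ ‖ξ‖ := by
    intro n i j ξ
    rw [← matOp_single]
    refine (lp.norm_apply_le_norm two_ne_zero _ i).trans ?_
    refine (norm_symmetry_le hq' ?_ ?_ _).trans
      (lp.norm_single (E := fun _ : Fin k => U.CoreSpace) (by norm_num) j ξ).le
    · exact isSelfAdjoint_iff.2 (by rw [← matOp_star, hus])
    · rw [← matOp_mul, huu]
  refine ⟨u, huA, hus, huu, hnorm, fun i j => ?_⟩
  have hcoef : ∀ a b, Tendsto (fun n => ⟪tens (vacuum U.Space) (d a),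
      u n i j (tens (vacuum U.Space) (d b))⟫_ℂ) atTop (𝓝 0) := by
    intro a b
    have h1 : Tendsto (fun n : ℕ => Real.sqrt (1 / ((n : ℝ) + 1))) atTop (𝓝 0) := by
      have := (Real.continuous_sqrt.tendsto 0).comp tendsto_one_div_add_atTop_nhds_zero_nat
      rwa [Real.sqrt_zero] at this
    refine squeeze_zero_norm' ?_ h1
    filter_upwards [eventually_gt_atTop (max a b)] with n hn
    refine Real.le_sqrt_of_sq_le (le_trans ?_ (huF n))
    have h2 : ⟪tens (vacuum U.Space) (d a), u n i j (tens (vacuum U.Space) (d b))⟫_ℂ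
        = ⟪f i a, matOp (u n) (f j b)⟫_ℂ := by
      rw [lp.inner_single_left, matOp_single]
    have hmem : ∀ (l : Fin k) (m : ℕ), m < n → f l m ∈ F n := fun l m hm =>
      Finset.mem_image.2 ⟨(l, m), by simp [hm], rfl⟩
    rw [h2]
    calc ‖⟪f i a, matOp (u n) (f j b)⟫_ℂ‖ ^ 2
        ≤ ∑ g ∈ F n, ‖⟪f i a, matOp (u n) g⟫_ℂ‖ ^ 2 :=
          Finset.single_le_sum (f := fun g => ‖⟪f i a, matOp (u n) g⟫_ℂ‖ ^ 2)
            (fun _ _ => by positivity) (hmem j b (lt_of_le_of_lt (le_max_right _ _) hn))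
      _ ≤ coeffSum (F n) (matOp (u n)) :=
          Finset.single_le_sum (f := fun x => ∑ g ∈ F n, ‖⟪x, matOp (u n) g⟫_ℂ‖ ^ 2)
            (fun _ _ => Finset.sum_nonneg fun _ _ => by positivity)
            (hmem i a (lt_of_le_of_lt (le_max_left _ _) hn))
  intro h g
  have h3 := tendsto_inner_of_denseRange (T := fun n => compress (vacuum U.Space) (u n i j))
    (C := 1) (fun n => norm_compress_le norm_vacuum fun ξ => by rw [one_mul]; exact hnorm n i j ξ)
    (TopologicalSpace.denseRange_denseSeq L2R) (fun a b => by
      simp only [compress_apply, ← inner_tens_left]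
      exact hcoef a b) h g
  simp only [compress_apply, ← inner_tens_left] at h3
  exact h3

end OrthRep

/-! ### Row operations on Hilbert sums -/

section RowOp

variable {k : ℕ} {κ : Type*} {G : Type*} [NormedAddCommGroup G] [InnerProductSpace ℂ G]

theorem memlp_row (a : Matrix (Fin k) (Fin k) (G →L[ℂ] G))
    (ξ : lp (fun _ : Fin k × κ => G) 2) :
    Memℓp (fun p : Fin k × κ => ∑ l, a p.1 l (ξ (l, p.2))) 2 := by
  refine Memℓp.finsetSum _ fun l _ => ?_
  rw [memlp_two_iff]
  have h1 : Summable fun i => ‖a i l‖ ^ 2 := Summable.of_finite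
  have h2 : Summable fun x => ‖ξ (l, x)‖ ^ 2 :=
    (lp_summable_sq ξ).comp_injective (i := fun x => (l, x)) fun _ _ h => (Prod.ext_iff.1 h).2
  refine Summable.of_nonneg_of_le (fun p => by positivity) (fun p => ?_)
    (h1.mul_of_nonneg h2 (fun _ => by positivity) (fun _ => by positivity))
  rw [← mul_pow]
  exact pow_le_pow_left₀ (norm_nonneg _) ((a p.1 l).le_opNorm _) 2

theorem inner_eq_sum (ξ η : lp (fun _ : Fin k × κ => G) 2) :
    ⟪ξ, η⟫_ℂ = ∑ i, ∑' x, ⟪ξ (i, x), η (i, x)⟫_ℂ := by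
  have h : Summable fun p : Fin k × κ => ⟪ξ p, η p⟫_ℂ := lp.summable_inner ξ η
  rw [lp.inner_eq_tsum, h.tsum_prod, tsum_fintype]

variable [CompleteSpace G]

/-- The action of a matrix of operators on the first index of a Hilbert sum over `Fin k × κ`. -/
def rowOp (a : Matrix (Fin k) (Fin k) (G →L[ℂ] G)) :
    lp (fun _ : Fin k × κ => G) 2 →L[ℂ] lp (fun _ : Fin k × κ => G) 2 :=
  lpOp (fun p => ∑ l, a p.1 l ∘L lp.evalCLM ℂ (fun _ : Fin k × κ => G) 2 (l, p.2)) fun ξ => by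
    have h : ∀ p : Fin k × κ,
        (∑ l, a p.1 l ∘L lp.evalCLM ℂ (fun _ : Fin k × κ => G) 2 (l, p.2)) ξ
          = ∑ l, a p.1 l (ξ (l, p.2)) := fun p => by rw [sum_apply]; rfl
    simp only [h]
    exact memlp_row a ξ

theorem rowOp_apply (a : Matrix (Fin k) (Fin k) (G →L[ℂ] G)) (ξ : lp (fun _ : Fin k × κ => G) 2)
    (i : Fin k) (x : κ) : rowOp a ξ (i, x) = ∑ l, a i l (ξ (l, x)) := by
  rw [rowOp, lpOp_apply, sum_apply]; rfl

theorem rowOp_mul (a b : Matrix (Fin k) (Fin k) (G →L[ℂ] G)) (ξ : lp (fun _ : Fin k × κ => G) 2) :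
    rowOp (a * b) ξ = rowOp a (rowOp b ξ) := by
  refine lp.ext (funext fun ⟨i, x⟩ => ?_)
  simp only [rowOp_apply, Matrix.mul_apply, sum_apply, map_sum]
  exact Finset.sum_comm

theorem inner_rowOp_left (a : Matrix (Fin k) (Fin k) (G →L[ℂ] G))
    (ξ η : lp (fun _ : Fin k × κ => G) 2) : ⟪rowOp a ξ, η⟫_ℂ = ⟪ξ, rowOp (star a) η⟫_ℂ := by
  have hrow : ∀ (ζ : lp (fun _ : Fin k × κ => G) 2) (i : Fin k), Memℓp (fun x => ζ (i, x)) 2 :=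
    fun ζ i => memlp_two_iff.2 ((lp_summable_sq ζ).comp_injective (i := fun x => (i, x))
      fun _ _ h => (Prod.ext_iff.1 h).2)
  have hs : ∀ (i l : Fin k), Summable fun x => ⟪a i l (ξ (l, x)), η (i, x)⟫_ℂ := by
    intro i l
    have h1 : Memℓp (fun x => a i l (ξ (l, x))) 2 := by
      rw [memlp_two_iff]
      refine Summable.of_nonneg_of_le (fun p => by positivity) (fun p => ?_)
        ((memlp_two_iff.1 (hrow ξ l)).mul_left (‖a i l‖ ^ 2))
      rw [← mul_pow]
      exact pow_le_pow_left₀ (norm_nonneg _) ((a i l).le_opNorm _) 2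
    exact lp.summable_inner (𝕜 := ℂ) (G := fun _ : κ => G) ⟨_, h1⟩ ⟨_, hrow η i⟩
  rw [inner_eq_sum, inner_eq_sum]
  simp only [rowOp_apply, sum_inner, inner_sum, Matrix.star_apply,
    ContinuousLinearMap.star_eq_adjoint, ContinuousLinearMap.adjoint_inner_right]
  have e1 : ∀ i, ∑' x, ∑ l, ⟪a i l (ξ (l, x)), η (i, x)⟫_ℂ
      = ∑ l, ∑' x, ⟪a i l (ξ (l, x)), η (i, x)⟫_ℂ := fun i =>
    Summable.tsum_finsetSum fun l _ => hs i l
  have e2 : ∀ l, ∑' x, ∑ i, ⟪a i l (ξ (l, x)), η (i, x)⟫_ℂ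
      = ∑ i, ∑' x, ⟪a i l (ξ (l, x)), η (i, x)⟫_ℂ := fun l =>
    Summable.tsum_finsetSum fun i _ => hs i l
  simp only [e1, e2]
  exact Finset.sum_comm

end RowOp

section Reindex

variable {ι : Type*} {G : Type*} [NormedAddCommGroup G] [InnerProductSpace ℂ G] [CompleteSpace G]

/-- The action of an operator on every component of a Hilbert sum. -/
def diagOp (c : G →L[ℂ] G) : lp (fun _ : ι => G) 2 →L[ℂ] lp (fun _ : ι => G) 2 :=
  lpOp (fun p => c ∘L lp.evalCLM ℂ (fun _ : ι => G) 2 p) fun ξ => by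
    rw [memlp_two_iff]
    refine Summable.of_nonneg_of_le (fun p => by positivity) (fun p => ?_)
      ((lp_summable_sq ξ).mul_left (‖c‖ ^ 2))
    rw [← mul_pow]
    exact pow_le_pow_left₀ (norm_nonneg _) (c.le_opNorm _) 2

/-- The reindexing of a Hilbert sum by a permutation. -/
def reindexOp (e : Equiv.Perm ι) : lp (fun _ : ι => G) 2 →L[ℂ] lp (fun _ : ι => G) 2 :=
  lpOp (fun p => lp.evalCLM ℂ (fun _ : ι => G) 2 (e p)) fun ξ =>
    memlp_two_iff.2 ((lp_summable_sq ξ).comp_injective e.injective)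

theorem reindexOp_apply (e : Equiv.Perm ι) (ξ : lp (fun _ : ι => G) 2) (p : ι) :
    reindexOp e ξ p = ξ (e p) := rfl

theorem norm_reindexOp (e : Equiv.Perm ι) (ξ : lp (fun _ : ι => G) 2) : ‖reindexOp e ξ‖ = ‖ξ‖ := by
  have h : ‖reindexOp e ξ‖ ^ 2 = ‖ξ‖ ^ 2 := by
    rw [lp_norm_sq, lp_norm_sq]
    exact e.tsum_eq fun p => ‖ξ p‖ ^ 2
  exact (sq_eq_sq₀ (norm_nonneg _) (norm_nonneg _)).1 h

theorem inner_reindexOp_left (e : Equiv.Perm ι) (ξ η : lp (fun _ : ι => G) 2) :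
    ⟪reindexOp e ξ, η⟫_ℂ = ⟪ξ, reindexOp e.symm η⟫_ℂ := by
  rw [lp.inner_eq_tsum, lp.inner_eq_tsum, ← e.tsum_eq fun p => ⟪ξ p, reindexOp e.symm η p⟫_ℂ]
  simp only [reindexOp_apply, e.symm_apply_apply]

end Reindex

namespace OrthRep

variable {H : Type*} [NormedAddCommGroup H] [InnerProductSpace ℝ H] {k : ℕ}

/-! ### Left and right multiplication on the ambient Hilbert space -/

/-- The interchange of the two matrix indices. -/
def swapIdx (k : ℕ) : Equiv.Perm (Fin k × Fin k × ℤ) where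
  toFun p := (p.2.1, p.1, p.2.2)
  invFun p := (p.2.1, p.1, p.2.2)
  left_inv _ := rfl
  right_inv _ := rfl

/-- Left multiplication by a matrix of operators. -/
def leftMul (U : OrthRep H) (a : U.Amp k) : U.L2Ambient k →L[ℂ] U.L2Ambient k := rowOp a

theorem leftMul_apply (U : OrthRep H) (a : U.Amp k) (ξ : U.L2Ambient k) (i j : Fin k) (n : ℤ) :
    U.leftMul a ξ (i, j, n) = ∑ l, a i l (ξ (l, j, n)) := rowOp_apply a ξ i (j, n)

theorem leftMul_mul (U : OrthRep H) (a b : U.Amp k) (ξ : U.L2Ambient k) :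
    U.leftMul (a * b) ξ = U.leftMul a (U.leftMul b ξ) := rowOp_mul a b ξ

theorem inner_leftMul_left (U : OrthRep H) (a : U.Amp k) (ξ η : U.L2Ambient k) :
    ⟪U.leftMul a ξ, η⟫_ℂ = ⟪ξ, U.leftMul (star a) η⟫_ℂ := inner_rowOp_left a ξ η

/-- The projection onto the components in `L²(ℝ) ⊗ Ω`. -/
def vacProj (U : OrthRep H) (k : ℕ) : U.L2Ambient k →L[ℂ] U.L2Ambient k :=
  diagOp (amplify (rankOne (vacuum U.Space) (vacuum U.Space)))

theorem vacProj_apply (U : OrthRep H) (ξ : U.L2Ambient k) (p : Fin k × Fin k × ℤ) :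
    U.vacProj k ξ p = tens (vacuum U.Space) (slice (vacuum U.Space) (ξ p)) :=
  amplify_rankOne _ _ (ξ p)

theorem inner_vacProj_left (U : OrthRep H) (ξ η : U.L2Ambient k) :
    ⟪U.vacProj k ξ, η⟫_ℂ = ⟪ξ, U.vacProj k η⟫_ℂ := by
  rw [lp.inner_eq_tsum, lp.inner_eq_tsum]
  refine tsum_congr fun p => ?_
  rw [vacProj_apply, vacProj_apply, inner_tens_left, inner_tens_right]

theorem vacProj_vacProj (U : OrthRep H) (ξ : U.L2Ambient k) :
    U.vacProj k (U.vacProj k ξ) = U.vacProj k ξ := by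
  refine lp.ext (funext fun p => ?_)
  rw [vacProj_apply, vacProj_apply, slice_tens_self norm_vacuum]

theorem vacProj_eq_zero_iff (U : OrthRep H) {ξ : U.L2Ambient k} :
    U.vacProj k ξ = 0 ↔ ∀ p, slice (vacuum U.Space) (ξ p) = 0 := by
  constructor
  · intro h p
    rw [← slice_tens_self (Ω := vacuum U.Space) norm_vacuum (slice (vacuum U.Space) (ξ p)), ← vacProj_apply, h]
    exact map_zero (slice (vacuum U.Space))
  · intro h
    refine lp.ext (funext fun p => ?_)
    rw [vacProj_apply, h, map_zero]; rfl

theorem vacProj_leftMul {U : OrthRep H} {a : U.Amp k} (ha : ∀ i j, a i j ∈ U.groupAlgebra)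
    (ξ : U.L2Ambient k) : U.vacProj k (U.leftMul a ξ) = U.leftMul a (U.vacProj k ξ) := by
  refine lp.ext (funext fun ⟨i, j, n⟩ => ?_)
  simp only [leftMul_apply, vacProj_apply, map_sum]
  refine Finset.sum_congr rfl fun l _ => ?_
  rw [← amplify_rankOne (vacuum U.Space) (vacuum U.Space),
    ← amplify_rankOne (vacuum U.Space) (vacuum U.Space)]
  exact transAlg_amplify (E := Fock U.Space) (ha i l) _ _

variable [CompleteSpace H]

/-- Right multiplication by a matrix over `L(ℝ)`: the entries act through the twisted translations,
which commute with the core. -/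
def rightMul (U : OrthRep H) (b : U.Amp k) : U.L2Ambient k →L[ℂ] U.L2Ambient k :=
  reindexOp (swapIdx k) ∘L rowOp (Matrix.of fun j l => U.flow.rho (b l j)) ∘L reindexOp (swapIdx k)

theorem rightMul_apply (U : OrthRep H) (b : U.Amp k) (ξ : U.L2Ambient k) (i j : Fin k) (n : ℤ) :
    U.rightMul b ξ (i, j, n) = ∑ l, U.flow.rho (b l j) (ξ (i, l, n)) := by
  have h1 : U.rightMul b ξ (i, j, n) = rowOp (Matrix.of fun j l => U.flow.rho (b l j))
      (reindexOp (swapIdx k) ξ) (swapIdx k (i, j, n)) := reindexOp_apply _ _ _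
  have h2 : swapIdx k (i, j, n) = (j, i, n) := rfl
  rw [h1, h2, rowOp_apply]
  refine Finset.sum_congr rfl fun l _ => ?_
  rw [reindexOp_apply]
  rfl

theorem inner_rightMul_left (U : OrthRep H) (b : U.Amp k) (ξ η : U.L2Ambient k) :
    ⟪U.rightMul b ξ, η⟫_ℂ = ⟪ξ, U.rightMul (star b) η⟫_ℂ := by
  have h : star (Matrix.of fun j l => U.flow.rho (b l j) : U.Amp k)
      = Matrix.of fun j l => U.flow.rho (star b l j) := by
    refine Matrix.ext fun j l => ?_
    rw [Matrix.star_apply, ContinuousLinearMap.star_eq_adjoint]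
    symm
    refine (ContinuousLinearMap.eq_adjoint_iff _ _).2 fun x y => ?_
    change ⟪U.flow.rho (star (b j l)) x, y⟫_ℂ = ⟪x, U.flow.rho (b j l) y⟫_ℂ
    rw [U.flow.inner_rho_left, star_star]
  change ⟪reindexOp (swapIdx k) (rowOp _ (reindexOp (swapIdx k) ξ)), η⟫_ℂ = _
  rw [inner_reindexOp_left, inner_rowOp_left, inner_reindexOp_left, h]
  rfl

theorem leftMul_rightMul {U : OrthRep H} {a b : U.Amp k} (ha : ∀ i j, a i j ∈ U.continuousCore)
    (hb : ∀ i j, b i j ∈ U.groupAlgebra) (ξ : U.L2Ambient k) :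
    U.leftMul a (U.rightMul b ξ) = U.rightMul b (U.leftMul a ξ) := by
  refine lp.ext (funext fun ⟨i, j, n⟩ => ?_)
  simp only [leftMul_apply, rightMul_apply, map_sum]
  rw [Finset.sum_comm]
  exact Finset.sum_congr rfl fun l _ => Finset.sum_congr rfl fun m _ =>
    core_commute_rho (ha i m) (hb l j) _

theorem vacProj_rightMul {U : OrthRep H} {b : U.Amp k} (hb : ∀ i j, b i j ∈ U.groupAlgebra)
    (ξ : U.L2Ambient k) : U.vacProj k (U.rightMul b ξ) = U.rightMul b (U.vacProj k ξ) := by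
  refine lp.ext (funext fun ⟨i, j, n⟩ => ?_)
  simp only [rightMul_apply, vacProj_apply, map_sum]
  refine Finset.sum_congr rfl fun l _ => ?_
  have hl : b l j ∈ transAlg (Fock U.Space) := hb l j
  rw [U.flow.rho_tens norm_vacuum U.flow_vacuum hl, transAlg_tens norm_vacuum hl,
    UnitaryFlow.rho_apply, U.flow.slice_fwd U.flow_vacuum, slice_transAlg norm_vacuum hl,
    U.flow.slice_bwd U.flow_vacuum]

end OrthRep

namespace OrthRep

variable {H : Type*} [NormedAddCommGroup H] [InnerProductSpace ℝ H] {k : ℕ}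

/-! ### Corners and square-integrable matrices -/

theorem mem_corner_iff {U : OrthRep H} {N : VonNeumannAlgebra U.CoreSpace} {q : U.Amp k}
    (hq : q * q = q) (hqN : ∀ i j, q i j ∈ N) {x : U.Amp k} :
    x ∈ U.corner N q ↔ (∀ i j, x i j ∈ N) ∧ q * x = x ∧ x * q = x := by
  constructor
  · rintro ⟨y, hy, rfl⟩
    refine ⟨fun i j => ?_, by rw [← mul_assoc, ← mul_assoc, hq], by rw [mul_assoc, hq]⟩
    simp only [Matrix.mul_apply]
    exact sum_mem fun l _ => mul_mem (sum_mem fun m _ => mul_mem (hqN _ _) (hy _ _)) (hqN _ _)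
  · rintro ⟨h1, h2, h3⟩
    exact ⟨x, h1, by rw [h2, h3]⟩

/-- The vector `x̂` is defined: `(Tr_k ⊗ Tr)(x^* x) < ∞`. -/
def SqIntegrable (U : OrthRep H) (x : U.Amp k) : Prop :=
  Memℓp (fun p : Fin k × Fin k × ℤ => x p.1 p.2.1 (U.traceVec p.2.2)) 2

theorem traceVec_eq (U : OrthRep H) (n : ℤ) : U.traceVec n = tens (vacuum U.Space) (windowVec n) :=
  rfl

theorem hat_apply {U : OrthRep H} {x : U.Amp k} (hx : U.SqIntegrable x) (i j : Fin k) (n : ℤ) :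
    U.hat x (i, j, n) = x i j (U.traceVec n) := by
  have h : U.hat x = ⟨_, hx⟩ := dif_pos hx
  rw [h]

theorem sqIntegrable_of_eq {U : OrthRep H} {x : U.Amp k} {ξ : U.L2Ambient k}
    (h : ∀ i j n, ξ (i, j, n) = x i j (U.traceVec n)) : U.SqIntegrable x ∧ U.hat x = ξ := by
  have h1 : U.SqIntegrable x := by
    have h2 : (fun p : Fin k × Fin k × ℤ => x p.1 p.2.1 (U.traceVec p.2.2)) = fun p => ξ p :=
      funext fun p => (h p.1 p.2.1 p.2.2).symm
    unfold SqIntegrable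
    rw [h2]
    exact lp.memℓp ξ
  refine ⟨h1, lp.ext (funext fun ⟨i, j, n⟩ => ?_)⟩
  rw [hat_apply h1, h]

theorem SqIntegrable.left_mul {U : OrthRep H} {x : U.Amp k} (hx : U.SqIntegrable x) (a : U.Amp k) :
    U.SqIntegrable (a * x) ∧ U.hat (a * x) = U.leftMul a (U.hat x) :=
  sqIntegrable_of_eq fun i j n => by
    rw [leftMul_apply, Matrix.mul_apply, sum_apply]
    refine Finset.sum_congr rfl fun l _ => ?_
    rw [hat_apply hx]; rfl

theorem SqIntegrable.add {U : OrthRep H} {x y : U.Amp k} (hx : U.SqIntegrable x)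
    (hy : U.SqIntegrable y) : U.hat (x + y) = U.hat x + U.hat y :=
  (sqIntegrable_of_eq fun i j n => by
    rw [lp.coeFn_add, Pi.add_apply, hat_apply hx, hat_apply hy]; rfl).2

theorem SqIntegrable.smul {U : OrthRep H} {x : U.Amp k} (hx : U.SqIntegrable x) (c : ℂ) :
    U.hat (c • x) = c • U.hat x :=
  (sqIntegrable_of_eq fun i j n => by
    rw [lp.coeFn_smul, Pi.smul_apply, hat_apply hx]; rfl).2

theorem hat_zero (U : OrthRep H) : U.hat (0 : U.Amp k) = 0 :=
  (sqIntegrable_of_eq fun i j n => by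
    rw [lp.coeFn_zero, Pi.zero_apply]; rfl).2

theorem summable_fin_prod {κ : Type*} {f : Fin k × κ → ℝ} (hf : ∀ p, 0 ≤ f p)
    (h : ∀ i, Summable fun x => f (i, x)) : Summable f :=
  (summable_prod_of_nonneg hf).2 ⟨h, Summable.of_finite⟩

/-- A projection with finite trace is square-integrable. -/
theorem sqIntegrable_of_ampTrace {U : OrthRep H} {q : U.Amp k} (hq : IsStarProjection q)
    (hqT : U.ampTrace q < ⊤) : U.SqIntegrable q := by
  have hval : ∀ j n, RCLike.re ⟪U.traceVec n, q j j (U.traceVec n)⟫_ℂ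
      = ∑ l, ‖q l j (U.traceVec n)‖ ^ 2 := by
    intro j n
    have h1 : q j j = ∑ l, star (q l j) * q l j := by
      conv_lhs => rw [← hq.isIdempotentElem.eq]
      rw [Matrix.mul_apply]
      refine Finset.sum_congr rfl fun l _ => ?_
      congr 1
      conv_lhs => rw [← hq.isSelfAdjoint.star_eq]
      rw [Matrix.star_apply]
    rw [h1, sum_apply, inner_sum, map_sum]
    refine Finset.sum_congr rfl fun l _ => ?_
    change RCLike.re ⟪U.traceVec n, star (q l j) (q l j (U.traceVec n))⟫_ℂ = _
    rw [ContinuousLinearMap.star_eq_adjoint, ContinuousLinearMap.adjoint_inner_right,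
      inner_self_eq_norm_sq]
  have hs : ∀ l j, Summable fun n => ‖q l j (U.traceVec n)‖ ^ 2 := by
    intro l j
    have h1 : U.trace (q j j) ≠ ⊤ :=
      (ENNReal.sum_lt_top.1 hqT j (Finset.mem_univ j)).ne
    have h2 := ENNReal.summable_toReal h1
    refine Summable.of_nonneg_of_le (fun n => by positivity) (fun n => ?_) h2
    rw [hval, ENNReal.toReal_ofReal (Finset.sum_nonneg fun _ _ => by positivity)]
    exact Finset.single_le_sum (f := fun l => ‖q l j (U.traceVec n)‖ ^ 2)
      (fun _ _ => by positivity) (Finset.mem_univ l)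
  rw [SqIntegrable, memlp_two_iff]
  exact summable_fin_prod (fun _ => by positivity) fun l =>
    summable_fin_prod (fun _ => by positivity) fun j => hs l j

/-- The trace property on `M_k(ℂ) ⊗ L(ℝ)`: a matrix and its adjoint have the same `L²` norm. -/
theorem norm_hat_star {U : OrthRep H} {b : U.Amp k} (hb : ∀ i j, b i j ∈ U.groupAlgebra)
    (h1 : U.SqIntegrable b) (h2 : U.SqIntegrable (star b)) : ‖U.hat (star b)‖ = ‖U.hat b‖ := by
  rw [← norm_reindexOp (swapIdx k) (U.hat (star b))]
  have h : ‖reindexOp (swapIdx k) (U.hat (star b))‖ ^ 2 = ‖U.hat b‖ ^ 2 := by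
    rw [lp_norm_sq, lp_norm_sq]
    refine tsum_congr fun ⟨i, j, n⟩ => ?_
    have h3 : reindexOp (swapIdx k) (U.hat (star b)) (i, j, n) = U.hat (star b) (j, i, n) := rfl
    rw [h3, hat_apply h1, hat_apply h2, Matrix.star_apply]
    have h4 : b i j ∈ transAlg (Fock U.Space) := hb i j
    rw [transAlg_norm_star h4]
  exact (sq_eq_sq₀ (norm_nonneg _) (norm_nonneg _)).1 h

/-- The setting of a finite corner: a projection over `L(ℝ)` with finite trace. -/
structure IsFiniteProjection (U : OrthRep H) (q : U.Amp k) : Prop where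
  isStarProjection : IsStarProjection q
  mem : ∀ i j, q i j ∈ U.groupAlgebra
  ampTrace_lt_top : U.ampTrace q < ⊤

namespace IsFiniteProjection

variable {U : OrthRep H} {q : U.Amp k}

theorem mul_self (hq : U.IsFiniteProjection q) : q * q = q :=
  hq.isStarProjection.isIdempotentElem.eq

theorem star_eq (hq : U.IsFiniteProjection q) : star q = q :=
  hq.isStarProjection.isSelfAdjoint.star_eq

theorem sqIntegrable (hq : U.IsFiniteProjection q) : U.SqIntegrable q :=
  sqIntegrable_of_ampTrace hq.isStarProjection hq.ampTrace_lt_top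

theorem mem_corner_group (hq : U.IsFiniteProjection q) {x : U.Amp k} :
    x ∈ U.corner U.groupAlgebra q ↔ (∀ i j, x i j ∈ U.groupAlgebra) ∧ q * x = x ∧ x * q = x :=
  mem_corner_iff hq.mul_self hq.mem

theorem star_mem_corner (hq : U.IsFiniteProjection q) {b : U.Amp k}
    (hb : b ∈ U.corner U.groupAlgebra q) : star b ∈ U.corner U.groupAlgebra q := by
  rw [hq.mem_corner_group] at hb ⊢
  refine ⟨fun i j => ?_, ?_, ?_⟩
  · rw [Matrix.star_apply]; exact star_mem (hb.1 j i)
  · rw [← hq.star_eq, ← star_mul, hb.2.2]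
  · rw [← hq.star_eq, ← star_mul, hb.2.1]

theorem sqIntegrable_of_mul (hq : U.IsFiniteProjection q) {x : U.Amp k} (hx : x * q = x) :
    U.SqIntegrable x := by
  rw [← hx]; exact (hq.sqIntegrable.left_mul x).1

theorem sqIntegrable_corner (hq : U.IsFiniteProjection q) {N : VonNeumannAlgebra U.CoreSpace}
    {x : U.Amp k} (hx : x ∈ U.corner N q) : U.SqIntegrable x := by
  obtain ⟨y, -, rfl⟩ := hx
  exact hq.sqIntegrable_of_mul (by rw [mul_assoc, hq.mul_self])

/-- The vectors `x̂` of a corner form a linear subspace. -/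
theorem mem_L2_iff (hq : U.IsFiniteProjection q) {N : VonNeumannAlgebra U.CoreSpace}
    {ξ : U.L2Ambient k} :
    ξ ∈ U.L2 (U.corner N q) ↔ ξ ∈ closure (U.hat '' U.corner N q) := by
  have h : (Submodule.span ℂ (U.hat '' U.corner N q) : Set (U.L2Ambient k))
      = U.hat '' U.corner N q := by
    refine Set.Subset.antisymm (fun η hη => ?_) Submodule.subset_span
    induction hη using Submodule.span_induction with
    | mem x hx => exact hx
    | zero => exact ⟨0, ⟨0, fun _ _ => zero_mem N, by simp⟩, U.hat_zero⟩
    | add a b _ _ ha hb =>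
      obtain ⟨x, hx, rfl⟩ := ha
      obtain ⟨y, hy, rfl⟩ := hb
      refine ⟨x + y, ?_, (hq.sqIntegrable_corner hx).add (hq.sqIntegrable_corner hy)⟩
      obtain ⟨x', hx', rfl⟩ := hx
      obtain ⟨y', hy', rfl⟩ := hy
      exact ⟨x' + y', fun i j => add_mem (hx' i j) (hy' i j), by rw [mul_add, add_mul]⟩
    | smul c a _ ha =>
      obtain ⟨x, hx, rfl⟩ := ha
      refine ⟨c • x, ?_, (hq.sqIntegrable_corner hx).smul c⟩
      obtain ⟨x', hx', rfl⟩ := hx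
      exact ⟨c • x', fun i j => N.toStarSubalgebra.smul_mem (hx' i j) c, by
        rw [Matrix.mul_smul, Matrix.smul_mul]⟩
  rw [L2, ← SetLike.mem_coe, Submodule.topologicalClosure_coe, h]

theorem isLeftMul (hq : U.IsFiniteProjection q) {N : VonNeumannAlgebra U.CoreSpace} (a : U.Amp k)
    {ξ : U.L2Ambient k} (hξ : ξ ∈ U.L2 (U.corner N q)) :
    U.IsLeftMul (U.corner N q) a ξ (U.leftMul a ξ) := by
  refine map_mem_closure (f := fun ξ => (ξ, U.leftMul a ξ)) (by fun_prop) (hq.mem_L2_iff.1 hξ) ?_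
  rintro _ ⟨x, hx, rfl⟩
  exact ⟨x, hx, Prod.ext rfl ((hq.sqIntegrable_corner hx).left_mul a).2⟩

theorem leftMul_self (hq : U.IsFiniteProjection q) {N : VonNeumannAlgebra U.CoreSpace}
    {ξ : U.L2Ambient k} (hξ : ξ ∈ U.L2 (U.corner N q)) : U.leftMul q ξ = ξ := by
  have hcl : IsClosed {ξ : U.L2Ambient k | U.leftMul q ξ = ξ} :=
    isClosed_eq (by fun_prop) (by fun_prop)
  refine closure_minimal ?_ hcl (hq.mem_L2_iff.1 hξ)
  rintro _ ⟨x, hx, rfl⟩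
  change U.leftMul q (U.hat x) = U.hat x
  rw [← ((hq.sqIntegrable_corner hx).left_mul q).2]
  obtain ⟨y, -, rfl⟩ := hx
  rw [← mul_assoc, ← mul_assoc, hq.mul_self]

theorem norm_hat_star (hq : U.IsFiniteProjection q) {b : U.Amp k}
    (hb : b ∈ U.corner U.groupAlgebra q) : ‖U.hat (star b)‖ = ‖U.hat b‖ :=
  OrthRep.norm_hat_star (hq.mem_corner_group.1 hb).1 (hq.sqIntegrable_corner hb)
    (hq.sqIntegrable_corner (hq.star_mem_corner hb))

/-- A vector of `L²(B)` is controlled by its inner products with the vectors `b̂`. -/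
theorem norm_le_of_inner (hq : U.IsFiniteProjection q) {ξ : U.L2Ambient k}
    (hξ : ξ ∈ U.L2 (U.corner U.groupAlgebra q)) {C : ℝ}
    (hC : 0 ≤ C) (h : ∀ b ∈ U.corner U.groupAlgebra q, ‖⟪U.hat b, ξ⟫_ℂ‖ ≤ C * ‖U.hat b‖) : ‖ξ‖ ≤ C := by
  have hcl : IsClosed {η : U.L2Ambient k | ‖⟪η, ξ⟫_ℂ‖ ≤ C * ‖η‖} :=
    isClosed_le (by fun_prop) (by fun_prop)
  have h1 : ‖⟪ξ, ξ⟫_ℂ‖ ≤ C * ‖ξ‖ := by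
    refine closure_minimal ?_ hcl (hq.mem_L2_iff.1 hξ)
    rintro _ ⟨b, hb, rfl⟩
    exact h b hb
  rw [inner_self_eq_norm_sq_to_K, norm_pow, RCLike.norm_ofReal, abs_norm, pow_two] at h1
  rcases (norm_nonneg ξ).eq_or_lt with h2 | h2
  · rwa [← h2]
  · exact le_of_mul_le_mul_right h1 h2

end IsFiniteProjection

/-! ### Right multiplication and conditional expectation on corners -/

variable [CompleteSpace H]

theorem SqIntegrable.right_mul {U : OrthRep H} {x : U.Amp k} (hx : U.SqIntegrable x)
    (hxN : ∀ i j, x i j ∈ U.continuousCore) {b : U.Amp k} (hb : ∀ i j, b i j ∈ U.groupAlgebra) :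
    U.SqIntegrable (x * b) ∧ U.hat (x * b) = U.rightMul b (U.hat x) :=
  sqIntegrable_of_eq fun i j n => by
    rw [rightMul_apply, Matrix.mul_apply, sum_apply]
    refine Finset.sum_congr rfl fun l _ => ?_
    rw [hat_apply hx, ← core_commute_rho (hxN i l) (hb l j), traceVec_eq,
      U.flow.rho_tens norm_vacuum U.flow_vacuum (hb l j)]
    rfl

namespace IsFiniteProjection

variable {U : OrthRep H} {q : U.Amp k}

theorem mem_corner_core (hq : U.IsFiniteProjection q) {x : U.Amp k} :
    x ∈ U.corner U.continuousCore q ↔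
      (∀ i j, x i j ∈ U.continuousCore) ∧ q * x = x ∧ x * q = x :=
  mem_corner_iff hq.mul_self fun i j => groupAlgebra_le_core (hq.mem i j)

theorem isRightMul (hq : U.IsFiniteProjection q) {b : U.Amp k}
    (hb : ∀ i j, b i j ∈ U.groupAlgebra) {ξ : U.L2Ambient k}
    (hξ : ξ ∈ U.L2 (U.corner U.continuousCore q)) :
    U.IsRightMul (U.corner U.continuousCore q) b ξ (U.rightMul b ξ) := by
  refine map_mem_closure (f := fun ξ => (ξ, U.rightMul b ξ)) (by fun_prop) (hq.mem_L2_iff.1 hξ) ?_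
  rintro _ ⟨x, hx, rfl⟩
  exact ⟨x, hx, Prod.ext rfl
    ((hq.sqIntegrable_corner hx).right_mul (hq.mem_corner_core.1 hx).1 hb).2⟩

theorem isRightMul_eq (hq : U.IsFiniteProjection q) {b : U.Amp k}
    (hb : ∀ i j, b i j ∈ U.groupAlgebra) {ξ η : U.L2Ambient k}
    (h : U.IsRightMul (U.corner U.continuousCore q) b ξ η) : η = U.rightMul b ξ := by
  have hcl : IsClosed {p : U.L2Ambient k × U.L2Ambient k | p.2 = U.rightMul b p.1} :=
    isClosed_eq (by fun_prop) (by fun_prop)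
  refine closure_minimal ?_ hcl h
  rintro _ ⟨x, hx, rfl⟩
  exact ((hq.sqIntegrable_corner hx).right_mul (hq.mem_corner_core.1 hx).1 hb).2

/-- The vectors `b̂` arise from `q̂` by right multiplication. -/
theorem rightMul_hat_self (hq : U.IsFiniteProjection q) {b : U.Amp k}
    (hb : b ∈ U.corner U.groupAlgebra q) : U.rightMul b (U.hat q) = U.hat b := by
  rw [hq.mem_corner_group] at hb
  rw [← (hq.sqIntegrable.right_mul (fun i j => groupAlgebra_le_core (hq.mem i j)) hb.1).2, hb.2.1]

/-- The conditional expectation onto `M_k(ℂ) ⊗ L(ℝ)` acts on the vectors `x̂` as the projection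
onto the components in `L²(ℝ) ⊗ Ω`. -/
theorem exists_expectation (hq : U.IsFiniteProjection q) {x : U.Amp k}
    (hx : x ∈ U.corner U.continuousCore q) :
    ∃ b ∈ U.corner U.groupAlgebra q, U.hat b = U.vacProj k (U.hat x) := by
  have hx' := hq.mem_corner_core.1 hx
  have hxs := hq.sqIntegrable_corner hx
  choose e he heq using fun i j => OrthRep.exists_expectation (hx'.1 i j)
  obtain ⟨h1, h2⟩ := sqIntegrable_of_eq (x := (Matrix.of e : U.Amp k)) (ξ := U.vacProj k (U.hat x))
    fun i j n => by
      rw [vacProj_apply, hat_apply hxs, traceVec_eq, ← heq]; rfl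
  have h3 := h1.right_mul (fun i j => groupAlgebra_le_core (he i j)) hq.mem
  have h4 := h3.1.left_mul q
  refine ⟨q * (Matrix.of e * q), ⟨Matrix.of e, he, (mul_assoc _ _ _).symm⟩, ?_⟩
  rw [h4.2, h3.2, h2, ← vacProj_rightMul hq.mem, ← vacProj_leftMul hq.mem,
    ← (hxs.right_mul hx'.1 hq.mem).2, hx'.2.2, ← (hxs.left_mul q).2, hx'.2.1]

theorem mem_L2_of_vacProj (hq : U.IsFiniteProjection q) {ξ : U.L2Ambient k}
    (hξ : ξ ∈ U.L2 (U.corner U.continuousCore q)) (h : U.vacProj k ξ = ξ) :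
    ξ ∈ U.L2 (U.corner U.groupAlgebra q) := by
  rw [hq.mem_L2_iff] at hξ ⊢
  rw [← h]
  refine map_mem_closure (U.vacProj k).continuous hξ ?_
  rintro _ ⟨x, hx, rfl⟩
  obtain ⟨b, hb, h⟩ := hq.exists_expectation hx
  exact ⟨b, hb, h⟩

end IsFiniteProjection

end OrthRep

namespace OrthRep

variable {H : Type*} [NormedAddCommGroup H] [InnerProductSpace ℝ H] {k : ℕ}
  {U : OrthRep H} {q : U.Amp k}

/-! ### Asymptotic orthogonality -/

theorem star_leftMul (a : U.Amp k) : star (U.leftMul a) = U.leftMul (star a) := by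
  symm
  rw [ContinuousLinearMap.star_eq_adjoint]
  refine (ContinuousLinearMap.eq_adjoint_iff _ _).2 fun ξ η => ?_
  rw [inner_leftMul_left, star_star]

theorem norm_leftMul_le (hq : IsStarProjection q) {u : U.Amp k} (hu : star u = u)
    (huu : u * u = q) (ξ : U.L2Ambient k) : ‖U.leftMul u ξ‖ ≤ ‖ξ‖ := by
  refine norm_symmetry_le (q := U.leftMul q) ⟨?_, ?_⟩ ?_ ?_ ξ
  · refine ContinuousLinearMap.ext fun η => ?_
    change U.leftMul q (U.leftMul q η) = _
    rw [← leftMul_mul, hq.isIdempotentElem.eq]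
  · rw [isSelfAdjoint_iff, star_leftMul, hq.isSelfAdjoint.star_eq]
  · rw [isSelfAdjoint_iff, star_leftMul, hu]
  · refine ContinuousLinearMap.ext fun η => ?_
    change U.leftMul u (U.leftMul u η) = _
    rw [← leftMul_mul, huu]

theorem norm_leftMul_eq (hq : IsStarProjection q) {u : U.Amp k} (hu : star u = u)
    (huu : u * u = q) {ξ : U.L2Ambient k} (hξ : U.leftMul q ξ = ξ) : ‖U.leftMul u ξ‖ = ‖ξ‖ := by
  refine le_antisymm (norm_leftMul_le hq hu huu ξ) ?_
  conv_lhs => rw [← hξ, ← huu, leftMul_mul]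
  exact norm_leftMul_le hq hu huu _

theorem mem_closure_span_single {ι G : Type*} [DecidableEq ι] [NormedAddCommGroup G]
    [InnerProductSpace ℂ G] {S : Set G} {ζ : lp (fun _ : ι => G) 2}
    (h : ∀ p, ζ p ∈ (Submodule.span ℂ S).topologicalClosure) :
    ζ ∈ (Submodule.span ℂ {x : lp (fun _ : ι => G) 2 | ∃ p, ∃ g ∈ S,
      x = lp.single (E := fun _ : ι => G) 2 p g}).topologicalClosure := by
  have hs := lp.hasSum_single (E := fun _ : ι => G) (p := 2) ENNReal.ofNat_ne_top ζ
  refine isClosed_closure.mem_of_tendsto hs (Eventually.of_forall fun F => ?_)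
  refine Submodule.sum_mem (Submodule.topologicalClosure _) fun p _ => ?_
  refine map_mem_closure (lp.singleContinuousLinearMap ℂ (fun _ : ι => G) 2 p).continuous (h p) ?_
  intro g hg
  induction hg using Submodule.span_induction with
  | mem g hg => exact Submodule.subset_span ⟨p, g, hg, rfl⟩
  | zero => rw [lp.single_zero]; exact Submodule.zero_mem _
  | add a b _ _ ha hb => rw [lp.single_add]; exact Submodule.add_mem _ ha hb
  | smul c a _ ha => rw [lp.single_smul]; exact Submodule.smul_mem _ _ ha

namespace IsFiniteProjection

theorem norm_compress_le_hat (hq : U.IsFiniteProjection q) {b : U.Amp k}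
    (hb : b ∈ U.corner U.groupAlgebra q) (j l : Fin k) (s : ℝ) (m : ℤ) :
    ‖compress (vacuum U.Space) (b j l) (shift ℂ s (windowVec m))‖ ≤ ‖U.hat b‖ := by
  have hbj : b j l ∈ transAlg (Fock U.Space) := (hq.mem_corner_group.1 hb).1 j l
  have h1 : ‖compress (vacuum U.Space) (b j l) (shift ℂ s (windowVec m))‖
      = ‖U.hat b (j, l, m)‖ := by
    rw [hat_apply (hq.sqIntegrable_corner hb), traceVec_eq, compress_shift_of_mem hbj, norm_shift,
      transAlg_tens norm_vacuum hbj, norm_tens, norm_vacuum, one_mul]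
  rw [h1]
  exact lp.norm_apply_le_norm two_ne_zero (U.hat b) _

variable [CompleteSpace H]

/-- Asymptotic orthogonality: if the symmetries `u n` over `L(ℝ)` converge weakly to `0`, then for
vectors `ζ`, `ζ'` orthogonal to `L²(ℝ) ⊗ Ω`, the vectors `u n ζ'` become orthogonal to `ζ b`,
uniformly over `b` in the unit ball of `L²`. The vector `ζ'` has to be right bounded. -/
theorem eventually_inner_le (hq : U.IsFiniteProjection q) (hU : U.IsMixing) {u : ℕ → U.Amp k}
    (hu : ∀ n, star (u n) = u n) (huu : ∀ n, u n * u n = q)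
    (huG : ∀ n i j, u n i j ∈ U.groupAlgebra) (hun : ∀ n i j ξ, ‖u n i j ξ‖ ≤ ‖ξ‖)
    (hw : ∀ i j h g, Tendsto (fun n => ⟪tens (vacuum U.Space) h,
      u n i j (tens (vacuum U.Space) g)⟫_ℂ) atTop (𝓝 0))
    {ζ ζ' : U.L2Ambient k} (hζ : U.vacProj k ζ = 0) (hζ' : U.vacProj k ζ' = 0) {C : ℝ}
    (hC : ∀ b ∈ U.corner U.groupAlgebra q, ‖U.rightMul b ζ'‖ ≤ C * ‖U.hat b‖)
    {ε : ℝ} (hε : 0 < ε) :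
    ∀ᶠ n in atTop, ∀ b ∈ U.corner U.groupAlgebra q,
      ‖⟪U.rightMul b ζ, U.leftMul (u n) ζ'⟫_ℂ‖ ≤ ε * ‖U.hat b‖ := by
  classical
  rw [vacProj_eq_zero_iff] at hζ hζ'
  let S : Set L2R := Set.range fun x : ℝ × ℤ => shift ℂ x.1 (windowVec x.2)
  have hmem := mem_closure_span_single (ζ := ζ) fun p =>
    U.flow.mem_closure_span_fwd_tens norm_vacuum U.flow_vacuum dense_span_windowVec (hζ p)
  -- the case of elementary tensors
  have hbase : ∀ (p : Fin k × Fin k × ℤ) (s : ℝ) (m : ℤ) (w : Fock U.Space),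
      ⟪vacuum U.Space, w⟫_ℂ = 0 → ∀ ε > 0, ∀ᶠ n in atTop, ∀ b ∈ U.corner U.groupAlgebra q,
      ‖⟪U.rightMul b (lp.single (E := fun _ : Fin k × Fin k × ℤ => U.CoreSpace) 2 p
        (U.flow.fwd (tens w (shift ℂ s (windowVec m))))), U.leftMul (u n) ζ'⟫_ℂ‖
          ≤ ε * ‖U.hat b‖ := by
    rintro ⟨i, j, r⟩ s m w hwΩ ε hε
    have hlim : Tendsto (fun n => ∑ l, ∑ t, ‖slice w (U.flow.bwd (u n i t (ζ' (t, l, r))))‖)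
        atTop (𝓝 (∑ l : Fin k, ∑ t : Fin k, 0)) := by
      refine tendsto_finsetSum _ fun l _ => tendsto_finsetSum _ fun t _ => ?_
      have h := U.flow.tendsto_slice_bwd norm_vacuum (U.flow_mixing hU)
        (a := fun n => u n i t) (fun n => huG n i t) (C := 1)
        (fun n ξ => by rw [one_mul]; exact hun n i t ξ) (hw i t) hwΩ (hζ' (t, l, r))
      simpa using h.norm
    simp only [Finset.sum_const_zero] at hlim
    filter_upwards [hlim.eventually (gt_mem_nhds hε)] with n hn b hb
    refine le_trans ?_ (mul_le_mul_of_nonneg_right hn.le (norm_nonneg _))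
    rw [inner_rightMul_left, lp.inner_single_left, rightMul_apply, inner_sum, Finset.sum_mul]
    refine (norm_sum_le _ _).trans (Finset.sum_le_sum fun l _ => ?_)
    rw [← star_star (star b l j), ← U.flow.inner_rho_left, leftMul_apply, inner_sum, Finset.sum_mul]
    refine (norm_sum_le _ _).trans (Finset.sum_le_sum fun t _ => ?_)
    have hbj : b j l ∈ transAlg (Fock U.Space) := (hq.mem_corner_group.1 hb).1 j l
    rw [Matrix.star_apply, star_star, UnitaryFlow.rho_apply, U.flow.bwd_fwd,
      transAlg_tens norm_vacuum hbj, U.flow.inner_fwd_left, inner_tens_left, mul_comm]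
    exact (norm_inner_le_norm _ _).trans
      (mul_le_mul_of_nonneg_right (hq.norm_compress_le_hat hb j l s m) (norm_nonneg _))
  -- the estimate passes to linear combinations
  have hspan : ∀ x ∈ Submodule.span ℂ {x : U.L2Ambient k | ∃ p, ∃ g ∈ {x : L2E (Fock U.Space) |
      ∃ g ∈ S, ∃ w, ⟪vacuum U.Space, w⟫_ℂ = 0 ∧ x = U.flow.fwd (tens w g)},
      x = lp.single (E := fun _ : Fin k × Fin k × ℤ => U.CoreSpace) 2 p g}, ∀ ε > 0,
      ∀ᶠ n in atTop, ∀ b ∈ U.corner U.groupAlgebra q,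
        ‖⟪U.rightMul b x, U.leftMul (u n) ζ'⟫_ℂ‖ ≤ ε * ‖U.hat b‖ := by
    intro x hx
    induction hx using Submodule.span_induction with
    | mem x hx =>
      obtain ⟨p, _, ⟨_, ⟨⟨s, m⟩, rfl⟩, w, hwΩ, rfl⟩, rfl⟩ := hx
      exact hbase p s m w hwΩ
    | zero =>
      intro ε hε
      refine Eventually.of_forall fun n b _ => ?_
      rw [map_zero, inner_zero_left, norm_zero]
      positivity
    | add x y _ _ hx hy =>
      intro ε hε
      filter_upwards [hx (ε / 2) (by positivity), hy (ε / 2) (by positivity)] with n h1 h2 b hb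
      rw [map_add, inner_add_left]
      refine (norm_add_le _ _).trans ((add_le_add (h1 b hb) (h2 b hb)).trans (le_of_eq ?_))
      ring
    | smul c x _ hx =>
      intro ε hε
      filter_upwards [hx (ε / (‖c‖ + 1)) (by positivity)] with n h1 b hb
      rw [map_smul, inner_smul_left, norm_mul, RCLike.norm_conj]
      calc ‖c‖ * ‖⟪U.rightMul b x, U.leftMul (u n) ζ'⟫_ℂ‖
          ≤ (‖c‖ + 1) * (ε / (‖c‖ + 1) * ‖U.hat b‖) :=
            mul_le_mul (by linarith) (h1 b hb) (norm_nonneg _) (by positivity)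
        _ = ε * ‖U.hat b‖ := by field_simp
  -- and to limits, as `ζ'` is right bounded
  obtain ⟨x, hx, hxd⟩ := Metric.mem_closure_iff.1 hmem (ε / (2 * (|C| + 1))) (by positivity)
  rw [dist_eq_norm] at hxd
  filter_upwards [hspan x hx (ε / 2) (by positivity)] with n h1 b hb
  have hb' := hq.star_mem_corner hb
  have hbG := (hq.mem_corner_group.1 hb').1
  have h2 : ‖⟪U.rightMul b (ζ - x), U.leftMul (u n) ζ'⟫_ℂ‖ ≤ ε / 2 * ‖U.hat b‖ := by
    rw [inner_rightMul_left, ← leftMul_rightMul (fun i j => groupAlgebra_le_core (huG n i j)) hbG]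
    refine (norm_inner_le_norm _ _).trans ?_
    have h3 : ‖U.leftMul (u n) (U.rightMul (star b) ζ')‖ ≤ (|C| + 1) * ‖U.hat b‖ := by
      refine (norm_leftMul_le hq.isStarProjection (hu n) (huu n) _).trans ((hC _ hb').trans ?_)
      rw [hq.norm_hat_star hb]
      exact mul_le_mul_of_nonneg_right (by linarith [le_abs_self C]) (norm_nonneg _)
    refine (mul_le_mul hxd.le h3 (norm_nonneg _) (by positivity)).trans (le_of_eq ?_)
    field_simp
  have h4 : ζ = (ζ - x) + x := by abel
  rw [h4, map_add, inner_add_left]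
  refine (norm_add_le _ _).trans ((add_le_add h2 (h1 b hb)).trans (le_of_eq ?_))
  ring

end IsFiniteProjection

end OrthRep

/-! ### Sub-bimodules of finite right dimension -/

section Subspace

variable {X : Type*} [NormedAddCommGroup X] [InnerProductSpace ℂ X] [CompleteSpace X]
  {K : Submodule ℂ X} [CompleteSpace K]

theorem inner_adjoint_subtype (η : X) (z : K) :
    ⟪ContinuousLinearMap.adjoint K.subtypeL η, z⟫_ℂ = ⟪η, (z : X)⟫_ℂ :=
  ContinuousLinearMap.adjoint_inner_left K.subtypeL z η

theorem norm_inner_le_adjoint_subtype (η : X) (z : K) :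
    ‖⟪η, (z : X)⟫_ℂ‖ ≤ ‖ContinuousLinearMap.adjoint K.subtypeL η‖ * ‖z‖ := by
  rw [← inner_adjoint_subtype]
  exact norm_inner_le_norm _ _

/-- The projection onto a subspace that is invariant under an operator and its adjoint commutes with
the operator. -/
theorem adjoint_subtype_apply {R R' : X → X} (hR : ∀ x y, ⟪R x, y⟫_ℂ = ⟪x, R' y⟫_ℂ)
    (hK : ∀ x ∈ K, R x ∈ K) (hK' : ∀ x ∈ K, R' x ∈ K) (η : X) :
    ContinuousLinearMap.adjoint K.subtypeL (R η)
      = ⟨R (ContinuousLinearMap.adjoint K.subtypeL η : K), hK _ (Subtype.coe_prop _)⟩ := by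
  refine ext_inner_right ℂ fun z => ?_
  rw [inner_adjoint_subtype, hR]
  have h := inner_adjoint_subtype η (⟨R' z, hK' _ z.2⟩ : K)
  rw [← h, Submodule.coe_inner, Submodule.coe_inner]
  exact (hR _ _).symm

end Subspace

namespace OrthRep

variable {H : Type*} [NormedAddCommGroup H] [InnerProductSpace ℝ H] {k : ℕ}
  {U : OrthRep H} {q : U.Amp k}

/-- The projection onto the orthogonal complement of the components in `L²(ℝ) ⊗ Ω`. -/
def vacCoproj (U : OrthRep H) (k : ℕ) : U.L2Ambient k →L[ℂ] U.L2Ambient k := 1 - U.vacProj k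

theorem vacCoproj_apply (ξ : U.L2Ambient k) : U.vacCoproj k ξ = ξ - U.vacProj k ξ := rfl

theorem vacProj_vacCoproj (ξ : U.L2Ambient k) : U.vacProj k (U.vacCoproj k ξ) = 0 := by
  rw [vacCoproj_apply, map_sub, vacProj_vacProj, sub_self]

theorem vacCoproj_eq_self {ξ : U.L2Ambient k} (h : U.vacProj k ξ = 0) : U.vacCoproj k ξ = ξ := by
  rw [vacCoproj_apply, h, sub_zero]

theorem inner_vacCoproj_left (ξ η : U.L2Ambient k) :
    ⟪U.vacCoproj k ξ, η⟫_ℂ = ⟪ξ, U.vacCoproj k η⟫_ℂ := by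
  rw [vacCoproj_apply, vacCoproj_apply, inner_sub_left, inner_sub_right, inner_vacProj_left]

theorem norm_vacCoproj_le (ξ : U.L2Ambient k) : ‖U.vacCoproj k ξ‖ ≤ ‖ξ‖ := by
  have h : ‖U.vacCoproj k ξ‖ * ‖U.vacCoproj k ξ‖ ≤ ‖ξ‖ * ‖U.vacCoproj k ξ‖ := by
    rw [← inner_self_eq_norm_mul_norm (𝕜 := ℂ), inner_vacCoproj_left,
      vacCoproj_eq_self (vacProj_vacCoproj ξ)]
    exact (RCLike.re_le_norm _).trans (norm_inner_le_norm _ _)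
  rcases (norm_nonneg (U.vacCoproj k ξ)).eq_or_lt with h0 | h0
  · rw [← h0]; exact norm_nonneg _
  · exact le_of_mul_le_mul_right h h0

theorem vacCoproj_leftMul {a : U.Amp k} (ha : ∀ i j, a i j ∈ U.groupAlgebra)
    (ξ : U.L2Ambient k) : U.vacCoproj k (U.leftMul a ξ) = U.leftMul a (U.vacCoproj k ξ) := by
  rw [vacCoproj_apply, vacCoproj_apply, map_sub, vacProj_leftMul ha]

variable [CompleteSpace H]

theorem vacCoproj_rightMul {b : U.Amp k} (hb : ∀ i j, b i j ∈ U.groupAlgebra)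
    (ξ : U.L2Ambient k) : U.vacCoproj k (U.rightMul b ξ) = U.rightMul b (U.vacCoproj k ξ) := by
  rw [vacCoproj_apply, vacCoproj_apply, map_sub, vacProj_rightMul hb]

namespace IsFiniteProjection

/-- A bimodule of finite right dimension over `L(ℝ)^T` has no component orthogonal to
`L²(L(ℝ)^T)`. -/
theorem le_L2 (hq : U.IsFiniteProjection q) (hU : U.IsMixing) {A : Set (U.Amp k)}
    (hAL : A ⊆ U.corner U.groupAlgebra q) {u : ℕ → U.Amp k} (huA : ∀ n, u n ∈ A)
    (hu : ∀ n, star (u n) = u n) (huu : ∀ n, u n * u n = q)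
    (hun : ∀ n i j ξ, ‖u n i j ξ‖ ≤ ‖ξ‖)
    (hw : ∀ i j h g, Tendsto (fun n => ⟪tens (vacuum U.Space) h,
      u n i j (tens (vacuum U.Space) g)⟫_ℂ) atTop (𝓝 0))
    {K : Submodule ℂ (U.L2Ambient k)} [CompleteSpace K]
    (hK : U.IsSubBimodule (U.corner U.continuousCore q) A (U.corner U.groupAlgebra q) K)
    (hfin : U.HasFiniteRightDim (U.corner U.continuousCore q) (U.corner U.groupAlgebra q) q K) :
    K ≤ U.L2 (U.corner U.groupAlgebra q) := by
  obtain ⟨v, hvB, hvlin, hvsum⟩ := hfin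
  have huG : ∀ n i j, u n i j ∈ U.groupAlgebra := fun n =>
    (hq.mem_corner_group.1 (hAL (huA n))).1
  have hKr : ∀ b ∈ U.corner U.groupAlgebra q, ∀ ξ ∈ K, U.rightMul b ξ ∈ K := fun b hb ξ hξ =>
    hK.right b hb ξ hξ _ (hq.isRightMul (hq.mem_corner_group.1 hb).1 (hK.le hξ))
  have hKl : ∀ n, ∀ ξ ∈ K, U.leftMul (u n) ξ ∈ K := fun n ξ hξ =>
    hK.left _ (huA n) ξ hξ _ (hq.isLeftMul _ (hK.le hξ))
  let J : K →L[ℂ] U.L2Ambient k := K.subtypeL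
  let J' : U.L2Ambient k →L[ℂ] K := ContinuousLinearMap.adjoint J
  let vL : K →L[ℂ] lp (fun _ : ℕ => U.L2Ambient k) 2 := v.toContinuousLinearMap
  let vL' : lp (fun _ : ℕ => U.L2Ambient k) 2 →L[ℂ] K := ContinuousLinearMap.adjoint vL
  let sg : ℕ → U.L2Ambient k →L[ℂ] lp (fun _ : ℕ => U.L2Ambient k) 2 := fun i =>
    lp.singleContinuousLinearMap ℂ (fun _ : ℕ => U.L2Ambient k) 2 i
  let T : ℕ → U.L2Ambient k →L[ℂ] U.L2Ambient k := fun i => U.vacCoproj k ∘L J ∘L vL' ∘L sg i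
  let D : ℕ → U.L2Ambient k → U.L2Ambient k := fun i η => v (J' (U.vacCoproj k η)) i
  have hTD : ∀ i x y, ⟪T i x, y⟫_ℂ = ⟪x, D i y⟫_ℂ := by
    intro i x y
    change ⟪U.vacCoproj k (J (vL' (sg i x))), y⟫_ℂ = _
    rw [inner_vacCoproj_left, ← ContinuousLinearMap.adjoint_inner_right,
      ContinuousLinearMap.adjoint_inner_left]
    exact lp.inner_single_left (𝕜 := ℂ) (G := fun _ : ℕ => U.L2Ambient k) i x _
  have hDB : ∀ i y, D i y ∈ U.L2 (U.corner U.groupAlgebra q) := fun i y => hvB _ i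
  have hDr : ∀ b ∈ U.corner U.groupAlgebra q, ∀ i y, D i (U.rightMul b y)
      = U.rightMul b (D i y) := by
    intro b hb i y
    have hbG := (hq.mem_corner_group.1 hb).1
    change v (J' (U.vacCoproj k (U.rightMul b y))) i = _
    rw [vacCoproj_rightMul hbG]
    change v (ContinuousLinearMap.adjoint K.subtypeL _) i = _
    rw [adjoint_subtype_apply (U.inner_rightMul_left b) (hKr b hb)
      (hKr _ (hq.star_mem_corner hb))]
    exact hq.isRightMul_eq hbG (hvlin b hb _ _ (hq.isRightMul hbG (hK.le (Subtype.coe_prop _))) i)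
  have hTr : ∀ b ∈ U.corner U.groupAlgebra q, ∀ i x, T i (U.rightMul b x)
      = U.rightMul b (T i x) := by
    intro b hb i x
    refine ext_inner_right ℂ fun y => ?_
    rw [hTD, inner_rightMul_left, ← hDr _ (hq.star_mem_corner hb), ← hTD, inner_rightMul_left]
  have hvL' : ∀ x, ‖vL' x‖ ≤ ‖x‖ := fun x => by
    refine (ContinuousLinearMap.le_opNorm _ _).trans ?_
    have h : ‖vL'‖ ≤ 1 := by
      change ‖ContinuousLinearMap.adjoint vL‖ ≤ 1
      rw [LinearIsometryEquiv.norm_map]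
      exact v.norm_toContinuousLinearMap_le
    exact mul_le_of_le_one_left (norm_nonneg _) h
  have hTn : ∀ i x, ‖T i x‖ ≤ ‖x‖ := fun i x =>
    (norm_vacCoproj_le _).trans ((hvL' _).trans
      (lp.norm_single (E := fun _ : ℕ => U.L2Ambient k) (by norm_num) i x).le)
  -- `ζ i` is the component of `ξ i ∈ K` orthogonal to `L²(ℝ) ⊗ Ω`; it is right bounded
  let ξ : ℕ → K := fun i => vL' (sg i (U.hat q))
  let ζ : ℕ → U.L2Ambient k := fun i => T i (U.hat q)
  have hζξ : ∀ i, ζ i = U.vacCoproj k (ξ i) := fun i => rfl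
  have hζ0 : ∀ i, U.vacProj k (ζ i) = 0 := fun i => vacProj_vacCoproj _
  have hζb : ∀ b ∈ U.corner U.groupAlgebra q, ∀ i, U.rightMul b (ζ i) = T i (U.hat b) := by
    intro b hb i
    rw [← hTr b hb, hq.rightMul_hat_self hb]
  have hζbn : ∀ i, ∀ b ∈ U.corner U.groupAlgebra q, ‖U.rightMul b (ζ i)‖ ≤ 1 * ‖U.hat b‖ := by
    intro i b hb
    rw [hζb b hb, one_mul]
    exact hTn i _
  have hsum : Summable fun i => ‖ζ i‖ ^ 2 := by
    refine Summable.of_nonneg_of_le (fun i => by positivity) (fun i => ?_)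
      (ENNReal.summable_toReal hvsum.ne)
    have h1 : RCLike.re ⟪U.unitTensor i (U.hat q), v.toContinuousLinearMap
        (ContinuousLinearMap.adjoint v.toContinuousLinearMap (U.unitTensor i (U.hat q)))⟫_ℂ
        = ‖ξ i‖ ^ 2 := by
      rw [← ContinuousLinearMap.adjoint_inner_left, inner_self_eq_norm_sq]
      rfl
    rw [h1, ENNReal.toReal_ofReal (by positivity), hζξ]
    exact pow_le_pow_left₀ (norm_nonneg _) (norm_vacCoproj_le _) 2
  -- the entries `T i ^* u T j` of a matrix over `L(ℝ)^T`; by the trace property, those of one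
  -- column are dominated by a square summable sequence
  have hdom : ∀ n i j, ‖D i (U.leftMul (u n) (ζ j))‖ ≤ ‖ζ i‖ := by
    intro n i j
    refine hq.norm_le_of_inner (hDB i _) (norm_nonneg _) fun b hb => ?_
    have hb' := hq.star_mem_corner hb
    rw [← hTD, ← hζb b hb, inner_rightMul_left,
      ← leftMul_rightMul (fun i j => groupAlgebra_le_core (huG n i j))
        (hq.mem_corner_group.1 hb').1, hζb _ hb', ← hu n, ← inner_leftMul_left,
      ← hq.norm_hat_star hb]
    exact (norm_inner_le_norm _ _).trans (mul_le_mul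
      (norm_leftMul_le hq.isStarProjection (hu n) (huu n) _) (hTn j _) (norm_nonneg _)
      (norm_nonneg _))
  have hlim : ∀ i j, Tendsto (fun n => D i (U.leftMul (u n) (ζ j))) atTop (𝓝 0) := by
    intro i j
    rw [Metric.tendsto_nhds]
    intro ε hε
    filter_upwards [hq.eventually_inner_le hU hu huu huG hun hw (hζ0 i) (hζ0 j) (hζbn j)
      (half_pos hε)] with n hn
    rw [dist_zero_right]
    refine lt_of_le_of_lt (hq.norm_le_of_inner (hDB i _) (half_pos hε).le fun b hb => ?_)
      (half_lt_self hε)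
    rw [← hTD, ← hζb b hb]
    exact hn b hb
  have hJ : ∀ n j, ‖J' (U.leftMul (u n) (ζ j))‖ ^ 2
      = ∑' i, ‖D i (U.leftMul (u n) (ζ j))‖ ^ 2 := by
    intro n j
    rw [← v.norm_map, lp_norm_sq]
    refine tsum_congr fun i => ?_
    change _ = ‖v (J' (U.vacCoproj k (U.leftMul (u n) (ζ j)))) i‖ ^ 2
    rw [vacCoproj_leftMul (huG n), vacCoproj_eq_self (hζ0 j)]
  have hJlim : ∀ j, Tendsto (fun n => ‖J' (U.leftMul (u n) (ζ j))‖ ^ 2) atTop (𝓝 0) := by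
    intro j
    simp only [hJ]
    have h := tendsto_tsum_of_dominated_convergence (𝓕 := atTop)
      (f := fun n i => ‖D i (U.leftMul (u n) (ζ j))‖ ^ 2) (g := fun _ => 0) hsum
      (fun i => by simpa using (hlim i j).norm.pow 2)
      (Eventually.of_forall fun n i => by
        rw [Real.norm_of_nonneg (by positivity)]
        exact pow_le_pow_left₀ (norm_nonneg _) (hdom n i j) 2)
    simpa using h
  have hζzero : ∀ j, ζ j = 0 := by
    intro j
    have hqζ : U.leftMul q (ζ j) = ζ j := by
      rw [hζξ, ← vacCoproj_leftMul hq.mem, hq.leftMul_self (hK.le (ξ j).2)]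
    have hbound : ∀ n, (‖ζ j‖ ^ 2) ^ 2 ≤ ‖J' (U.leftMul (u n) (ζ j))‖ ^ 2 * ‖ξ j‖ ^ 2 := by
      intro n
      rw [← mul_pow]
      refine pow_le_pow_left₀ (by positivity) ?_ 2
      have h1 : U.leftMul (u n) (ζ j) = U.vacCoproj k (U.leftMul (u n) (ξ j)) := by
        rw [vacCoproj_leftMul (huG n), hζξ]
      have h2 : ‖U.leftMul (u n) (ζ j)‖ ^ 2
          = RCLike.re ⟪U.leftMul (u n) (ζ j), U.leftMul (u n) (ξ j : U.L2Ambient k)⟫_ℂ := by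
        rw [← inner_self_eq_norm_sq (𝕜 := ℂ)]
        conv_lhs => rw [h1, inner_vacCoproj_left, vacCoproj_eq_self (vacProj_vacCoproj _),
          ← inner_vacCoproj_left, ← h1]
      rw [← norm_leftMul_eq hq.isStarProjection (hu n) (huu n) hqζ, h2]
      refine (RCLike.re_le_norm _).trans
        ((norm_inner_le_adjoint_subtype _ (⟨_, hKl n _ (ξ j).2⟩ : K)).trans ?_)
      exact mul_le_mul_of_nonneg_left (norm_leftMul_le hq.isStarProjection (hu n) (huu n) _)
        (norm_nonneg _)
    have h1 := ge_of_tendsto' ((hJlim j).mul_const (‖ξ j‖ ^ 2)) hbound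
    rw [zero_mul] at h1
    have h2 : (‖ζ j‖ ^ 2) ^ 2 = 0 := le_antisymm h1 (by positivity)
    simpa using h2
  -- `T i` is right linear, so it vanishes as soon as `T i q̂ = ζ i` does
  have hTB : ∀ i, ∀ η ∈ U.L2 (U.corner U.groupAlgebra q), T i η = 0 := by
    intro i η hη
    refine closure_minimal ?_ (isClosed_eq (T i).continuous continuous_const) (hq.mem_L2_iff.1 hη)
    rintro _ ⟨b, hb, rfl⟩
    change T i (U.hat b) = 0
    rw [← hζb b hb, hζzero, map_zero]
  intro x hx
  refine hq.mem_L2_of_vacProj (hK.le hx) ?_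
  have h1 : ⟪U.vacCoproj k x, U.vacCoproj k x⟫_ℂ = 0 := by
    have h2 : ⟪U.vacCoproj k x, U.vacCoproj k x⟫_ℂ = ⟪J' (U.vacCoproj k x), (⟨x, hx⟩ : K)⟫_ℂ := by
      rw [ContinuousLinearMap.adjoint_inner_left, ← inner_vacCoproj_left,
        vacCoproj_eq_self (vacProj_vacCoproj x)]
      rfl
    rw [h2, ← v.inner_map_map, lp.inner_eq_tsum]
    refine (tsum_congr fun i => ?_).trans tsum_zero
    change ⟪D i x, v ⟨x, hx⟩ i⟫_ℂ = 0
    rw [← inner_conj_symm, ← hTD, hTB i _ (hvB _ i), inner_zero_left, map_zero]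
  rw [inner_self_eq_zero, vacCoproj_apply, sub_eq_zero] at h1
  exact h1.symm

/-! ### Relative commutants -/

/-- A matrix over the core whose vector `x̂` lies in the components in `L²(ℝ) ⊗ Ω` is a matrix over
`L(ℝ)`. -/
theorem mem_corner_of_vacProj (hq : U.IsFiniteProjection q) {x : U.Amp k}
    (hx : x ∈ U.corner U.continuousCore q) (h : U.vacProj k (U.hat x) = U.hat x) :
    x ∈ U.corner U.groupAlgebra q := by
  have hx' := hq.mem_corner_core.1 hx
  obtain ⟨b, hb, hbx⟩ := hq.exists_expectation hx
  have hb' := hq.mem_corner_group.1 hb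
  suffices x = b by rw [this]; exact hb
  refine Matrix.ext fun i j => ?_
  rw [← sub_eq_zero]
  have hd : x i j - b i j ∈ U.continuousCore := sub_mem (hx'.1 i j) (groupAlgebra_le_core (hb'.1 i j))
  refine core_eq_zero hd fun g => ?_
  have hz : (x i j - b i j) ∘L tens (vacuum U.Space) = 0 := by
    refine ContinuousLinearMap.ext_on dense_span_windowVec ?_
    rintro _ ⟨⟨s, n⟩, rfl⟩
    have h1 : (x i j - b i j) (tens (vacuum U.Space) (windowVec n)) = 0 := by
      have h2 : x i j (U.traceVec n) = b i j (U.traceVec n) := by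
        rw [← hat_apply (hq.sqIntegrable_corner hx), ← hat_apply (hq.sqIntegrable_corner hb), hbx, h]
      rw [sub_apply, sub_eq_zero]
      exact h2
    change (x i j - b i j) (tens (vacuum U.Space) (shift ℂ s (windowVec n))) = 0
    rw [core_tens_shift hd, h1, map_zero]
  exact congrArg (fun T : L2R →L[ℂ] U.CoreSpace => T g) hz

/-- Matrices over the core that commute with weakly null symmetries of `L(ℝ)^T` belong to
`L(ℝ)^T`. -/
theorem mem_corner_of_commute (hq : U.IsFiniteProjection q) (hU : U.IsMixing) {A : Set (U.Amp k)}
    (hAL : A ⊆ U.corner U.groupAlgebra q) {u : ℕ → U.Amp k} (huA : ∀ n, u n ∈ A)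
    (hu : ∀ n, star (u n) = u n) (huu : ∀ n, u n * u n = q)
    (hun : ∀ n i j ξ, ‖u n i j ξ‖ ≤ ‖ξ‖)
    (hw : ∀ i j h g, Tendsto (fun n => ⟪tens (vacuum U.Space) h,
      u n i j (tens (vacuum U.Space) g)⟫_ℂ) atTop (𝓝 0))
    {x : U.Amp k} (hx : x ∈ U.corner U.continuousCore q) (hxA : ∀ a ∈ A, a * x = x * a) :
    x ∈ U.corner U.groupAlgebra q := by
  have hx' := hq.mem_corner_core.1 hx
  have huB : ∀ n, u n ∈ U.corner U.groupAlgebra q := fun n => hAL (huA n)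
  have huG : ∀ n i j, u n i j ∈ U.groupAlgebra := fun n => (hq.mem_corner_group.1 (huB n)).1
  let T : U.L2Ambient k →L[ℂ] U.L2Ambient k := U.vacCoproj k ∘L U.leftMul x
  let ζ : U.L2Ambient k := T (U.hat q)
  have hT : ∀ b ∈ U.corner U.groupAlgebra q, U.rightMul b ζ = T (U.hat b) := by
    intro b hb
    have hbG := (hq.mem_corner_group.1 hb).1
    rw [← hq.rightMul_hat_self hb]
    change U.rightMul b (U.vacCoproj k (U.leftMul x (U.hat q)))
      = U.vacCoproj k (U.leftMul x (U.rightMul b (U.hat q)))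
    rw [leftMul_rightMul hx'.1 hbG, vacCoproj_rightMul hbG]
  have hζ0 : U.vacProj k ζ = 0 := vacProj_vacCoproj _
  have hζx : ζ = U.vacCoproj k (U.hat x) := by
    change U.vacCoproj k (U.leftMul x (U.hat q)) = _
    rw [← (hq.sqIntegrable.left_mul x).2, hx'.2.2]
  have hcomm : ∀ n, U.leftMul (u n) ζ = U.rightMul (u n) ζ := by
    intro n
    rw [hT _ (huB n), hζx, ← vacCoproj_leftMul (huG n),
      ← ((hq.sqIntegrable_corner hx).left_mul (u n)).2, hxA _ (huA n),
      ((hq.sqIntegrable_corner (huB n)).left_mul x).2]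
    rfl
  have hqζ : U.leftMul q ζ = ζ := by
    rw [hζx, ← vacCoproj_leftMul hq.mem, ← ((hq.sqIntegrable_corner hx).left_mul q).2, hx'.2.1]
  have hnorm : ∀ n, ‖U.leftMul (u n) ζ‖ = ‖ζ‖ := fun n =>
    norm_leftMul_eq hq.isStarProjection (hu n) (huu n) hqζ
  have hhat : ∀ n, ‖U.hat (u n)‖ = ‖U.hat q‖ := by
    intro n
    have h1 : U.hat (u n) = U.leftMul (u n) (U.hat q) := by
      rw [← (hq.sqIntegrable.left_mul (u n)).2, (hq.mem_corner_group.1 (huB n)).2.2]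
    rw [h1]
    refine norm_leftMul_eq hq.isStarProjection (hu n) (huu n) ?_
    rw [← (hq.sqIntegrable.left_mul q).2, hq.mul_self]
  have hζzero : ‖ζ‖ * ‖ζ‖ ≤ 0 := by
    refine le_of_forall_pos_le_add fun ε hε => ?_
    have hev := hq.eventually_inner_le hU hu huu huG hun hw hζ0 hζ0 (C := ‖T‖)
      (fun b hb => by rw [hT b hb]; exact T.le_opNorm _) (ε := ε / (‖U.hat q‖ + 1)) (by positivity)
    obtain ⟨n, hn⟩ := hev.exists
    have h1 := hn _ (huB n)
    rw [← hcomm n, inner_self_eq_norm_sq_to_K, norm_pow, RCLike.norm_ofReal, abs_norm, hnorm,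
      hhat, pow_two] at h1
    rw [zero_add]
    refine h1.trans ?_
    rw [div_mul_eq_mul_div, div_le_iff₀ (by positivity)]
    nlinarith [norm_nonneg (U.hat q)]
  have hζz : ζ = 0 := by
    rw [← norm_eq_zero]
    nlinarith [norm_nonneg ζ]
  refine hq.mem_corner_of_vacProj hx ?_
  rw [hζx, vacCoproj_apply, sub_eq_zero] at hζz
  exact hζz.symm

end IsFiniteProjection

end OrthRep

end

theorem theorem3p3 {H : Type*} [NormedAddCommGroup H] [InnerProductSpace ℝ H] [CompleteSpace H]
    [TopologicalSpace.SeparableSpace H] (U : OrthRep H) (hU : U.IsMixing)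
    (k : ℕ) (q : U.Amp k) (hq : IsStarProjection q) (hq0 : q ≠ 0)
    (hqL : ∀ i j, q i j ∈ U.groupAlgebra) (hqT : U.ampTrace q < ⊤)
    (A : Set (U.Amp k)) (hA : U.IsVNAlgebraWithUnit q A)
    (hAL : A ⊆ U.corner U.groupAlgebra q) (hdiff : U.IsDiffuse A) :
    (∀ (K : Submodule ℂ (U.L2Ambient k)) [CompleteSpace K],
      U.IsSubBimodule (U.corner U.continuousCore q) A (U.corner U.groupAlgebra q) K →
      U.HasFiniteRightDim (U.corner U.continuousCore q) (U.corner U.groupAlgebra q) q K →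
      K ≤ U.L2 (U.corner U.groupAlgebra q)) ∧
    ∀ x ∈ U.corner U.continuousCore q, (∀ a ∈ A, a * x = x * a) →
      x ∈ U.corner U.groupAlgebra q := by
  have hqf : U.IsFiniteProjection q := ⟨hq, hqL, hqT⟩
  obtain ⟨u, huA, hu, huu, hun, hw⟩ := OrthRep.exists_weakly_null_symmetries hq hA hdiff
  exact ⟨fun K _ hK hfin => hqf.le_L2 hU hAL huA hu huu hun hw hK hfin,
    fun x hx hxA => hqf.mem_corner_of_commute hU hAL huA hu huu hun hw hx hxA⟩
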